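/- Let $X_1,X_2,\dots$ be i.i.d. $\mathrm{Exp}(1)$ random variables (the values of the candidates), and let $r(0),r(1),\dots$ be integers with $r(0)=1$ and $r(m)\le r(m+1)\le r(m)+1$ for all $m\ge0$. Candidates are examined one at a time; if $m$ candidates have been accepted so far, the next one is accepted if and only if her value exceeds the threshold $Y_m$, which is the $r(m)$-th largest of the $m$ accepted values, interpreted as $Y_m=0$ when $r(m)=m+1$. Let $I_n\in\{0,1\}$ be the indicator that candidate $n$ is accepted, $M_n=\sum_{k=1}^n I_k$, let $N_m$ be the index of the $m$-th accepted candidate ($N_0=0$), $L_n=n-N_{M_n}$ the number of candidates examined after the last accepted one, and $P_n=e^{-Y_{M_{n-1}}}$. Put $\delta_m=1$ if $r(m)=r(m-1)$ and $\delta_m=0$ otherwise ($m\ge1$). Suppose that $\sum_{k=1}^\infty \delta_k/r(k)=\infty$ and that $r(m)\to\infty$ as $m\to\infty$. Then: 1. For every $n\ge1$, $P_n=\mathbb E(I_n\mid X_1,\dots,X_{n-1})$ a.s. 2. There exist a deterministic real sequence $a_n\to\infty$ and, for each $n$, on an extension of the probability space, $\{0,1\}$-valued random variables $(I'_k)_k$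 (depending on $n$) that conditionally on $P_n$ are i.i.d. $\mathrm{Bernoulli}(P_n)$, such that, with probability tending to $1$ as $n\to\infty$, the interval $J_n=[\,n-a_nP_n^{-1},\,n\,]$ satisfies $J_n\subseteq[1,n]$, i.e. $n-a_nP_n^{-1}\ge 1$, and $I_k=I'_k$ for all integers $k\in J_n$. 3. Conditionally on $P_n$, $d_{TV}(L_n,\mathrm{Ge}(P_n))\to0$ as $n\to\infty$, where $\mathrm{Ge}(p)$ is the geometric distribution $\Pr(j)=p(1-p)^{j-1}$, $j\ge1$; that is, the total variation distance between the conditional law of $L_n$ given $P_n$ and $\mathrm{Ge}(P_n)$ converges to $0$ in probability. 4. Conditionally on $P_n$, $P_nL_n\to\mathrm{Exp}(1)$ in distribution; that is, for every bounded continuous $f:\mathbb R\to\mathbb R$, $\mathbb E[f(P_nL_n)\mid P_n]\to\int_0^\infty f(x)e^{-x}\,dx$ in probability. -/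

import Mathlib

open MeasureTheory ProbabilityTheory Filter Topology
open scoped ENNReal BoundedContinuousFunction

noncomputable section

namespace Hiring

/-- Admissible parameter sequences of a rank-based strategy:
`r 0 = 1` and `r m ≤ r (m + 1) ≤ r m + 1`. -/
def IsRankSequence (r : ℕ → ℕ) : Prop :=
  r 0 = 1 ∧ ∀ m, r m ≤ r (m + 1) ∧ r (m + 1) ≤ r m + 1

/-- The indicator `δ_m` of `r m = r (m - 1)`, used for `m ≥ 1`. -/
def delta (r : ℕ → ℕ) (m : ℕ) : ℝ := if r m = r (m - 1) then 1 else 0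

/-- Given the multiset `s` of the `m` values accepted so far, the `r m`-th largest of them,
interpreted as `0` when `r m = m + 1`. -/
def threshold (r : ℕ → ℕ) (s : Multiset ℝ) : ℝ :=
  (s.sort (fun a b => a ≥ b)).getD (r s.card - 1) 0

/-- The values accepted among the candidates `1, …, n`; candidate `k ≥ 1` has value `x k`
(the entry `x 0` is never used). The next candidate is accepted if and only if her value exceeds
the current threshold. -/
def acceptedValues (r : ℕ → ℕ) (x : ℕ → ℝ) : ℕ → Multiset ℝ
  | 0 => 0
  | n + 1 =>
    if threshold r (acceptedValues r x n) < x (n + 1) then x (n + 1) ::ₘ acceptedValues r x n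
    else acceptedValues r x n

/-- The threshold `Y_{M_{n-1}}` in force when candidate `n ≥ 1` is examined. -/
def currentThreshold (r : ℕ → ℕ) (x : ℕ → ℝ) (n : ℕ) : ℝ :=
  threshold r (acceptedValues r x (n - 1))

/-- Candidate `n ≥ 1` is accepted. -/
def Accepted (r : ℕ → ℕ) (x : ℕ → ℝ) (n : ℕ) : Prop := currentThreshold r x n < x n

open scoped Classical in
/-- `M_n`, the number of candidates accepted among `1, …, n`. -/
def numAccepted (r : ℕ → ℕ) (x : ℕ → ℝ) (n : ℕ) : ℕ :=
  ((Finset.Icc 1 n).filter (Accepted r x)).card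

/-- `N_m`, the index of the `m`-th accepted candidate (`N_0 = 0`). -/
def acceptIndex (r : ℕ → ℕ) (x : ℕ → ℝ) (m : ℕ) : ℕ := sInf {n | m ≤ numAccepted r x n}

/-- `L_n = n - N_{M_n}`, the number of candidates examined after the last accepted one
among `1, …, n`. -/
def lastGap (r : ℕ → ℕ) (x : ℕ → ℝ) (n : ℕ) : ℕ := n - acceptIndex r x (numAccepted r x n)

/-- `P_n = exp (-Y_{M_{n-1}})`, the probability that candidate `n ≥ 1` is accepted given
the past. -/
def acceptProb (r : ℕ → ℕ) (x : ℕ → ℝ) (n : ℕ) : ℝ := Real.exp (-currentThreshold r x n)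

/-- The geometric distribution started at `1` with success probability `p ∈ (0, 1]`. -/
def geomFromOne (p : ℝ) : Measure ℕ :=
  Measure.sum fun j : ℕ => ENNReal.ofReal (p * (1 - p) ^ j) • Measure.dirac (j + 1)

/-- The total variation distance of two probability measures. -/
def dTV {E : Type*} [MeasurableSpace E] (μ ν : Measure E) : ℝ :=
  ⨆ A : {A : Set E // MeasurableSet A}, |μ.real A - ν.real A|

/-- Conditionally on `Z`, the `{0,1}`-valued random variables `J 0, J 1, …` (`true` stands for `1`)
are independent and Bernoulli distributed with parameter `Z`. -/
def CondIIDBernoulli {Ω : Type*} [MeasurableSpace Ω] (μ : Measure Ω) (Z : Ω → ℝ)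
    (J : ℕ → Ω → Bool) : Prop :=
  Measurable Z ∧ (∀ k, Measurable (J k)) ∧
    ∀ (S : Finset ℕ) (b : ℕ → Bool),
      μ⟦{ω | ∀ k ∈ S, J k ω = b k} | MeasurableSpace.comap Z inferInstance⟧
        =ᵐ[μ] fun ω => ∏ k ∈ S, if b k then Z ω else 1 - Z ω

/-- `V n → ν` in distribution conditionally on `Z n`: for every bounded continuous `f`, the
integral of `f` against the conditional law of `V n` given `Z n` converges in probability
to `∫ f dν`. -/
def CondTendstoInDistribution {Ω : Type*} [MeasurableSpace Ω] (μ : Measure Ω) [IsFiniteMeasure μ]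
    (V Z : ℕ → Ω → ℝ) (ν : Measure ℝ) : Prop :=
  ∀ f : ℝ →ᵇ ℝ,
    TendstoInMeasure μ (fun n ω => ∫ v, f v ∂(condDistrib (V n) (Z n) μ (Z n ω))) atTop
      (fun _ => ∫ v, f v ∂ν)

end Hiring

end

noncomputable section

namespace Hiring

set_option linter.unusedSectionVars false

/-! ### Rank sequences and thresholds -/

/-! Write Y_t for the threshold in force after t candidates and M_t for the number accepted.
Thresholds never decrease, so every candidate so far whose value exceeds the current threshold has
been accepted; hence fewer than r(M_t) of the first t values exceed Y_t, and the threshold is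
controlled by counts in an i.i.d. sample.

Divergence. The mean of M_n is the sum of E e^{-Y_k} over k < n, while r(M_n) is at least n e^{-Y_n}
up to a small error, by a grid argument uniform in the level. So the expected number of stalls, M_n
+ 1 - r(M_n), is at most the sum over k < n of E e^{-Y_k} - E e^{-Y_n}, up to O(n^{3/4}). Such
averages of a decreasing sequence telescope, whence the stall counts at times n, divided by n(n+1),
are a.s. summable (`IsExpSequence.ae_summable_stallCount`). Bounded thresholds would force M_n and
r(m) to grow linearly, and Abel summation would then make the series of δ_k / r(k) converge. Hence
Y_n tends to infinity a.s. (`IsExpSequence.ae_tendsto_threshold`), and with it M_n and r(M_n), while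
P_n tends to 0.

Freezing the threshold. Let N = n - 1, fix a large B and stop at the first t with (N - t) e^{-Y_t} ≤
B. The number of candidates after t exceeding Y_t is then bounded in probability. A rise of the
threshold by ε would have to pass almost all sample values in an interval of length ε, and no more
values can be passed than there are acceptances; but below a sample value of sufficiently low rank
every such interval contains many others (`IsExpSequence.measure_gapEvent_le`). So with high
probability the threshold moves by at most ε, no later value falls within ε of it, and after t
acceptance means exceeding Y_t (`windowGood_of`).

Decoupling. Given the past up to t, the exceedances form a Bernoulli set with parameter p =
e^{-Y_t}, and by memorylessness the excesses depend on the set only through its size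
(`IsExpSequence.setLIntegral_over`). So P_n feels the last a / P_n indicators only through their
contribution to that size. This contribution is O(a) on average, whereas the earlier indicators
contribute a binomial variable of variance of order B; by Stein's identity, removing the shift costs
O(a / √B) (`bernSum_integral_le`). Replacing p by P_n costs a(e^ε - 1). The outcome is
`IsExpSequence.eventually_windowComparison`, a one-sided inequality for all [0,1]-valued tests,
which amounts to closeness in total variation.

Consequences. The first claim is the freshness of candidate n. For the second, a maximal coupling
conditional on P_n is completed by independent seeds outside the window, and the window constant is
sent slowly to infinity. For the third, the distance from n to the last success is geometric
starting at 0, and moving the start to 1 costs P_n. The fourth follows since p times a geometric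
variable tends to an exponential one as p tends to 0. -/

theorem IsRankSequence.monotone {r : ℕ → ℕ} (hr : IsRankSequence r) : Monotone r :=
  monotone_nat_of_le_succ fun m => (hr.2 m).1

theorem IsRankSequence.one_le {r : ℕ → ℕ} (hr : IsRankSequence r) (m : ℕ) : 1 ≤ r m := by
  have := hr.monotone (Nat.zero_le m)
  rwa [hr.1] at this

/-- In a decreasing list the entries with an upward closed property form an initial segment, so a
question about the entry in position k becomes a question about a count. -/
theorem getD_iff_of_sorted (q : ℝ → Prop) [DecidablePred q] (hq : ∀ a b, b ≤ a → q b → q a)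
    (l : List ℝ) (hl : l.Pairwise (fun a b => a ≥ b)) (k : ℕ) :
    (k < l.length ∧ q (l.getD k 0)) ↔ k < (l.filter q).length := by
  induction l generalizing k with
  | nil => simp
  | cons h t ih =>
    rw [List.pairwise_cons] at hl
    by_cases hc : q h
    · cases k with
      | zero => simp [hc]
      | succ j => simpa [hc] using ih hl.2 j
    · have h0 : (h :: t).filter q = [] := by
        rw [List.filter_eq_nil_iff]
        intro a ha
        rcases List.mem_cons.1 ha with rfl | ha
        · simpa using hc
        · simp only [decide_eq_true_eq]
          exact fun h2 => hc (hq _ _ (hl.1 a ha) h2)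
      rw [h0]
      simp only [List.length_nil, Nat.not_lt_zero, iff_false, not_and]
      intro hk
      rw [List.getD_eq_getElem _ _ hk]
      have : (h :: t)[k] ∈ h :: t := List.getElem_mem hk
      rcases List.mem_cons.1 this with h1 | h1
      · rw [h1]; exact hc
      · exact fun h2 => hc (hq _ _ (hl.1 _ h1) h2)

theorem sort_getD_iff (q : ℝ → Prop) [DecidablePred q] (hq : ∀ a b, b ≤ a → q b → q a)
    (s : Multiset ℝ) (k : ℕ) :
    (k < s.card ∧ q ((s.sort (fun a b => a ≥ b)).getD k 0)) ↔ k < (s.filter q).card := by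
  have h := getD_iff_of_sorted q hq (s.sort (fun a b => a ≥ b)) (s.pairwise_sort _) k
  rw [Multiset.length_sort] at h
  rw [h]
  conv_rhs => rw [← Multiset.sort_eq s (fun a b => a ≥ b), Multiset.filter_coe, Multiset.coe_card]

/-- The number of elements of `s` exceeding `c`. -/
def countAbove (c : ℝ) (s : Multiset ℝ) : ℕ := (s.filter (fun v => c < v)).card

theorem countAbove_le_card (c : ℝ) (s : Multiset ℝ) : countAbove c s ≤ s.card :=
  Multiset.card_le_card (Multiset.filter_le _ _)

theorem threshold_of_card_lt {r : ℕ → ℕ} {s : Multiset ℝ} (h : s.card < r s.card) :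
    threshold r s = 0 := by
  unfold threshold
  apply List.getD_eq_default
  rw [Multiset.length_sort]
  omega

theorem threshold_mem {r : ℕ → ℕ} (hr : IsRankSequence r) {s : Multiset ℝ}
    (h : r s.card ≤ s.card) : threshold r s ∈ s := by
  have h1 := hr.one_le s.card
  unfold threshold
  have h2 : r s.card - 1 < (s.sort (fun a b => a ≥ b)).length := by
    rw [Multiset.length_sort]; omega
  rw [List.getD_eq_getElem _ _ h2, ← Multiset.mem_sort (r := fun a b : ℝ => a ≥ b)]
  exact List.getElem_mem h2

/-- This replaces the sorted list by counts for all further purposes, combinatorial and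
measure-theoretic. The second alternative comes from the convention Y = 0 when too few values have
been accepted. -/
theorem lt_threshold_iff {r : ℕ → ℕ} (hr : IsRankSequence r) (c : ℝ) (s : Multiset ℝ) :
    c < threshold r s ↔
      (r s.card ≤ countAbove c s) ∨ (s.card < r s.card ∧ c < 0) := by
  have h1 := hr.one_le s.card
  by_cases h : s.card < r s.card
  · rw [threshold_of_card_lt h]
    have := countAbove_le_card c s
    constructor
    · intro hc; exact Or.inr ⟨h, hc⟩
    · rintro (h2 | h2)
      · omega
      · exact h2.2
  · have h2 := sort_getD_iff (fun v => c < v) (fun a b hab hb => lt_of_lt_of_le hb hab) s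
      (r s.card - 1)
    unfold threshold countAbove
    constructor
    · intro hc
      have := h2.1 ⟨by omega, hc⟩
      left; omega
    · rintro (h3 | h3)
      · exact (h2.2 (by omega)).2
      · exact absurd h3.1 h

theorem lt_threshold_iff_of_nonneg {r : ℕ → ℕ} (hr : IsRankSequence r) {c : ℝ} (hc : 0 ≤ c)
    (s : Multiset ℝ) : c < threshold r s ↔ r s.card ≤ countAbove c s := by
  rw [lt_threshold_iff hr]
  constructor
  · rintro (h | h)
    · exact h
    · linarith [h.2]
  · exact Or.inl

theorem rank_le_card_filter_threshold_le {r : ℕ → ℕ} (hr : IsRankSequence r) {s : Multiset ℝ}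
    (h : r s.card ≤ s.card) : r s.card ≤ (s.filter (fun v => threshold r s ≤ v)).card := by
  have h1 := hr.one_le s.card
  have h2 := (sort_getD_iff (fun v => threshold r s ≤ v) (fun a b hab hb => le_trans hb hab) s
      (r s.card - 1)).1 ⟨by omega, le_refl _⟩
  omega

theorem countAbove_threshold_lt {r : ℕ → ℕ} (hr : IsRankSequence r) (s : Multiset ℝ) :
    countAbove (threshold r s) s < r s.card := by
  by_contra! h
  exact lt_irrefl _ ((lt_threshold_iff hr _ s).2 (Or.inl h))

theorem threshold_nonneg {r : ℕ → ℕ} (hr : IsRankSequence r) {s : Multiset ℝ}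
    (hs : ∀ v ∈ s, 0 ≤ v) : 0 ≤ threshold r s := by
  by_cases h : s.card < r s.card
  · rw [threshold_of_card_lt h]
  · exact hs _ (threshold_mem hr (by omega))

theorem countAbove_cons (c x : ℝ) (s : Multiset ℝ) :
    countAbove c (x ::ₘ s) = (if c < x then 1 else 0) + countAbove c s := by
  unfold countAbove
  split_ifs with h
  · rw [Multiset.filter_cons_of_pos _ h, Multiset.card_cons, add_comm]
  · rw [Multiset.filter_cons_of_neg _ h, zero_add]

theorem countAbove_add (c : ℝ) (s t : Multiset ℝ) :
    countAbove c (s + t) = countAbove c s + countAbove c t := by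
  unfold countAbove
  rw [Multiset.filter_add, Multiset.card_add]

/-- The new value adds one to the count above every level below the old threshold, while the
required rank grows by at most one. -/
theorem threshold_le_threshold_cons {r : ℕ → ℕ} (hr : IsRankSequence r) {s : Multiset ℝ} {x : ℝ}
    (hs : ∀ v ∈ s, 0 ≤ v) (hx : threshold r s ≤ x) :
    threshold r s ≤ threshold r (x ::ₘ s) := by
  have h0 := threshold_nonneg hr hs
  have hs' : ∀ v ∈ x ::ₘ s, 0 ≤ v := by
    intro v hv
    rcases Multiset.mem_cons.1 hv with rfl | hv
    · linarith
    · exact hs v hv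
  refine le_of_forall_lt fun c hc => ?_
  rcases lt_or_ge c 0 with h | h
  · exact lt_of_lt_of_le h (threshold_nonneg hr hs')
  · have h1 := (lt_threshold_iff_of_nonneg hr h s).1 hc
    rw [lt_threshold_iff_of_nonneg hr h, countAbove_cons, Multiset.card_cons,
      if_pos (by linarith)]
    have h2 := (hr.2 s.card).2
    omega

/-! ### The hiring process along a fixed sequence of values -/

section Path

variable {r : ℕ → ℕ} {x : ℕ → ℝ}

theorem acceptedValues_succ_of_lt {n : ℕ} (h : threshold r (acceptedValues r x n) < x (n + 1)) :
    acceptedValues r x (n + 1) = x (n + 1) ::ₘ acceptedValues r x n := by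
  rw [acceptedValues, if_pos h]

theorem acceptedValues_succ_of_not_lt {n : ℕ}
    (h : ¬ threshold r (acceptedValues r x n) < x (n + 1)) :
    acceptedValues r x (n + 1) = acceptedValues r x n := by
  rw [acceptedValues, if_neg h]

theorem accepted_succ_iff {n : ℕ} :
    Accepted r x (n + 1) ↔ threshold r (acceptedValues r x n) < x (n + 1) := by
  simp [Accepted, currentThreshold]

theorem acceptProb_succ (n : ℕ) :
    acceptProb r x (n + 1) = Real.exp (-threshold r (acceptedValues r x n)) := by
  simp [acceptProb, currentThreshold]

theorem acceptedValues_nonneg (hr : IsRankSequence r) (n : ℕ) :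
    ∀ v ∈ acceptedValues r x n, 0 ≤ v := by
  induction n with
  | zero => simp [acceptedValues]
  | succ n ih =>
    by_cases h : threshold r (acceptedValues r x n) < x (n + 1)
    · rw [acceptedValues_succ_of_lt h]
      intro v hv
      rcases Multiset.mem_cons.1 hv with rfl | hv
      · have := threshold_nonneg hr ih
        linarith
      · exact ih v hv
    · rwa [acceptedValues_succ_of_not_lt h]

theorem threshold_acceptedValues_nonneg (hr : IsRankSequence r) (n : ℕ) :
    0 ≤ threshold r (acceptedValues r x n) :=
  threshold_nonneg hr (acceptedValues_nonneg hr n)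

theorem threshold_acceptedValues_mono (hr : IsRankSequence r) :
    Monotone fun n => threshold r (acceptedValues r x n) := by
  refine monotone_nat_of_le_succ fun n => ?_
  by_cases h : threshold r (acceptedValues r x n) < x (n + 1)
  · rw [acceptedValues_succ_of_lt h]
    exact threshold_le_threshold_cons hr (acceptedValues_nonneg hr n) h.le
  · rw [acceptedValues_succ_of_not_lt h]

open scoped Classical in
theorem card_acceptedValues (n : ℕ) :
    (acceptedValues r x n).card = numAccepted r x n := by
  induction n with
  | zero => simp [acceptedValues, numAccepted]
  | succ n ih =>
    unfold numAccepted at ih ⊢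
    rw [← Finset.insert_Icc_right_eq_Icc_add_one (by omega), Finset.filter_insert]
    by_cases h : threshold r (acceptedValues r x n) < x (n + 1)
    · rw [acceptedValues_succ_of_lt h, if_pos (accepted_succ_iff.2 h),
        Finset.card_insert_of_notMem (by simp), Multiset.card_cons, ih]
    · rw [acceptedValues_succ_of_not_lt h, if_neg (by rwa [accepted_succ_iff]), ih]

theorem card_acceptedValues_mono : Monotone fun n => (acceptedValues r x n).card := by
  refine monotone_nat_of_le_succ fun n => ?_
  by_cases h : threshold r (acceptedValues r x n) < x (n + 1)
  · rw [acceptedValues_succ_of_lt h]; simp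
  · rw [acceptedValues_succ_of_not_lt h]

theorem card_acceptedValues_succ_le (n : ℕ) :
    (acceptedValues r x (n + 1)).card ≤ (acceptedValues r x n).card + 1 := by
  by_cases h : threshold r (acceptedValues r x n) < x (n + 1)
  · rw [acceptedValues_succ_of_lt h]; simp
  · rw [acceptedValues_succ_of_not_lt h]; simp

theorem card_acceptedValues_le (n : ℕ) : (acceptedValues r x n).card ≤ n := by
  induction n with
  | zero => simp [acceptedValues]
  | succ n ih => have := card_acceptedValues_succ_le (r := r) (x := x) n; omega

/-- Above the current threshold every candidate so far has been accepted. -/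
theorem card_filter_acceptedValues (hr : IsRankSequence r) (q : ℝ → Prop) [DecidablePred q] (n : ℕ)
    (hq : ∀ v, q v → threshold r (acceptedValues r x n) < v) :
    ((acceptedValues r x n).filter q).card = ((Finset.Icc 1 n).filter fun k => q (x k)).card := by
  induction n with
  | zero => simp [acceptedValues]
  | succ n ih =>
    have hm := threshold_acceptedValues_mono (x := x) hr (Nat.le_succ n)
    have ih' := ih fun v hv => lt_of_le_of_lt hm (hq v hv)
    rw [← Finset.insert_Icc_right_eq_Icc_add_one (by omega), Finset.filter_insert]
    by_cases h : threshold r (acceptedValues r x n) < x (n + 1)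
    · rw [acceptedValues_succ_of_lt h]
      by_cases h2 : q (x (n + 1))
      · rw [if_pos h2, Finset.card_insert_of_notMem (by simp), Multiset.filter_cons_of_pos _ h2,
          Multiset.card_cons, ih']
      · rw [if_neg h2, Multiset.filter_cons_of_neg _ h2, ih']
    · have h2 : ¬ q (x (n + 1)) := fun h2 => h (lt_of_le_of_lt hm (hq _ h2))
      rw [acceptedValues_succ_of_not_lt h, if_neg h2, ih']

theorem card_filter_acceptedValues_le (q : ℝ → Prop) [DecidablePred q] (n : ℕ) :
    ((acceptedValues r x n).filter q).card ≤ ((Finset.Icc 1 n).filter fun k => q (x k)).card := by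
  induction n with
  | zero => simp [acceptedValues]
  | succ n ih =>
    rw [← Finset.insert_Icc_right_eq_Icc_add_one (by omega), Finset.filter_insert]
    have hsub : ((Finset.Icc 1 n).filter fun k => q (x k)).card ≤
        (if q (x (n + 1)) then insert (n + 1) ((Finset.Icc 1 n).filter fun k => q (x k)) else
          (Finset.Icc 1 n).filter fun k => q (x k)).card := by
      split_ifs
      · exact Finset.card_le_card (Finset.subset_insert _ _)
      · exact le_rfl
    by_cases h : threshold r (acceptedValues r x n) < x (n + 1)
    · rw [acceptedValues_succ_of_lt h]
      by_cases h2 : q (x (n + 1))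
      · rw [if_pos h2, Finset.card_insert_of_notMem (by simp), Multiset.filter_cons_of_pos _ h2,
          Multiset.card_cons]
        omega
      · rw [if_neg h2, Multiset.filter_cons_of_neg _ h2]
        exact ih
    · rw [acceptedValues_succ_of_not_lt h]
      omega

theorem card_above_threshold_lt (hr : IsRankSequence r) (n : ℕ) :
    ((Finset.Icc 1 n).filter fun k => threshold r (acceptedValues r x n) < x k).card <
      r (acceptedValues r x n).card := by
  rw [← card_filter_acceptedValues hr (fun v => threshold r (acceptedValues r x n) < v) n
    fun v hv => hv]
  exact countAbove_threshold_lt hr _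

/-- Each acceptance between `s` and `t` adds at most one value satisfying `q`; the inequality is
arranged to avoid truncated subtraction. -/
theorem card_filter_acceptedValues_add_le (q : ℝ → Prop) [DecidablePred q] {s t : ℕ}
    (hst : s ≤ t) :
    ((acceptedValues r x t).filter q).card + (acceptedValues r x s).card ≤
      ((acceptedValues r x s).filter q).card + (acceptedValues r x t).card := by
  induction t, hst using Nat.le_induction with
  | base => exact le_rfl
  | succ n hn ih =>
    by_cases h : threshold r (acceptedValues r x n) < x (n + 1)
    · rw [acceptedValues_succ_of_lt h, Multiset.card_cons]
      by_cases h2 : q (x (n + 1))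
      · rw [Multiset.filter_cons_of_pos _ h2, Multiset.card_cons]; omega
      · rw [Multiset.filter_cons_of_neg _ h2]; omega
    · rwa [acceptedValues_succ_of_not_lt h]

theorem rank_le_card_of_threshold_pos {s : Multiset ℝ} (h : 0 < threshold r s) :
    r s.card ≤ s.card := by
  by_contra! h2
  rw [threshold_of_card_lt h2] at h
  exact lt_irrefl _ h

theorem rank_le_card_ge_threshold (hr : IsRankSequence r) {n : ℕ}
    (h : 0 < threshold r (acceptedValues r x n)) :
    r (acceptedValues r x n).card ≤
      ((Finset.Icc 1 n).filter fun k => threshold r (acceptedValues r x n) ≤ x k).card :=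
  (rank_le_card_filter_threshold_le hr (rank_le_card_of_threshold_pos h)).trans
    (card_filter_acceptedValues_le _ n)

theorem exists_eq_of_mem_acceptedValues {n : ℕ} {v : ℝ} (h : v ∈ acceptedValues r x n) :
    ∃ k ∈ Finset.Icc 1 n, x k = v := by
  have h1 := card_filter_acceptedValues_le (r := r) (x := x) (fun w => w = v) n
  have h2 : 0 < ((acceptedValues r x n).filter fun w => w = v).card :=
    Multiset.card_pos_iff_exists_mem.2 ⟨v, Multiset.mem_filter.2 ⟨h, rfl⟩⟩
  obtain ⟨k, hk⟩ := Finset.card_pos.1 (lt_of_lt_of_le h2 h1)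
  exact ⟨k, (Finset.mem_filter.1 hk).1, (Finset.mem_filter.1 hk).2⟩

/-- When the threshold rises between the times `s` and `t`, it passes fewer of the values seen up
to time `s` than there are acceptances in between. -/
theorem card_between_thresholds_le (hr : IsRankSequence r) {s t : ℕ} (hst : s ≤ t) :
    ((Finset.Icc 1 s).filter fun k => threshold r (acceptedValues r x s) < x k ∧
      x k < threshold r (acceptedValues r x t)).card ≤
      (acceptedValues r x t).card - (acceptedValues r x s).card := by
  set a := threshold r (acceptedValues r x s) with ha
  set b := threshold r (acceptedValues r x t) with hb
  have hab : a ≤ b := threshold_acceptedValues_mono hr hst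
  rcases hab.eq_or_lt with h | h
  · rw [Finset.filter_false_of_mem]
    · simp
    · rintro k _ ⟨h1, h2⟩
      linarith
  · have ha0 : 0 ≤ a := threshold_acceptedValues_nonneg hr s
    have h1 := card_above_threshold_lt (x := x) hr s
    rw [← ha] at h1
    have h2 := card_filter_acceptedValues hr (x := x) (fun v => b ≤ v) s
      fun v hv => lt_of_lt_of_le h hv
    have h3 := card_filter_acceptedValues_add_le (r := r) (x := x) (fun v => b ≤ v) hst
    have h4 := rank_le_card_filter_threshold_le hr
      (rank_le_card_of_threshold_pos (lt_of_le_of_lt ha0 h))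
    rw [← hb] at h4
    have h5 := hr.monotone (card_acceptedValues_mono (r := r) (x := x) hst)
    have h6 := card_acceptedValues_mono (r := r) (x := x) hst
    simp only at h5 h6
    have h7 : ((Finset.Icc 1 s).filter fun k => a < x k ∧ x k < b).card +
        ((Finset.Icc 1 s).filter fun k => b ≤ x k).card =
        ((Finset.Icc 1 s).filter fun k => a < x k).card := by
      rw [← Finset.card_union_of_disjoint]
      · congr 1
        ext k
        simp only [Finset.mem_union, Finset.mem_filter]
        constructor
        · rintro (⟨h8, h9, -⟩ | ⟨h8, h9⟩)
          · exact ⟨h8, h9⟩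
          · exact ⟨h8, by linarith⟩
        · rintro ⟨h8, h9⟩
          rcases lt_or_ge (x k) b with h10 | h10
          · exact Or.inl ⟨h8, h9, h10⟩
          · exact Or.inr ⟨h8, h10⟩
      · rw [Finset.disjoint_filter]
        rintro k _ ⟨_, h8⟩ h9
        linarith
    -- Fewer than r(M_s) ≤ r(M_t) old values exceed Y_s. At least r(M_t) accepted values are ≥ Y_t
    -- at time t, and at most M_t - M_s of them are new. The difference counts the old values
    -- strictly in between.
    omega

open scoped Classical in
/-- The set of accepted candidates among `1, …, n`. -/
def acceptedSet (r : ℕ → ℕ) (x : ℕ → ℝ) (n : ℕ) : Finset ℕ :=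
  (Finset.Icc 1 n).filter (Accepted r x)

theorem mem_acceptedSet {n k : ℕ} :
    k ∈ acceptedSet r x n ↔ (1 ≤ k ∧ k ≤ n) ∧ Accepted r x k := by
  simp [acceptedSet]

theorem card_acceptedSet (n : ℕ) : (acceptedSet r x n).card = (acceptedValues r x n).card :=
  (card_acceptedValues n).symm

theorem acceptedSet_succ (n : ℕ) : acceptedSet r x (n + 1) =
    if threshold r (acceptedValues r x n) < x (n + 1) then insert (n + 1) (acceptedSet r x n)
    else acceptedSet r x n := by
  ext k
  rcases eq_or_ne k (n + 1) with rfl | hk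
  · split_ifs with h
    · simp [mem_acceptedSet, accepted_succ_iff, h]
    · simp [mem_acceptedSet, accepted_succ_iff, h]
  · have : k ≤ n + 1 ↔ k ≤ n := by omega
    split_ifs with h
    · simp [mem_acceptedSet, hk, this]
    · simp [mem_acceptedSet, this]

/-- If candidate `m ≤ n` is accepted and no later candidate up to `n` is, then `L_n = n - m`. -/
theorem lastGap_eq {n m : ℕ} (hm : m ∈ acceptedSet r x n)
    (hlast : ∀ k ∈ acceptedSet r x n, k ≤ m) : lastGap r x n = n - m := by
  classical
  obtain ⟨⟨h1, h2⟩, h3⟩ := mem_acceptedSet.1 hm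
  have hsub : ∀ j, j < m → (acceptedSet r x j).card < (acceptedSet r x n).card := by
    intro j hj
    apply Finset.card_lt_card
    refine ⟨fun k hk => ?_, fun h => ?_⟩
    · rw [mem_acceptedSet] at hk ⊢
      exact ⟨⟨hk.1.1, by omega⟩, hk.2⟩
    · have := mem_acceptedSet.1 (h hm)
      omega
  have heq : acceptedSet r x m = acceptedSet r x n := by
    ext k
    constructor
    · intro hk
      rw [mem_acceptedSet] at hk ⊢
      exact ⟨⟨hk.1.1, by omega⟩, hk.2⟩
    · intro hk
      have := hlast k hk
      rw [mem_acceptedSet] at hk ⊢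
      exact ⟨⟨hk.1.1, this⟩, hk.2⟩
  have key : acceptIndex r x (numAccepted r x n) = m := by
    unfold acceptIndex
    apply le_antisymm
    · apply Nat.sInf_le
      change numAccepted r x n ≤ numAccepted r x m
      rw [← card_acceptedValues, ← card_acceptedValues, ← card_acceptedSet, ← card_acceptedSet, heq]
    · apply le_csInf ⟨n, le_refl (numAccepted r x n)⟩
      intro j hj
      by_contra! hlt
      have h4 := hsub j hlt
      have h5 : numAccepted r x n ≤ numAccepted r x j := hj
      rw [← card_acceptedValues, ← card_acceptedValues, ← card_acceptedSet,
        ← card_acceptedSet] at h5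
      omega
  unfold lastGap
  rw [key]

end Path

/-! ### The exponential distribution -/

instance isProbabilityMeasure_expMeasure_one : IsProbabilityMeasure (expMeasure 1) :=
  isProbabilityMeasure_expMeasure one_pos

theorem expMeasure_real_Iic {y : ℝ} (hy : 0 ≤ y) :
    (expMeasure 1).real (Set.Iic y) = 1 - Real.exp (-y) := by
  rw [← cdf_eq_real, cdf_expMeasure_eq one_pos, if_pos hy, one_mul]

theorem expMeasure_real_Ioi {y : ℝ} (hy : 0 ≤ y) :
    (expMeasure 1).real (Set.Ioi y) = Real.exp (-y) := by
  rw [← Set.compl_Iic, probReal_compl_eq_one_sub measurableSet_Iic, expMeasure_real_Iic hy]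
  ring

theorem expMeasure_Ioi {y : ℝ} (hy : 0 ≤ y) :
    expMeasure 1 (Set.Ioi y) = ENNReal.ofReal (Real.exp (-y)) := by
  rw [← expMeasure_real_Ioi hy, ofReal_measureReal]

theorem expMeasure_Iic {y : ℝ} (hy : 0 ≤ y) :
    expMeasure 1 (Set.Iic y) = ENNReal.ofReal (1 - Real.exp (-y)) := by
  rw [← expMeasure_real_Iic hy, ofReal_measureReal]

theorem exponentialPDF_measurable : Measurable (exponentialPDF 1) :=
  (measurable_exponentialPDFReal 1).ennreal_ofReal

theorem lintegral_expMeasure {f : ℝ → ℝ≥0∞} (hf : Measurable f) :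
    ∫⁻ x, f x ∂(expMeasure 1) =
      ∫⁻ x in Set.Ioi 0, ENNReal.ofReal (Real.exp (-x)) * f x := by
  have h1 : expMeasure 1 = volume.withDensity (exponentialPDF 1) := rfl
  rw [h1, lintegral_withDensity_eq_lintegral_mul _ exponentialPDF_measurable hf,
    ← lintegral_indicator measurableSet_Ioi]
  have h0 : ∀ᵐ x : ℝ, x ≠ 0 := by
    simp [ae_iff]
  refine lintegral_congr_ae ?_
  filter_upwards [h0] with x hx
  rcases lt_or_gt_of_ne hx with h | h
  · rw [Pi.mul_apply, exponentialPDF_of_neg h, Set.indicator_of_notMem (by simp; linarith), zero_mul]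
  · rw [Pi.mul_apply, exponentialPDF_of_nonneg h.le, Set.indicator_of_mem (by simpa using h)]
    simp

/-- The memoryless property: restricted to values above `y`, an exponential variable is `e^{-y}`
times a shifted exponential variable. -/
theorem lintegral_expMeasure_Ioi {y : ℝ} (hy : 0 ≤ y) {f : ℝ → ℝ≥0∞} (hf : Measurable f) :
    ∫⁻ x in Set.Ioi y, f x ∂(expMeasure 1) =
      ENNReal.ofReal (Real.exp (-y)) * ∫⁻ v, f (y + v) ∂(expMeasure 1) := by
  rw [← lintegral_indicator measurableSet_Ioi, lintegral_expMeasure (hf.indicator measurableSet_Ioi),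
    lintegral_expMeasure (f := fun v => f (y + v)) (by fun_prop), ← lintegral_const_mul _ (by fun_prop),
    ← lintegral_indicator measurableSet_Ioi, ← lintegral_indicator measurableSet_Ioi,
    ← lintegral_add_left_eq_self _ y]
  refine lintegral_congr fun x => ?_
  by_cases hx : 0 < x
  · rw [Set.indicator_of_mem (by simp; linarith), Set.indicator_of_mem (by simpa using hx),
      Set.indicator_of_mem (by simpa using hx), ← mul_assoc, ← ENNReal.ofReal_mul (by positivity),
      ← Real.exp_add]
    congr 3
    ring
  · have h1 : x ∉ Set.Ioi (0:ℝ) := by simpa using hx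
    rw [Set.indicator_of_notMem h1]
    by_cases h2 : y + x ∈ Set.Ioi (0 : ℝ)
    · rw [Set.indicator_of_mem h2, Set.indicator_of_notMem, mul_zero]
      simp only [Set.mem_Ioi] at h1 ⊢
      linarith
    · rw [Set.indicator_of_notMem h2]

/-! ### Measurability of the hiring process -/

/-- The `σ`-algebra on finite multisets of reals generated by the numbers of elements above given
levels and the total number of elements. -/
instance multisetMeasurableSpace : MeasurableSpace (Multiset ℝ) :=
  (⨆ c : ℝ, MeasurableSpace.comap (countAbove c) ⊤) ⊔ MeasurableSpace.comap Multiset.card ⊤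

theorem measurable_countAbove (c : ℝ) : Measurable (countAbove c) := by
  refine Measurable.mono (comap_measurable (m := ⊤) (countAbove c)) ?_ le_top
  exact le_sup_of_le_left (le_iSup (fun c : ℝ => MeasurableSpace.comap (countAbove c) ⊤) c)

theorem measurable_multiset_card : Measurable (Multiset.card : Multiset ℝ → ℕ) :=
  Measurable.mono (comap_measurable (m := ⊤) Multiset.card) le_sup_right le_top

theorem measurable_multiset_iff {α : Type*} [MeasurableSpace α] {f : α → Multiset ℝ} :
    Measurable f ↔ (∀ c, Measurable fun a => countAbove c (f a)) ∧
      Measurable fun a => (f a).card := by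
  constructor
  · intro h
    exact ⟨fun c => (measurable_countAbove c).comp h, measurable_multiset_card.comp h⟩
  · rintro ⟨h1, h2⟩
    rw [measurable_iff_comap_le]
    simp only [multisetMeasurableSpace, MeasurableSpace.comap_sup, MeasurableSpace.comap_iSup,
      sup_le_iff, iSup_le_iff, MeasurableSpace.comap_comp]
    exact ⟨fun c => (h1 c).comap_le, h2.comap_le⟩

theorem measurable_multiset_cons :
    Measurable fun z : ℝ × Multiset ℝ => z.1 ::ₘ z.2 := by
  rw [measurable_multiset_iff]
  constructor
  · intro c
    simp only [countAbove_cons]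
    have h1 : Measurable fun z : ℝ × Multiset ℝ => countAbove c z.2 :=
      (measurable_countAbove c).comp measurable_snd
    refine Measurable.add ?_ h1
    exact Measurable.ite (measurableSet_lt measurable_const measurable_fst) measurable_const
      measurable_const
  · simp only [Multiset.card_cons]
    exact (measurable_multiset_card.comp measurable_snd).add_const 1

theorem measurable_multiset_add :
    Measurable fun z : Multiset ℝ × Multiset ℝ => z.1 + z.2 := by
  rw [measurable_multiset_iff]
  constructor
  · intro c
    simp only [countAbove_add]
    exact ((measurable_countAbove c).comp measurable_fst).add
      ((measurable_countAbove c).comp measurable_snd)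
  · simp only [Multiset.card_add]
    exact (measurable_multiset_card.comp measurable_fst).add
      (measurable_multiset_card.comp measurable_snd)

/-- By `lt_threshold_iff` the superlevel sets are conditions on counts, which generate the
σ-algebra. -/
theorem measurable_threshold {r : ℕ → ℕ} (hr : IsRankSequence r) : Measurable (threshold r) := by
  refine measurable_of_Ioi fun c => ?_
  have : threshold r ⁻¹' Set.Ioi c = {s | r s.card ≤ countAbove c s} ∪
      ({s | s.card < r s.card} ∩ {_s | c < 0}) := by
    ext s
    simp only [Set.mem_preimage, Set.mem_Ioi, lt_threshold_iff hr]
    rfl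
  rw [this]
  have h1 : Measurable fun s : Multiset ℝ => r s.card :=
    (measurable_of_countable r).comp measurable_multiset_card
  exact (measurableSet_le h1 (measurable_countAbove c)).union
    ((measurableSet_lt measurable_multiset_card h1).inter (MeasurableSet.const _))

/-! ### Independent exponential values -/

/-- The values `X ω 1, X ω 2, …` are independent and exponentially distributed. -/
structure IsExpSequence {Ω : Type*} [MeasurableSpace Ω] (P : Measure Ω) (X : Ω → ℕ → ℝ) :
    Prop where
  measurable : ∀ k ≥ 1, Measurable fun ω => X ω k
  indep : iIndepFun (fun (k : ℕ) ω => X ω (k + 1)) P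
  law : ∀ k ≥ 1, P.map (fun ω => X ω k) = expMeasure 1

/-- The `σ`-algebra generated by the values of the candidates in `S`. -/
@[reducible]
def valuesAlg {Ω : Type*} (X : Ω → ℕ → ℝ) (S : Finset ℕ) : MeasurableSpace Ω :=
  ⨆ k ∈ S, MeasurableSpace.comap (fun ω => X ω k) inferInstance

section

variable {Ω : Type*} {X : Ω → ℕ → ℝ}

theorem valuesAlg_mono {S T : Finset ℕ} (h : S ⊆ T) : valuesAlg X S ≤ valuesAlg X T :=
  biSup_mono fun _ hk => h hk

theorem measurable_valuesAlg {S : Finset ℕ} {k : ℕ} (hk : k ∈ S) :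
    Measurable[valuesAlg X S] fun ω => X ω k :=
  Measurable.mono (comap_measurable _)
    (le_iSup₂_of_le (f := fun k (_ : k ∈ S) => MeasurableSpace.comap (fun ω => X ω k) inferInstance)
      k hk le_rfl) le_rfl

end

section

variable {Ω : Type*} [mΩ : MeasurableSpace Ω] {P : Measure Ω} [IsProbabilityMeasure P]
  {X : Ω → ℕ → ℝ} {r : ℕ → ℕ}

theorem IsExpSequence.valuesAlg_le (h : IsExpSequence P X) {S : Finset ℕ}
    (hS : ∀ k ∈ S, 1 ≤ k) : valuesAlg X S ≤ mΩ :=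
  iSup₂_le fun k hk => (h.measurable k (hS k hk)).comap_le

theorem IsExpSequence.indep_valuesAlg (h : IsExpSequence P X) {S : Finset ℕ}
    (hS : ∀ k ∈ S, 1 ≤ k) {k : ℕ} (hk : 1 ≤ k) (hkS : k ∉ S) :
    Indep (valuesAlg X S) (MeasurableSpace.comap (fun ω => X ω k) inferInstance) P := by
  -- The independent family is indexed from 0, so candidate `k` has index `k - 1`.
  have h1 := indep_iSup_of_disjoint (m := fun k : ℕ =>
      MeasurableSpace.comap (fun ω => X ω (k + 1)) inferInstance)
    (fun j => (h.measurable (j + 1) (by omega)).comap_le) h.indep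
    (S := {j | j + 1 ∈ S}) (T := {k - 1}) (by
      rw [Set.disjoint_singleton_right]
      simp only [Set.mem_ofPred_eq]
      rwa [Nat.sub_add_cancel hk])
  refine indep_of_indep_of_le_left (indep_of_indep_of_le_right h1 ?_) ?_
  · refine le_iSup₂_of_le (k - 1) (Set.mem_singleton _) ?_
    rw [Nat.sub_add_cancel hk]
  · refine iSup₂_le fun j hj => ?_
    have hj1 := hS j hj
    refine le_iSup₂_of_le (j - 1) ?_ ?_
    · simp only [Set.mem_ofPred_eq]
      rwa [Nat.sub_add_cancel hj1]
    · rw [Nat.sub_add_cancel hj1]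

/-- A fresh value may be integrated out. -/
theorem IsExpSequence.lintegral_fresh (h : IsExpSequence P X) {S : Finset ℕ}
    (hS : ∀ k ∈ S, 1 ≤ k) {k : ℕ} (hk : 1 ≤ k) (hkS : k ∉ S)
    {E : Type*} [MeasurableSpace E] {W : Ω → E} (hW : Measurable[valuesAlg X S] W)
    {g : E × ℝ → ℝ≥0∞} (hg : Measurable g) :
    ∫⁻ ω, g (W ω, X ω k) ∂P = ∫⁻ ω, ∫⁻ x, g (W ω, x) ∂(expMeasure 1) ∂P := by
  have hW' : Measurable W := hW.mono (h.valuesAlg_le hS) le_rfl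
  have hX := h.measurable k hk
  have hind : IndepFun W (fun ω => X ω k) P := by
    rw [IndepFun_iff_Indep]
    exact indep_of_indep_of_le_left (h.indep_valuesAlg hS hk hkS) hW.comap_le
  have hmap := (indepFun_iff_map_prod_eq_prod_map_map hW'.aemeasurable hX.aemeasurable).1 hind
  rw [h.law k hk] at hmap
  calc ∫⁻ ω, g (W ω, X ω k) ∂P = ∫⁻ z, g z ∂(P.map fun ω => (W ω, X ω k)) := by
        rw [lintegral_map hg (hW'.prodMk hX)]
    _ = ∫⁻ z, g z ∂((P.map W).prod (expMeasure 1)) := by rw [hmap]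
    _ = ∫⁻ w, ∫⁻ x, g (w, x) ∂(expMeasure 1) ∂(P.map W) := lintegral_prod _ hg.aemeasurable
    _ = _ := by rw [lintegral_map hg.lintegral_prod_right' hW']

theorem IsExpSequence.setLIntegral_fresh (h : IsExpSequence P X) {S : Finset ℕ}
    (hS : ∀ k ∈ S, 1 ≤ k) {k : ℕ} (hk : 1 ≤ k) (hkS : k ∉ S)
    {E : Type*} [MeasurableSpace E] {W : Ω → E} (hW : Measurable[valuesAlg X S] W)
    {T : Set Ω} (hT : MeasurableSet[valuesAlg X S] T)
    {g : E × ℝ → ℝ≥0∞} (hg : Measurable g) :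
    ∫⁻ ω in T, g (W ω, X ω k) ∂P = ∫⁻ ω in T, ∫⁻ x, g (W ω, x) ∂(expMeasure 1) ∂P := by
  have hT' : MeasurableSet T := h.valuesAlg_le hS _ hT
  rw [← lintegral_indicator hT', ← lintegral_indicator hT']
  have hind : Measurable[valuesAlg X S] fun ω => T.indicator (fun _ => (1 : ℝ≥0∞)) ω :=
    measurable_const.indicator hT
  -- The indicator of `T` travels as an extra coordinate of the variable known from the past.
  have := h.lintegral_fresh hS hk hkS (W := fun ω => (T.indicator (fun _ => (1 : ℝ≥0∞)) ω, W ω))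
    (hind.prodMk hW) (g := fun z => z.1.1 * g (z.1.2, z.2)) (by fun_prop)
  calc _ = ∫⁻ ω, T.indicator (fun _ => (1 : ℝ≥0∞)) ω * g (W ω, X ω k) ∂P := by
        refine lintegral_congr fun ω => ?_
        by_cases hω : ω ∈ T <;> simp [hω]
    _ = _ := this
    _ = _ := by
        refine lintegral_congr fun ω => ?_
        by_cases hω : ω ∈ T <;> simp [hω]

theorem measurable_acceptedValues_of {α : Type*} [MeasurableSpace α] {x : α → ℕ → ℝ}
    (hr : IsRankSequence r) (n : ℕ) (hx : ∀ k ∈ Finset.Icc 1 n, Measurable fun a => x a k) :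
    Measurable fun a => acceptedValues r (x a) n := by
  induction n with
  | zero => exact measurable_const
  | succ n ih =>
    have ih' := ih fun k hk => hx k (Finset.Icc_subset_Icc le_rfl (Nat.le_succ n) hk)
    have hx' := hx (n + 1) (by simp)
    simp only [acceptedValues]
    refine Measurable.ite ?_ ?_ ih'
    · exact measurableSet_lt ((measurable_threshold hr).comp ih') hx'
    · exact measurable_multiset_cons.comp (hx'.prodMk ih')

theorem measurable_acceptedSet_of {α : Type*} [MeasurableSpace α] {x : α → ℕ → ℝ}
    (hr : IsRankSequence r) (n : ℕ) (hx : ∀ k ∈ Finset.Icc 1 n, Measurable fun a => x a k) :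
    Measurable fun a => acceptedSet r (x a) n := by
  rw [measurable_finset_iff]
  intro k
  by_cases hk : 1 ≤ k ∧ k ≤ n
  · simp only [mem_acceptedSet, hk, and_self, true_and, Accepted, currentThreshold]
    have h1 := (measurable_threshold hr).comp (measurable_acceptedValues_of hr (k - 1)
      fun j hj => hx j (Finset.Icc_subset_Icc le_rfl (by omega) hj))
    exact measurableSet_setOfPred.1 (measurableSet_lt h1 (hx k (by simpa using hk)))
  · simp only [mem_acceptedSet, hk, false_and]
    exact measurable_const

theorem measurable_acceptedValues (hr : IsRankSequence r) (n : ℕ) :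
    Measurable[valuesAlg X (Finset.Icc 1 n)] fun ω => acceptedValues r (X ω) n :=
  @measurable_acceptedValues_of r Ω (valuesAlg X (Finset.Icc 1 n)) X hr n
    fun _ hk => measurable_valuesAlg hk

theorem one_le_of_mem_Icc {n k : ℕ} (hk : k ∈ Finset.Icc 1 n) : 1 ≤ k := (Finset.mem_Icc.1 hk).1

theorem IsExpSequence.measurable_acceptedValues (h : IsExpSequence P X) (hr : IsRankSequence r)
    (n : ℕ) : Measurable fun ω => acceptedValues r (X ω) n :=
  measurable_acceptedValues_of hr n fun k hk => h.measurable k (one_le_of_mem_Icc hk)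

theorem IsExpSequence.measurable_threshold (h : IsExpSequence P X) (hr : IsRankSequence r)
    (n : ℕ) : Measurable fun ω => threshold r (acceptedValues r (X ω) n) :=
  (Hiring.measurable_threshold hr).comp (h.measurable_acceptedValues hr n)

theorem IsExpSequence.measurable_acceptProb (h : IsExpSequence P X) (hr : IsRankSequence r)
    (n : ℕ) : Measurable fun ω => acceptProb r (X ω) n :=
  Real.measurable_exp.comp (h.measurable_threshold hr (n - 1)).neg

theorem measurable_acceptedSet (hr : IsRankSequence r) (n : ℕ) :
    Measurable[valuesAlg X (Finset.Icc 1 n)] fun ω => acceptedSet r (X ω) n :=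
  @measurable_acceptedSet_of r Ω (valuesAlg X (Finset.Icc 1 n)) X hr n
    fun _ hk => measurable_valuesAlg hk

theorem IsExpSequence.measurable_acceptedSet (h : IsExpSequence P X) (hr : IsRankSequence r)
    (n : ℕ) : Measurable fun ω => acceptedSet r (X ω) n :=
  measurable_acceptedSet_of hr n fun k hk => h.measurable k (one_le_of_mem_Icc hk)

theorem acceptProb_pos (x : ℕ → ℝ) (n : ℕ) : 0 < acceptProb r x n := Real.exp_pos _

theorem acceptProb_le_one (hr : IsRankSequence r) (x : ℕ → ℝ) (n : ℕ) : acceptProb r x n ≤ 1 := by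
  rw [acceptProb, Real.exp_le_one_iff, neg_nonpos]
  exact threshold_acceptedValues_nonneg hr _

end

/-! ### Bernoulli weights of finite sets -/

/-- The probability that independent `Bernoulli(p)` indicators indexed by `S` are successes exactly
at the elements of `c`. -/
def bernWeight (p : ℝ) (S c : Finset ℕ) : ℝ := ∏ k ∈ S, if k ∈ c then p else 1 - p

/-- The expectation of `f` of the random set of successes among independent `Bernoulli(p)`
indicators indexed by `S`. -/
def bernSum (p : ℝ) (S : Finset ℕ) (f : Finset ℕ → ℝ) : ℝ :=
  ∑ c ∈ S.powerset, bernWeight p S c * f c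

section

variable {p : ℝ}

theorem bernWeight_nonneg (h0 : 0 ≤ p) (h1 : p ≤ 1) (S c : Finset ℕ) : 0 ≤ bernWeight p S c :=
  Finset.prod_nonneg fun k _ => by split_ifs <;> linarith

theorem bernWeight_congr {S c d : Finset ℕ} (h : ∀ k ∈ S, (k ∈ c ↔ k ∈ d)) :
    bernWeight p S c = bernWeight p S d :=
  Finset.prod_congr rfl fun k hk => by simp only [h k hk]

theorem bernSum_empty (f : Finset ℕ → ℝ) : bernSum p ∅ f = f ∅ := by
  simp [bernSum, bernWeight]

theorem sum_powerset_bernWeight_insert {M : Type*} [AddCommMonoid M] (F : ℝ → Finset ℕ → M)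
    {S : Finset ℕ} {k : ℕ} (hk : k ∉ S) :
    ∑ c ∈ (insert k S).powerset, F (bernWeight p (insert k S) c) c =
      (∑ c ∈ S.powerset, F ((1 - p) * bernWeight p S c) c) +
        ∑ c ∈ S.powerset, F (p * bernWeight p S c) (insert k c) := by
  rw [Finset.sum_powerset_insert hk]
  congr 1
  · refine Finset.sum_congr rfl fun c hc => ?_
    have hkc : k ∉ c := fun h => hk (Finset.mem_powerset.1 hc h)
    rw [bernWeight, Finset.prod_insert hk, if_neg hkc]
    rfl
  · refine Finset.sum_congr rfl fun c hc => ?_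
    rw [bernWeight, Finset.prod_insert hk, if_pos (Finset.mem_insert_self k c),
      ← bernWeight, bernWeight_congr (d := c)]
    intro j hj
    rw [Finset.mem_insert]
    have : j ≠ k := fun h => hk (h ▸ hj)
    simp [this]

theorem bernSum_insert {S : Finset ℕ} {k : ℕ} (hk : k ∉ S) (f : Finset ℕ → ℝ) :
    bernSum p (insert k S) f = (1 - p) * bernSum p S f + p * bernSum p S fun c => f (insert k c) := by
  unfold bernSum
  rw [sum_powerset_bernWeight_insert (fun w c => w * f c) hk, Finset.mul_sum, Finset.mul_sum]
  simp only [mul_assoc]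

theorem bernSum_congr {S : Finset ℕ} {f g : Finset ℕ → ℝ} (h : ∀ c ⊆ S, f c = g c) :
    bernSum p S f = bernSum p S g :=
  Finset.sum_congr rfl fun c hc => by rw [h c (Finset.mem_powerset.1 hc)]

theorem bernSum_mono (h0 : 0 ≤ p) (h1 : p ≤ 1) {S : Finset ℕ} {f g : Finset ℕ → ℝ}
    (h : ∀ c ⊆ S, f c ≤ g c) : bernSum p S f ≤ bernSum p S g :=
  Finset.sum_le_sum fun c hc =>
    mul_le_mul_of_nonneg_left (h c (Finset.mem_powerset.1 hc)) (bernWeight_nonneg h0 h1 S c)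

theorem bernSum_add (S : Finset ℕ) (f g : Finset ℕ → ℝ) :
    bernSum p S (fun c => f c + g c) = bernSum p S f + bernSum p S g := by
  simp only [bernSum, mul_add, Finset.sum_add_distrib]

theorem bernSum_sub (S : Finset ℕ) (f g : Finset ℕ → ℝ) :
    bernSum p S (fun c => f c - g c) = bernSum p S f - bernSum p S g := by
  simp only [bernSum, mul_sub, Finset.sum_sub_distrib]

theorem bernSum_const_mul (S : Finset ℕ) (a : ℝ) (f : Finset ℕ → ℝ) :
    bernSum p S (fun c => a * f c) = a * bernSum p S f := by
  simp only [bernSum, Finset.mul_sum]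
  exact Finset.sum_congr rfl fun c _ => by ring

theorem bernSum_const (S : Finset ℕ) (a : ℝ) : bernSum p S (fun _ => a) = a := by
  induction S using Finset.induction_on with
  | empty => rw [bernSum_empty]
  | insert k S hk ih => rw [bernSum_insert hk, ih]; ring

/-- Indicators over disjoint index sets are independent, so the expectation may be iterated. -/
theorem bernSum_union {S T : Finset ℕ} (h : Disjoint S T) (f : Finset ℕ → ℝ) :
    bernSum p (S ∪ T) f = bernSum p T fun d => bernSum p S fun c => f (c ∪ d) := by
  induction T using Finset.induction_on generalizing f with
  | empty => simp [bernSum_empty]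
  | insert k T hk ih =>
    rw [Finset.disjoint_insert_right] at h
    rw [Finset.union_insert, bernSum_insert (by simp [h.1, hk]), bernSum_insert hk, ih h.2, ih h.2]
    congr 3
    funext d
    congr 1
    funext c
    rw [Finset.union_insert]

/-- Indicators outside `T` do not matter for functions that depend on those in `T` only. -/
theorem bernSum_of_inter {S T : Finset ℕ} (hT : T ⊆ S) {f : Finset ℕ → ℝ}
    (hf : ∀ c ⊆ S, f c = f (c ∩ T)) : bernSum p S f = bernSum p T f := by
  have h1 : Disjoint (S \ T) T := Finset.sdiff_disjoint
  have h2 : (S \ T) ∪ T = S := Finset.sdiff_union_of_subset hT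
  conv_lhs => rw [← h2]
  rw [bernSum_union h1]
  refine bernSum_congr fun d hd => ?_
  rw [bernSum_congr (g := fun _ => f d), bernSum_const]
  intro c hc
  have hcd : c ∪ d ⊆ S := Finset.union_subset (hc.trans Finset.sdiff_subset) (hd.trans hT)
  rw [hf _ hcd, Finset.union_inter_distrib_right, Finset.inter_eq_left.2 hd,
    Finset.disjoint_iff_inter_eq_empty.1 (h1.mono_left hc), Finset.empty_union]

theorem bernSum_card (S : Finset ℕ) : bernSum p S (fun c => (c.card : ℝ)) = S.card * p := by
  induction S using Finset.induction_on with
  | empty => simp [bernSum_empty]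
  | insert k S hk ih =>
    rw [bernSum_insert hk, ih, bernSum_congr (g := fun c => (c.card : ℝ) + 1), bernSum_add,
      bernSum_const, ih, Finset.card_insert_of_notMem hk]
    · push_cast; ring
    · intro c hc
      rw [Finset.card_insert_of_notMem fun h => hk (hc h)]
      push_cast; ring

/-- Bernoulli sums with different success probabilities. -/
theorem bernSum_le_bernSum_add {q : ℝ} (hp0 : 0 ≤ p) (hp1 : p ≤ 1) (hq0 : 0 ≤ q) (hq1 : q ≤ 1)
    (S : Finset ℕ) {f : Finset ℕ → ℝ} (hf : ∀ c, 0 ≤ f c ∧ f c ≤ 1) :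
    bernSum p S f ≤ bernSum q S f + S.card * |p - q| := by
  induction S using Finset.induction_on generalizing f with
  | empty => simp [bernSum_empty]
  | insert k S hk ih =>
    rw [bernSum_insert hk, bernSum_insert hk, Finset.card_insert_of_notMem hk]
    have h1 := ih hf
    have h2 := ih (f := fun c => f (insert k c)) fun c => hf _
    set A := bernSum p S f
    set B := bernSum q S f with hB
    set A' := bernSum p S fun c => f (insert k c)
    set B' := bernSum q S fun c => f (insert k c) with hB'
    have hB0 : 0 ≤ B := by
      have := bernSum_mono hq0 hq1 (S := S) (f := fun _ => 0) (g := f) fun c _ => (hf c).1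
      rwa [bernSum_const] at this
    have hB1 : B ≤ 1 := by
      have := bernSum_mono hq0 hq1 (S := S) (g := fun _ => 1) (f := f) fun c _ => (hf c).2
      rwa [bernSum_const] at this
    have hB0' : 0 ≤ B' := by
      have := bernSum_mono hq0 hq1 (S := S) (f := fun _ => 0) (g := fun c => f (insert k c))
        fun c _ => (hf _).1
      rwa [bernSum_const] at this
    have hB1' : B' ≤ 1 := by
      have := bernSum_mono hq0 hq1 (S := S) (g := fun _ => 1) (f := fun c => f (insert k c))
        fun c _ => (hf _).2
      rwa [bernSum_const] at this
    -- Changing the parameter of one coordinate moves the mixture of `B` and `B'` by this amount;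
    -- both lie in [0,1], so each coordinate costs at most |p - q|.
    have h3 : (p - q) * (B' - B) ≤ |p - q| := by
      calc (p - q) * (B' - B) ≤ |(p - q) * (B' - B)| := le_abs_self _
        _ = |p - q| * |B' - B| := abs_mul _ _
        _ ≤ |p - q| * 1 := by
          refine mul_le_mul_of_nonneg_left ?_ (abs_nonneg _)
          rw [abs_le]; constructor <;> linarith
        _ = _ := mul_one _
    have h4 := mul_le_mul_of_nonneg_left h1 (by linarith : 0 ≤ 1 - p)
    have h5 := mul_le_mul_of_nonneg_left h2 hp0
    push_cast
    nlinarith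

/-! ### Shifting a binomial variable -/

/-- The expectation of `g` of a binomial variable with parameters `m` and `p`. -/
def binomSum (p : ℝ) : ℕ → (ℕ → ℝ) → ℝ
  | 0, g => g 0
  | m + 1, g => (1 - p) * binomSum p m g + p * binomSum p m fun j => g (j + 1)

theorem bernSum_card_eq_binomSum (S : Finset ℕ) (g : ℕ → ℝ) :
    bernSum p S (fun c => g c.card) = binomSum p S.card g := by
  induction S using Finset.induction_on generalizing g with
  | empty => simp [bernSum_empty, binomSum]
  | insert k S hk ih =>
    rw [bernSum_insert hk, ih, Finset.card_insert_of_notMem hk, binomSum, ← ih fun j => g (j + 1)]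
    congr 2
    refine bernSum_congr fun c hc => ?_
    rw [Finset.card_insert_of_notMem fun h => hk (hc h)]

theorem binomSum_add (m : ℕ) (f g : ℕ → ℝ) :
    binomSum p m (fun j => f j + g j) = binomSum p m f + binomSum p m g := by
  induction m generalizing f g with
  | zero => rfl
  | succ m ih => simp only [binomSum, ih]; ring

theorem binomSum_const_mul (m : ℕ) (a : ℝ) (f : ℕ → ℝ) :
    binomSum p m (fun j => a * f j) = a * binomSum p m f := by
  induction m generalizing f with
  | zero => rfl
  | succ m ih => simp only [binomSum, ih]; ring

theorem binomSum_sub (m : ℕ) (f g : ℕ → ℝ) :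
    binomSum p m (fun j => f j - g j) = binomSum p m f - binomSum p m g := by
  induction m generalizing f g with
  | zero => rfl
  | succ m ih => simp only [binomSum, ih]; ring

theorem binomSum_const (m : ℕ) (a : ℝ) : binomSum p m (fun _ => a) = a := by
  induction m with
  | zero => rfl
  | succ m ih => simp only [binomSum, ih]; ring

theorem binomSum_mono (h0 : 0 ≤ p) (h1 : p ≤ 1) (m : ℕ) {f g : ℕ → ℝ} (h : ∀ j, f j ≤ g j) :
    binomSum p m f ≤ binomSum p m g := by
  induction m generalizing f g with
  | zero => exact h 0
  | succ m ih =>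
    exact add_le_add (mul_le_mul_of_nonneg_left (ih h) (by linarith))
      (mul_le_mul_of_nonneg_left (ih fun j => h (j + 1)) h0)

/-- Stein's identity for the binomial distribution. -/
theorem binomSum_stein (m : ℕ) (g : ℕ → ℝ) :
    binomSum p (m + 1) (fun j => ((j : ℝ) - p * (m + 1)) * g j) =
      (m + 1) * p * (1 - p) * binomSum p m fun j => g (j + 1) - g j := by
  induction m generalizing g with
  | zero => simp [binomSum]; ring
  | succ m ih =>
    rw [binomSum]
    have e1 : (fun j : ℕ => ((j : ℝ) - p * (((m + 1 : ℕ) : ℝ) + 1)) * g j) =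
        fun j : ℕ => ((j : ℝ) - p * (m + 1)) * g j + (-p) * g j := by
      funext j; push_cast; ring
    have e2 : (fun j : ℕ => (((j + 1 : ℕ) : ℝ) - p * (((m + 1 : ℕ) : ℝ) + 1)) * g (j + 1)) =
        fun j : ℕ => ((j : ℝ) - p * (m + 1)) * g (j + 1) + (1 - p) * g (j + 1) := by
      funext j; push_cast; ring
    rw [e1, e2, binomSum_add, binomSum_add, binomSum_const_mul, binomSum_const_mul, ih g,
      ih fun j => g (j + 1)]
    have e3 : binomSum p (m + 1) (fun j => g (j + 1) - g j) =
        (1 - p) * binomSum p m (fun j => g (j + 1) - g j) +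
          p * binomSum p m fun j => g (j + 1 + 1) - g (j + 1) := rfl
    have e4 := binomSum_sub (p := p) (m + 1) (fun j => g (j + 1)) g
    rw [e3] at e4 ⊢
    push_cast
    linear_combination (-p * (1 - p)) * e4

/-- Stein's identity turns the effect of a unit shift, multiplied by the variance V, into the
expectation of the centred binomial variable times g, which is at most √V. Applied to the centred
variable itself, the same identity computes the variance. The bound 1/√V results. -/
theorem binomSum_shift_one (h0 : 0 < p) (h1 : p < 1) (m : ℕ) {g : ℕ → ℝ} (hg : ∀ j, |g j| ≤ 1)
    {v : ℝ} (hv : 0 < v) (hv2 : v ^ 2 ≤ (m + 1) * p * (1 - p)) :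
    binomSum p m (fun j => g (j + 1) - g j) ≤ 1 / v := by
  set V := ((m : ℝ) + 1) * p * (1 - p) with hV
  have hVpos : 0 < V := by have : 0 < 1 - p := by linarith
                           positivity
  have s1 := binomSum_stein (p := p) m g
  have s2 := binomSum_stein (p := p) m fun j => (j : ℝ) - p * (m + 1)
  have e2 : (fun j : ℕ => (((j + 1 : ℕ) : ℝ) - p * (m + 1)) - ((j : ℝ) - p * (m + 1))) =
      fun _ => 1 := by
    funext j; push_cast; ring
  rw [e2, binomSum_const, mul_one, ← hV] at s2
  rw [← hV] at s1
  set s := Real.sqrt V with hs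
  have hspos : 0 < s := Real.sqrt_pos.2 hVpos
  have hss : s * s = V := Real.mul_self_sqrt hVpos.le
  have hvs : v ≤ s := Real.le_sqrt_of_sq_le hv2
  -- The inequality |d| ≤ d²/(2s) + s/2 with s = √V plays the role of Cauchy–Schwarz and needs only
  -- linearity.
  have h3 : binomSum p (m + 1) (fun j => ((j : ℝ) - p * (m + 1)) * g j) ≤
      binomSum p (m + 1) (fun j => (1 / (2 * s)) *
        (((j : ℝ) - p * (m + 1)) * ((j : ℝ) - p * (m + 1))) + s / 2) := by
    refine binomSum_mono h0.le h1.le _ fun j => ?_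
    set d := (j : ℝ) - p * (m + 1)
    have : d * g j ≤ |d| := by
      calc d * g j ≤ |d * g j| := le_abs_self _
        _ = |d| * |g j| := abs_mul _ _
        _ ≤ |d| * 1 := mul_le_mul_of_nonneg_left (hg j) (abs_nonneg _)
        _ = |d| := mul_one _
    refine this.trans ?_
    have h4 : 1 / (2 * s) * (d * d) + s / 2 - |d| = (|d| - s) ^ 2 / (2 * s) := by
      have : d * d = |d| ^ 2 := by rw [sq_abs]; ring
      rw [this]
      field_simp
      ring
    have h5 : 0 ≤ (|d| - s) ^ 2 / (2 * s) := by positivity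
    linarith
  rw [binomSum_add, binomSum_const_mul, binomSum_const, s2, s1] at h3
  have h6 : 1 / (2 * s) * V + s / 2 = s := by rw [← hss]; field_simp; ring
  rw [h6] at h3
  calc binomSum p m (fun j => g (j + 1) - g j) ≤ s / V := by
        rw [le_div_iff₀ hVpos]; linarith
    _ = 1 / s := by rw [← hss]; field_simp
    _ ≤ 1 / v := one_div_le_one_div_of_le hv hvs

theorem binomSum_shift (h0 : 0 < p) (h1 : p < 1) (m : ℕ) {g : ℕ → ℝ} (hg : ∀ j, |g j| ≤ 1)
    {v : ℝ} (hv : 0 < v) (hv2 : v ^ 2 ≤ (m + 1) * p * (1 - p)) (i : ℕ) :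
    binomSum p m (fun j => g (j + i)) ≤ binomSum p m g + i * (1 / v) := by
  induction i with
  | zero => simp
  | succ i ih =>
    have := binomSum_shift_one h0 h1 m (g := fun j => g (j + i)) (fun j => hg _) hv hv2
    rw [binomSum_sub] at this
    have e : (fun j => g (j + 1 + i)) = fun j => g (j + (i + 1)) := by
      funext j; congr 1; ring
    rw [e] at this
    push_cast
    linarith

end

/-! ### Removing the dependence on the last indicators -/

theorem bernSum_binomSum_comm (p : ℝ) (L : Finset ℕ) (m : ℕ) (H : ℕ → Finset ℕ → ℝ) :
    bernSum p L (fun d => binomSum p m fun j => H j d) =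
      binomSum p m fun j => bernSum p L (H j) := by
  induction m generalizing H with
  | zero => rfl
  | succ m ih =>
    simp only [binomSum]
    rw [bernSum_add, bernSum_const_mul, bernSum_const_mul, ih, ih fun j => H (j + 1)]

/-- `E` carries the early indicators and `L` the late ones; `u` stands for the excesses, whose law
sees the set only through its size. Given the late set d, that size is |d| plus a binomial variable
over `E`. Dropping |d| costs |d|/v, on average |L|p/v, and afterwards `u` is independent of d, so
`F` may be averaged over d and compared with `Φ`. -/
theorem bernSum_integral_le {U : Type*} [MeasurableSpace U] (ρ : ℕ → Measure U)
    [∀ i, IsProbabilityMeasure (ρ i)] {p : ℝ} (hp0 : 0 < p) (hp1 : p < 1) {E L : Finset ℕ}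
    (hEL : Disjoint E L) {G : Set U} (hG : MeasurableSet G) {F : U → Finset ℕ → ℝ}
    (hFm : ∀ c, Measurable fun u => F u c) (hF : ∀ u c, 0 ≤ F u c ∧ F u c ≤ 1)
    (hloc : ∀ u ∈ G, ∀ c ⊆ E ∪ L, F u c = F u (c ∩ L))
    {Φ : U → ℝ} (hΦm : Measurable Φ) (hΦ : ∀ u, 0 ≤ Φ u ∧ Φ u ≤ 1) {η v : ℝ} (hη : 0 ≤ η)
    (hFΦ : ∀ u ∈ G, bernSum p L (F u) ≤ Φ u + η) (hv : 0 < v)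
    (hv2 : v ^ 2 ≤ (E.card + 1) * p * (1 - p)) :
    bernSum p (E ∪ L) (fun c => ∫ u in G, F u c ∂(ρ c.card)) ≤
      bernSum p (E ∪ L) (fun c => ∫ u in G, Φ u ∂(ρ c.card)) + L.card * p * (1 / v) + η := by
  have hFi : ∀ i c, Integrable (fun u => F u c) (ρ i) := fun i c =>
    Integrable.of_bound (hFm c).aestronglyMeasurable 1 (ae_of_all _ fun u => by
      rw [Real.norm_eq_abs, abs_of_nonneg (hF u c).1]; exact (hF u c).2)
  have hΦi : ∀ i, Integrable Φ (ρ i) := fun i =>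
    Integrable.of_bound hΦm.aestronglyMeasurable 1 (ae_of_all _ fun u => by
      rw [Real.norm_eq_abs, abs_of_nonneg (hΦ u).1]; exact (hΦ u).2)
  -- Centring at `Φ` keeps the integrand in [-1,1], as the shift bound requires, and makes the
  -- averaged integrand at most η on `G`.
  set H : ℕ → Finset ℕ → ℝ := fun i l => ∫ u in G, (F u l - Φ u) ∂(ρ i) with hH
  have hHabs : ∀ i l, |H i l| ≤ 1 := by
    intro i l
    rw [hH, ← Real.norm_eq_abs]
    have := norm_setIntegral_le_of_norm_le_const (μ := ρ i) (s := G) (C := 1)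
      (f := fun u => F u l - Φ u) (measure_lt_top _ _) (fun u _ => by
        rw [Real.norm_eq_abs, abs_le]
        have h1 := hF u l
        have h2 := hΦ u
        constructor <;> linarith)
    refine this.trans ?_
    rw [one_mul]
    exact measureReal_le_one
  have h1 : bernSum p (E ∪ L) (fun c => ∫ u in G, F u c ∂(ρ c.card)) -
      bernSum p (E ∪ L) (fun c => ∫ u in G, Φ u ∂(ρ c.card)) =
      bernSum p (E ∪ L) fun c => H c.card (c ∩ L) := by
    rw [← bernSum_sub]
    refine bernSum_congr fun c hc => ?_
    rw [hH, ← integral_sub (hFi _ _).integrableOn (hΦi _).integrableOn]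
    exact setIntegral_congr_fun hG fun u hu => by simp only [hloc u hu c hc]
  have h2 : bernSum p (E ∪ L) (fun c => H c.card (c ∩ L)) =
      bernSum p L fun d => binomSum p E.card fun j => H (j + d.card) d := by
    rw [bernSum_union hEL]
    refine bernSum_congr fun d hd => ?_
    rw [← bernSum_card_eq_binomSum E fun j => H (j + d.card) d]
    refine bernSum_congr fun c hc => ?_
    rw [Finset.card_union_of_disjoint (hEL.mono hc hd), Finset.union_inter_distrib_right,
      Finset.inter_eq_left.2 hd, Finset.disjoint_iff_inter_eq_empty.1 (hEL.mono_left hc),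
      Finset.empty_union]
  -- For each late set d the shift by |d| is removed; the accumulated cost is linear in |d| and is
  -- averaged afterwards by `bernSum_card`.
  have h3 : bernSum p L (fun d => binomSum p E.card fun j => H (j + d.card) d) ≤
      bernSum p L (fun d => (binomSum p E.card fun j => H j d) + (1 / v) * d.card) := by
    refine bernSum_mono hp0.le hp1.le fun d _ => ?_
    have := binomSum_shift hp0 hp1 E.card (g := fun j => H j d) (fun j => hHabs j d) hv hv2 d.card
    linarith
  have h4 : (binomSum p E.card fun j => bernSum p L (H j)) ≤ η := by
    rw [← binomSum_const (p := p) E.card η]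
    refine binomSum_mono hp0.le hp1.le _ fun j => ?_
    have h5 : bernSum p L (H j) = ∫ u in G, (bernSum p L (F u) - Φ u) ∂(ρ j) := by
      have h6 : ∀ u, bernSum p L (F u) - Φ u = bernSum p L fun d => F u d - Φ u := by
        intro u
        rw [bernSum_sub, bernSum_const]
      simp only [h6]
      unfold bernSum
      rw [integral_finsetSum (f := fun d u => bernWeight p L d * (F u d - Φ u)) _ fun d _ =>
        (((hFi j d).sub (hΦi j)).const_mul _).integrableOn]
      simp only [hH, integral_const_mul]
    rw [h5]
    calc ∫ u in G, (bernSum p L (F u) - Φ u) ∂(ρ j) ≤ ∫ _u in G, η ∂(ρ j) := by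
          refine setIntegral_mono_on ?_ (integrable_const _).integrableOn hG fun u hu => ?_
          · unfold bernSum
            exact ((integrable_finsetSum _ fun d _ => (hFi j d).const_mul _).sub
              (hΦi j)).integrableOn
          · have := hFΦ u hu
            linarith
      _ = (ρ j).real G * η := by simp
      _ ≤ 1 * η := mul_le_mul_of_nonneg_right measureReal_le_one hη
      _ = η := one_mul _
  rw [bernSum_add, bernSum_const_mul, bernSum_card, bernSum_binomSum_comm p L E.card H] at h3
  rw [h2] at h1
  linarith

/-! ### The candidates exceeding a fixed level -/

/-- The candidates in `(t, k]` whose values exceed `y`. -/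
def overSet (y : ℝ) (x : ℕ → ℝ) (t k : ℕ) : Finset ℕ := (Finset.Ioc t k).filter fun j => y < x j

/-- The values exceeding `y` of the candidates in `(t, k]`. -/
def overValues (y : ℝ) (x : ℕ → ℝ) (t k : ℕ) : Multiset ℝ := (overSet y x t k).val.map x

theorem overSet_self (y : ℝ) (x : ℕ → ℝ) (t : ℕ) : overSet y x t t = ∅ := by simp [overSet]

theorem overSet_subset (y : ℝ) (x : ℕ → ℝ) (t k : ℕ) : overSet y x t k ⊆ Finset.Ioc t k :=
  Finset.filter_subset _ _

theorem Ioc_succ_eq_insert {t k : ℕ} (htk : t ≤ k) :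
    Finset.Ioc t (k + 1) = insert (k + 1) (Finset.Ioc t k) := by
  ext j; simp only [Finset.mem_Ioc, Finset.mem_insert]; omega

theorem overSet_succ (y : ℝ) (x : ℕ → ℝ) {t k : ℕ} (htk : t ≤ k) :
    overSet y x t (k + 1) =
      if y < x (k + 1) then insert (k + 1) (overSet y x t k) else overSet y x t k := by
  unfold overSet
  rw [Ioc_succ_eq_insert htk, Finset.filter_insert]

theorem overValues_self (y : ℝ) (x : ℕ → ℝ) (t : ℕ) : overValues y x t t = 0 := by
  simp [overValues, overSet_self]

theorem overValues_succ (y : ℝ) (x : ℕ → ℝ) {t k : ℕ} (htk : t ≤ k) :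
    overValues y x t (k + 1) =
      if y < x (k + 1) then x (k + 1) ::ₘ overValues y x t k else overValues y x t k := by
  unfold overValues
  rw [overSet_succ y x htk]
  split_ifs with h
  · rw [Finset.insert_val_of_notMem, Multiset.map_cons]
    intro h2
    have := overSet_subset y x t k h2
    simp at this
  · rfl

theorem measurable_overSet_of {α : Type*} [MeasurableSpace α] {y : α → ℝ} {x : α → ℕ → ℝ}
    (hy : Measurable y) (t k : ℕ) (hx : ∀ j ∈ Finset.Ioc t k, Measurable fun a => x a j) :
    Measurable fun a => overSet (y a) (x a) t k := by
  rw [measurable_finset_iff]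
  intro j
  by_cases hj : j ∈ Finset.Ioc t k
  · simp only [overSet, Finset.mem_filter, hj, true_and]
    exact measurableSet_setOfPred.1 (measurableSet_lt hy (hx j hj))
  · simp only [overSet, Finset.mem_filter, hj, false_and]
    exact measurable_const

theorem measurable_overValues_of {α : Type*} [MeasurableSpace α] {y : α → ℝ} {x : α → ℕ → ℝ}
    (hy : Measurable y) {t k : ℕ} (htk : t ≤ k)
    (hx : ∀ j ∈ Finset.Ioc t k, Measurable fun a => x a j) :
    Measurable fun a => overValues (y a) (x a) t k := by
  induction k, htk using Nat.le_induction with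
  | base => simp only [overValues_self]; exact measurable_const
  | succ k hk ih =>
    have ih' := ih fun j hj => hx j (Finset.Ioc_subset_Ioc le_rfl (Nat.le_succ k) hj)
    have hx' := hx (k + 1) (by simp; omega)
    simp only [overValues_succ _ _ hk]
    exact Measurable.ite (measurableSet_lt hy hx') (measurable_multiset_cons.comp (hx'.prodMk ih'))
      ih'

/-- The law of the multiset of `i` independent exponential variables shifted by `y`. -/
def excessLaw (y : ℝ) : ℕ → Measure (Multiset ℝ)
  | 0 => Measure.dirac 0
  | i + 1 => ((expMeasure 1).prod (excessLaw y i)).map fun z => (y + z.1) ::ₘ z.2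

theorem measurable_shift_cons (y : ℝ) :
    Measurable fun z : ℝ × Multiset ℝ => (y + z.1) ::ₘ z.2 :=
  measurable_multiset_cons.comp ((measurable_fst.const_add y).prodMk measurable_snd)

instance isProbabilityMeasure_excessLaw (y : ℝ) (i : ℕ) :
    IsProbabilityMeasure (excessLaw y i) := by
  induction i with
  | zero => exact Measure.dirac.isProbabilityMeasure
  | succ i ih => exact Measure.isProbabilityMeasure_map (measurable_shift_cons y).aemeasurable

theorem lintegral_excessLaw_succ (y : ℝ) (i : ℕ) {f : Multiset ℝ → ℝ≥0∞} (hf : Measurable f) :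
    ∫⁻ u, f u ∂(excessLaw y (i + 1)) =
      ∫⁻ u, ∫⁻ v, f ((y + v) ::ₘ u) ∂(expMeasure 1) ∂(excessLaw y i) := by
  have h1 : Measurable fun z : ℝ × Multiset ℝ => f ((y + z.1) ::ₘ z.2) :=
    hf.comp (measurable_shift_cons y)
  rw [excessLaw, lintegral_map hf (measurable_shift_cons y), lintegral_prod_symm _ h1.aemeasurable]

section

variable {Ω : Type*} [mΩ : MeasurableSpace Ω] {P : Measure Ω} [IsProbabilityMeasure P]
  {X : Ω → ℕ → ℝ}

/-- Given the past up to time `t`, the candidates exceeding a level `y` known at time `t` form a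
Bernoulli random set, and their excesses are independent of it. -/
theorem IsExpSequence.setLIntegral_over (h : IsExpSequence P X) {E : Type*} [MeasurableSpace E]
    {t : ℕ} {W : Ω → E} (hW : Measurable[valuesAlg X (Finset.Icc 1 t)] W) {T : Set Ω}
    (hT : MeasurableSet[valuesAlg X (Finset.Icc 1 t)] T) {y : E → ℝ} (hy : Measurable y)
    (hy0 : ∀ ω, 0 ≤ y (W ω)) {k : ℕ} (htk : t ≤ k) (G : Finset ℕ → E × Multiset ℝ → ℝ≥0∞)
    (hG : ∀ c, Measurable (G c)) :
    ∫⁻ ω in T, G (overSet (y (W ω)) (X ω) t k) (W ω, overValues (y (W ω)) (X ω) t k) ∂P =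
      ∫⁻ ω in T, ∑ c ∈ (Finset.Ioc t k).powerset,
        ENNReal.ofReal (bernWeight (Real.exp (-y (W ω))) (Finset.Ioc t k) c) *
          ∫⁻ u, G c (W ω, u) ∂(excessLaw (y (W ω)) c.card) ∂P := by
  induction k, htk using Nat.le_induction generalizing G with
  | base =>
    refine lintegral_congr fun ω => ?_
    have : Measurable fun u => G ∅ (W ω, u) := (hG ∅).comp measurable_prodMk_left
    simp [overSet_self, overValues_self, bernWeight, excessLaw, lintegral_dirac' _ this]
  | succ k hk ih =>
    -- The fresh value either joins the set and the multiset or is ignored, according to its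
    -- position relative to the level fixed at time `t`.
    set g : (E × Multiset ℝ × Finset ℕ) × ℝ → ℝ≥0∞ := fun z =>
      if y z.1.1 < z.2 then G (insert (k + 1) z.1.2.2) (z.1.1, z.2 ::ₘ z.1.2.1)
      else G z.1.2.2 (z.1.1, z.1.2.1) with hg
    have hGu : Measurable fun z : Finset ℕ × (E × Multiset ℝ) => G z.1 z.2 :=
      measurable_from_prod_countable_right fun c => hG c
    have hcons : Measurable fun z : (E × Multiset ℝ × Finset ℕ) × ℝ => z.2 ::ₘ z.1.2.1 :=
      measurable_multiset_cons.comp (measurable_snd.prodMk (by fun_prop))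
    have hgm : Measurable g := by
      refine Measurable.ite (measurableSet_lt (by fun_prop) (by fun_prop)) ?_ ?_
      · refine hGu.comp (f := fun z : (E × Multiset ℝ × Finset ℕ) × ℝ =>
          (insert (k + 1) z.1.2.2, (z.1.1, z.2 ::ₘ z.1.2.1))) ?_
        exact ((measurable_of_countable fun c : Finset ℕ => insert (k + 1) c).comp
          (by fun_prop)).prodMk ((by fun_prop : Measurable fun z : (E × Multiset ℝ × Finset ℕ) × ℝ =>
            z.1.1).prodMk hcons)
      · exact hGu.comp (f := fun z : (E × Multiset ℝ × Finset ℕ) × ℝ =>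
          (z.1.2.2, (z.1.1, z.1.2.1))) (by fun_prop)
    have hsub : valuesAlg X (Finset.Icc 1 t) ≤ valuesAlg X (Finset.Icc 1 k) :=
      valuesAlg_mono (Finset.Icc_subset_Icc le_rfl hk)
    have hxk : ∀ j ∈ Finset.Ioc t k, Measurable[valuesAlg X (Finset.Icc 1 k)] fun ω => X ω j :=
      fun j hj => measurable_valuesAlg (by simp only [Finset.mem_Icc, Finset.mem_Ioc] at *; omega)
    have hyW : Measurable[valuesAlg X (Finset.Icc 1 k)] fun ω => y (W ω) :=
      hy.comp (hW.mono hsub le_rfl)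
    have hU := @measurable_overValues_of Ω (valuesAlg X (Finset.Icc 1 k)) (fun ω => y (W ω)) X
      hyW t k hk hxk
    have hC := @measurable_overSet_of Ω (valuesAlg X (Finset.Icc 1 k)) (fun ω => y (W ω)) X
      hyW t k hxk
    have hZ := (hW.mono hsub le_rfl).prodMk (hU.prodMk hC)
    have step := h.setLIntegral_fresh (fun _ => one_le_of_mem_Icc) (k := k + 1) (by omega)
      (by simp) hZ (hsub _ hT) hgm
    set G' : Finset ℕ → E × Multiset ℝ → ℝ≥0∞ := fun c z =>
      ∫⁻ x, g ((z.1, z.2, c), x) ∂(expMeasure 1) with hG'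
    have hG'm : ∀ c, Measurable (G' c) := fun c =>
      Measurable.lintegral_prod_right' (f := fun z : (E × Multiset ℝ) × ℝ =>
        g ((z.1.1, z.1.2, c), z.2)) (hgm.comp (by fun_prop))
    have e1 : ∀ ω, G (overSet (y (W ω)) (X ω) t (k + 1)) (W ω, overValues (y (W ω)) (X ω) t (k + 1)) =
        g ((W ω, overValues (y (W ω)) (X ω) t k, overSet (y (W ω)) (X ω) t k), X ω (k + 1)) := by
      intro ω
      rw [overSet_succ _ _ hk, overValues_succ _ _ hk, hg]
      by_cases hlt : y (W ω) < X ω (k + 1) <;> simp [hlt]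
    simp only [e1]
    rw [step]
    have ih' := ih G' hG'm
    simp only [hG'] at ih'
    rw [ih']
    refine lintegral_congr fun ω => ?_
    rw [Ioc_succ_eq_insert hk, sum_powerset_bernWeight_insert (fun w c => ENNReal.ofReal w *
      ∫⁻ u, G c (W ω, u) ∂(excessLaw (y (W ω)) c.card)) (by simp), ← Finset.sum_add_distrib]
    refine Finset.sum_congr rfl fun c hc => ?_
    set yω := y (W ω) with hyω
    have hy0ω : 0 ≤ yω := hy0 ω
    have hc' : k + 1 ∉ c := fun hkc => by
      have := Finset.mem_powerset.1 hc hkc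
      simp at this
    have hGw : ∀ d, Measurable fun u => G d (W ω, u) := fun d => (hG d).comp measurable_prodMk_left
    -- Integrating out the fresh value yields one binary branch of the Bernoulli tree; by
    -- memorylessness the upper branch receives an Exp(1) excess, which is one step of `excessLaw`.
    have e2 : ∀ u, ∫⁻ x, g ((W ω, u, c), x) ∂(expMeasure 1) =
        ENNReal.ofReal (1 - Real.exp (-yω)) * G c (W ω, u) + ENNReal.ofReal (Real.exp (-yω)) *
          ∫⁻ v, G (insert (k + 1) c) (W ω, (yω + v) ::ₘ u) ∂(expMeasure 1) := by
      intro u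
      have hcm : Measurable fun x => G (insert (k + 1) c) (W ω, x ::ₘ u) :=
        (hGw _).comp (measurable_multiset_cons.comp measurable_prodMk_right)
      rw [← lintegral_add_compl _ (measurableSet_Ioi (a := yω)), add_comm,
        ← lintegral_expMeasure_Ioi hy0ω hcm]
      congr 1
      · rw [Set.compl_Ioi, ← expMeasure_Iic hy0ω, mul_comm, ← setLIntegral_const]
        refine setLIntegral_congr_fun measurableSet_Iic fun x hx => ?_
        simp only [hg, ← hyω]
        rw [if_neg (not_lt.2 (Set.mem_Iic.1 hx))]
      · refine setLIntegral_congr_fun measurableSet_Ioi fun x hx => ?_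
        simp only [hg, ← hyω]
        rw [if_pos (Set.mem_Ioi.1 hx)]
    simp only [e2]
    rw [lintegral_add_left ((hGw c).const_mul _), lintegral_const_mul _ (hGw c),
      lintegral_const_mul _ (Measurable.lintegral_prod_right'
        (f := fun z : Multiset ℝ × ℝ => G (insert (k + 1) c) (W ω, (yω + z.2) ::ₘ z.1))
        ((hGw _).comp ((measurable_shift_cons yω).comp measurable_swap))),
      ← lintegral_excessLaw_succ yω c.card (hGw (insert (k + 1) c)),
      Finset.card_insert_of_notMem hc', mul_add, ← mul_assoc, ← mul_assoc]
    have h1 : Real.exp (-yω) ≤ 1 := by rw [Real.exp_le_one_iff]; linarith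
    rw [mul_comm (ENNReal.ofReal (bernWeight _ _ _)) (ENNReal.ofReal (1 - _)),
      mul_comm (ENNReal.ofReal (bernWeight _ _ _)) (ENNReal.ofReal (Real.exp _)),
      ← ENNReal.ofReal_mul (by linarith), ← ENNReal.ofReal_mul (by positivity)]

end

/-! ### Gaps between large order statistics -/

instance nullSingletonClass_expMeasure : NullSingletonClass (expMeasure 1) := by
  unfold expMeasure gammaMeasure
  infer_instance

/-- Since e^{-x} is uniform on (0,1) under Exp(1), this is the integral of e^{-su} over (0,1); the
antiderivative is explicit. -/
theorem lintegral_exp_neg_mul_exp_neg_le {s : ℝ} (hs : 0 < s) :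
    ∫⁻ x, ENNReal.ofReal (Real.exp (-(s * Real.exp (-x)))) ∂(expMeasure 1) ≤
      ENNReal.ofReal (1 / s) := by
  rw [lintegral_expMeasure (by fun_prop)]
  have hderiv : ∀ x : ℝ, HasDerivAt (fun x => Real.exp (-(s * Real.exp (-x))) / s)
      (Real.exp (-x) * Real.exp (-(s * Real.exp (-x)))) x := by
    intro x
    have h1 : HasDerivAt (fun x : ℝ => -(s * Real.exp (-x))) (s * Real.exp (-x)) x := by
      have h0 := ((hasDerivAt_neg x).exp.const_mul s).neg
      have e : -(s * (Real.exp (-x) * -1)) = s * Real.exp (-x) := by ring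
      rw [e] at h0
      exact h0
    have h2 := h1.exp.div_const s
    have e : Real.exp (-(s * Real.exp (-x))) * (s * Real.exp (-x)) / s =
        Real.exp (-x) * Real.exp (-(s * Real.exp (-x))) := by
      field_simp
    rwa [e] at h2
  have hlim : Tendsto (fun x : ℝ => Real.exp (-(s * Real.exp (-x))) / s) atTop (𝓝 (1 / s)) := by
    have h1 : Tendsto (fun x : ℝ => -(s * Real.exp (-x))) atTop (𝓝 (-(s * 0))) :=
      (Tendsto.const_mul s Real.tendsto_exp_neg_atTop_nhds_zero).neg
    have h2 := (Real.continuous_exp.tendsto _).comp h1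
    simp only [mul_zero, neg_zero, Real.exp_zero] at h2
    exact h2.div_const s
  have hcont : ContinuousWithinAt (fun x : ℝ => Real.exp (-(s * Real.exp (-x))) / s)
      (Set.Ici 0) 0 := (hderiv 0).continuousAt.continuousWithinAt
  have hpos : ∀ x ∈ Set.Ioi (0 : ℝ), 0 ≤ Real.exp (-x) * Real.exp (-(s * Real.exp (-x))) :=
    fun x _ => by positivity
  have hint := integrableOn_Ioi_deriv_of_nonneg hcont (fun x _ => hderiv x) hpos hlim
  have hval := integral_Ioi_of_hasDerivAt_of_nonneg hcont (fun x _ => hderiv x) hpos hlim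
  have e : ∀ x : ℝ, ENNReal.ofReal (Real.exp (-x)) *
      ENNReal.ofReal (Real.exp (-(s * Real.exp (-x)))) =
      ENNReal.ofReal (Real.exp (-x) * Real.exp (-(s * Real.exp (-x)))) := fun x =>
    (ENNReal.ofReal_mul (Real.exp_pos _).le).symm
  simp only [e]
  rw [← ofReal_integral_eq_lintegral_ofReal hint
    ((ae_restrict_iff' measurableSet_Ioi).2 (ae_of_all _ hpos)), hval]
  apply ENNReal.ofReal_le_ofReal
  have : 0 ≤ Real.exp (-(s * Real.exp (-0))) / s := by positivity
  linarith

/-- Some value among the first `N`, at least `ε` and dominated by at least `R` values, has at most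
`C` values in the interval of length `ε` below it. -/
def gapEvent (ε : ℝ) (C R N : ℕ) (x : ℕ → ℝ) : Prop :=
  ∃ i ∈ Finset.Icc 1 N, ε ≤ x i ∧ R ≤ ((Finset.Icc 1 N).filter fun k => x i ≤ x k).card ∧
    ((Finset.Icc 1 N).filter fun k => x i - ε < x k ∧ x k < x i).card ≤ C

/-- A weight that is large for values above `x`, and small for values just below `x`. -/
def gapWeight (ε u : ℝ) (z : ℝ × ℝ) : ℝ≥0∞ :=
  if z.1 ≤ z.2 then ENNReal.ofReal u
  else if z.1 - ε < z.2 then ENNReal.ofReal (1 / 2) else 1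

theorem measurable_gapWeight (ε u : ℝ) : Measurable (gapWeight ε u) := by
  unfold gapWeight
  refine Measurable.ite (measurableSet_le measurable_fst measurable_snd) measurable_const
    (Measurable.ite (measurableSet_lt (by fun_prop) measurable_snd) measurable_const
      measurable_const)

/-- With c = (e^ε - 1)/4, the weight 1 + c above x gains c e^{-x}, while the weight 1/2 on the
interval of mass 4c e^{-x} below x loses 2c e^{-x}. The choice of c leaves a net loss, although many
values above x still make the product of weights large. -/
theorem lintegral_gapWeight {ε x : ℝ} (hε : 0 < ε) (hx : ε ≤ x) :
    ∫⁻ z, gapWeight ε (1 + (Real.exp ε - 1) / 4) (x, z) ∂(expMeasure 1) =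
      ENNReal.ofReal (1 - (Real.exp ε - 1) / 4 * Real.exp (-x)) := by
  set u := 1 + (Real.exp ε - 1) / 4 with hu
  have hE : 1 < Real.exp ε := by rw [Real.one_lt_exp_iff]; exact hε
  have hm : Measurable fun z => gapWeight ε u (x, z) :=
    (measurable_gapWeight ε u).comp measurable_prodMk_left
  have hmul : Real.exp (-(x - ε)) = Real.exp ε * Real.exp (-x) := by
    rw [← Real.exp_add]; congr 1; ring
  have hq : Real.exp (-(x - ε)) ≤ 1 := by rw [Real.exp_le_one_iff]; linarith
  rw [← lintegral_add_compl _ (measurableSet_Ioi (a := x - ε)), Set.compl_Ioi]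
  have h1 : ∫⁻ z in Set.Iic (x - ε), gapWeight ε u (x, z) ∂(expMeasure 1) =
      ENNReal.ofReal (1 - Real.exp (-(x - ε))) := by
    rw [← expMeasure_Iic (by linarith), ← one_mul (expMeasure 1 _), ← setLIntegral_const]
    refine setLIntegral_congr_fun measurableSet_Iic fun z hz => ?_
    have hz' := Set.mem_Iic.1 hz
    simp only [gapWeight]
    rw [if_neg (by linarith), if_neg (by linarith)]
  have h2 : ∫⁻ z in Set.Ioi (x - ε), gapWeight ε u (x, z) ∂(expMeasure 1) =
      ENNReal.ofReal (1 / 2 * (Real.exp (-(x - ε)) - Real.exp (-x)) + u * Real.exp (-x)) := by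
    have hun : Set.Ioi (x - ε) = Set.Ioc (x - ε) x ∪ Set.Ioi x :=
      (Set.Ioc_union_Ioi_eq_Ioi (by linarith)).symm
    have hIoc : expMeasure 1 (Set.Ioc (x - ε) x) =
        ENNReal.ofReal (Real.exp (-(x - ε)) - Real.exp (-x)) := by
      have := measureReal_sdiff (μ := expMeasure 1) (s₁ := Set.Ioi (x - ε)) (s₂ := Set.Ioi x)
        (Set.Ioi_subset_Ioi (by linarith)) measurableSet_Ioi
      rw [Set.Ioi_sdiff_Ioi, expMeasure_real_Ioi (by linarith), expMeasure_real_Ioi (by linarith)]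
        at this
      rw [← this, ofReal_measureReal]
    rw [hun, lintegral_union measurableSet_Ioi (by
      rw [Set.disjoint_left]
      intro z h3 h4
      have := h3.2
      have := Set.mem_Ioi.1 h4
      linarith)]
    have h3 : ∫⁻ z in Set.Ioi x, gapWeight ε u (x, z) ∂(expMeasure 1) =
        ENNReal.ofReal u * ENNReal.ofReal (Real.exp (-x)) := by
      rw [← expMeasure_Ioi (by linarith), ← setLIntegral_const]
      refine setLIntegral_congr_fun measurableSet_Ioi fun z hz => ?_
      have hz' := Set.mem_Ioi.1 hz
      simp only [gapWeight]
      rw [if_pos (by linarith)]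
    have h4 : ∫⁻ z in Set.Ioc (x - ε) x, gapWeight ε u (x, z) ∂(expMeasure 1) =
        ENNReal.ofReal (1 / 2) * ENNReal.ofReal (Real.exp (-(x - ε)) - Real.exp (-x)) := by
      rw [← hIoc, ← setLIntegral_const]
      refine setLIntegral_congr_fun_ae measurableSet_Ioc ?_
      have hne : ∀ᵐ z ∂(expMeasure 1), z ≠ x := by
        simp [ae_iff]
      filter_upwards [hne] with z hzx hz
      simp only [gapWeight]
      rw [if_neg (not_le.2 (lt_of_le_of_ne hz.2 hzx)), if_pos hz.1]
    rw [h3, h4, ← ENNReal.ofReal_mul (by norm_num), ← ENNReal.ofReal_mul (by rw [hu]; linarith),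
      ← ENNReal.ofReal_add]
    · refine mul_nonneg (by norm_num) ?_
      rw [hmul]
      have := Real.exp_pos (-x)
      nlinarith
    · rw [hu]; have := Real.exp_pos (-x); nlinarith
  rw [h1, h2, ← ENNReal.ofReal_add]
  · congr 1
    rw [hmul, hu]
    ring
  · rw [hmul, hu]
    have := Real.exp_pos (-x)
    nlinarith
  · linarith

section

variable {Ω : Type*} [mΩ : MeasurableSpace Ω] {P : Measure Ω} [IsProbabilityMeasure P]
  {X : Ω → ℕ → ℝ}

/-- Given the value of candidate `i` the other factors are independent and identically distributed;
they are integrated out one at a time, each factor being absorbed into `g`. -/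
theorem IsExpSequence.lintegral_prod_fresh (h : IsExpSequence P X) {f : ℝ × ℝ → ℝ≥0∞}
    (hf : Measurable f) {i : ℕ} (hi : 1 ≤ i) (S : Finset ℕ) (hS : ∀ k ∈ S, 1 ≤ k) (hiS : i ∉ S)
    {g : ℝ → ℝ≥0∞} (hg : Measurable g) :
    ∫⁻ ω, g (X ω i) * ∏ k ∈ S, f (X ω i, X ω k) ∂P =
      ∫⁻ x, g x * (∫⁻ z, f (x, z) ∂(expMeasure 1)) ^ S.card ∂(expMeasure 1) := by
  induction S using Finset.induction_on generalizing g with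
  | empty =>
    simp only [Finset.prod_empty, mul_one, Finset.card_empty, pow_zero]
    rw [← h.law i hi, lintegral_map hg (h.measurable i hi)]
  | insert k S hk ih =>
    have hS' : ∀ j ∈ insert i S, 1 ≤ j := by
      intro j hj
      rcases Finset.mem_insert.1 hj with rfl | hj
      · exact hi
      · exact hS j (Finset.mem_insert_of_mem hj)
    have hkS : k ∉ insert i S := by
      intro hki
      rcases Finset.mem_insert.1 hki with rfl | hki
      · exact hiS (Finset.mem_insert_self _ _)
      · exact hk hki
    have hXi : Measurable[valuesAlg X (insert i S)] fun ω => X ω i :=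
      measurable_valuesAlg (Finset.mem_insert_self _ _)
    have hprod : Measurable[valuesAlg X (insert i S)] fun ω => ∏ j ∈ S, f (X ω i, X ω j) :=
      Finset.measurable_fun_prod S fun j hj =>
        hf.comp (hXi.prodMk (measurable_valuesAlg (Finset.mem_insert_of_mem hj)))
    have hW : Measurable[valuesAlg X (insert i S)] fun ω =>
        (g (X ω i) * ∏ j ∈ S, f (X ω i, X ω j), X ω i) :=
      ((hg.comp hXi).mul hprod).prodMk hXi
    have step := h.lintegral_fresh hS' (hS k (Finset.mem_insert_self _ _)) hkS hW
      (g := fun z => z.1.1 * f (z.1.2, z.2)) (by fun_prop)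
    have hF : Measurable fun x => ∫⁻ z, f (x, z) ∂(expMeasure 1) := hf.lintegral_prod_right'
    calc _ = ∫⁻ ω, (g (X ω i) * ∏ j ∈ S, f (X ω i, X ω j)) * f (X ω i, X ω k) ∂P := by
          refine lintegral_congr fun ω => ?_
          rw [Finset.prod_insert hk]
          ring
      _ = _ := step
      _ = ∫⁻ ω, (g (X ω i) * ∫⁻ z, f (X ω i, z) ∂(expMeasure 1)) *
            ∏ j ∈ S, f (X ω i, X ω j) ∂P := by
          refine lintegral_congr fun ω => ?_
          have hfi : Measurable fun x => f (X ω i, x) := hf.comp measurable_prodMk_left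
          simp only
          rw [lintegral_const_mul _ hfi]
          ring
      _ = _ := by
          rw [ih (fun j hj => hS j (Finset.mem_insert_of_mem hj))
            (fun h => hiS (Finset.mem_insert_of_mem h))
            (g := fun x => g x * ∫⁻ z, f (x, z) ∂(expMeasure 1)) (hg.mul hF)]
          refine lintegral_congr fun x => ?_
          rw [Finset.card_insert_of_notMem hk, pow_succ]
          ring

theorem prod_gapWeight (ε u : ℝ) (hu : 0 ≤ u) (x : ℕ → ℝ) (i : ℕ) (S : Finset ℕ) :
    ∏ k ∈ S, gapWeight ε u (x i, x k) = ENNReal.ofReal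
      (u ^ (S.filter fun k => x i ≤ x k).card *
        (1 / 2) ^ (S.filter fun k => x i - ε < x k ∧ x k < x i).card) := by
  induction S using Finset.induction_on with
  | empty => simp
  | insert k S hk ih =>
    rw [Finset.prod_insert hk, ih, Finset.filter_insert, Finset.filter_insert, gapWeight]
    by_cases h1 : x i ≤ x k
    · rw [if_pos h1, if_pos h1, if_neg (by intro h2; linarith [h2.2]),
        Finset.card_insert_of_notMem (by simp [hk]), ← ENNReal.ofReal_mul hu]
      congr 1; ring
    · rw [if_neg h1, if_neg h1]
      by_cases h2 : x i - ε < x k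
      · rw [if_pos h2, if_pos ⟨h2, not_le.1 h1⟩, Finset.card_insert_of_notMem (by simp [hk]),
          ← ENNReal.ofReal_mul (by norm_num)]
        congr 1; ring
      · rw [if_neg h2, if_neg (fun h3 => h2 h3.1), one_mul]

/-- An exponential Markov bound for each candidate i. On its event the product of weights is at
least (1+c)^{R-1} 2^{-C}, whereas its mean given X_i = x is (1 - c e^{-x})^{N-1}. Integrated over x
this is of order 1/N, which compensates for the union over N candidates. The bound is therefore
uniform in N and small for large R. -/
theorem IsExpSequence.measure_gapEvent_le (h : IsExpSequence P X) {ε : ℝ} (hε : 0 < ε)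
    (C R N : ℕ) :
    P {ω | gapEvent ε C R N (X ω)} ≤ ENNReal.ofReal
      (2 ^ C / (1 + (Real.exp ε - 1) / 4) ^ (R - 1) *
        (Real.exp ((Real.exp ε - 1) / 4) / ((Real.exp ε - 1) / 4))) := by
  set c := (Real.exp ε - 1) / 4 with hc
  have hc0 : 0 < c := by
    have : 1 < Real.exp ε := by rw [Real.one_lt_exp_iff]; exact hε
    rw [hc]; linarith
  set K : ℝ := 2 ^ C / (1 + c) ^ (R - 1) with hK
  have hK0 : 0 < K := by positivity
  rcases Nat.eq_zero_or_pos N with rfl | hN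
  · simp [gapEvent]
  have hNr : (0 : ℝ) < N := by exact_mod_cast hN
  have key : ∀ i ∈ Finset.Icc 1 N, P {ω | ε ≤ X ω i ∧
      R ≤ ((Finset.Icc 1 N).filter fun k => X ω i ≤ X ω k).card ∧
      ((Finset.Icc 1 N).filter fun k => X ω i - ε < X ω k ∧ X ω k < X ω i).card ≤ C} ≤
      ENNReal.ofReal (K * (Real.exp c * (1 / (c * N)))) := by
    intro i hi
    set S := (Finset.Icc 1 N).erase i with hS
    have hcard : S.card = N - 1 := by
      rw [hS, Finset.card_erase_of_mem hi, Nat.card_Icc]; omega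
    have hS1 : ∀ k ∈ S, 1 ≤ k := fun k hk => one_le_of_mem_Icc (Finset.mem_of_mem_erase hk)
    have hiS : i ∉ S := Finset.notMem_erase i _
    set g : ℝ → ℝ≥0∞ := fun x => if ε ≤ x then ENNReal.ofReal K else 0 with hg
    have hgm : Measurable g := Measurable.ite measurableSet_Ici measurable_const measurable_const
    have hpw : ∀ ω, Set.indicator {ω | ε ≤ X ω i ∧
        R ≤ ((Finset.Icc 1 N).filter fun k => X ω i ≤ X ω k).card ∧
        ((Finset.Icc 1 N).filter fun k => X ω i - ε < X ω k ∧ X ω k < X ω i).card ≤ C}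
        (fun _ => (1 : ℝ≥0∞)) ω ≤ g (X ω i) * ∏ k ∈ S, gapWeight ε (1 + c) (X ω i, X ω k) := by
      intro ω
      by_cases hω : ω ∈ {ω | ε ≤ X ω i ∧
        R ≤ ((Finset.Icc 1 N).filter fun k => X ω i ≤ X ω k).card ∧
        ((Finset.Icc 1 N).filter fun k => X ω i - ε < X ω k ∧ X ω k < X ω i).card ≤ C}
      · rw [Set.indicator_of_mem hω]
        obtain ⟨h1, h2, h3⟩ := hω
        rw [prod_gapWeight ε (1 + c) (by linarith), hg]
        simp only [if_pos h1]
        rw [← ENNReal.ofReal_mul hK0.le, ← ENNReal.ofReal_one]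
        apply ENNReal.ofReal_le_ofReal
        -- Candidate `i` dominates itself but does not belong to `S`, hence the exponent R - 1.
        have h4 : R - 1 ≤ (S.filter fun k => X ω i ≤ X ω k).card := by
          rw [hS, Finset.filter_erase]
          have := Finset.pred_card_le_card_erase
            (s := (Finset.Icc 1 N).filter fun k => X ω i ≤ X ω k) (a := i)
          omega
        have h5 : (S.filter fun k => X ω i - ε < X ω k ∧ X ω k < X ω i).card ≤ C :=
          (Finset.card_le_card (Finset.filter_subset_filter _ (Finset.erase_subset _ _))).trans h3
        have h6 : (1 + c) ^ (R - 1) ≤ (1 + c) ^ (S.filter fun k => X ω i ≤ X ω k).card :=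
          pow_le_pow_right₀ (by linarith) h4
        have h7 : (1 / 2 : ℝ) ^ C ≤
            (1 / 2) ^ (S.filter fun k => X ω i - ε < X ω k ∧ X ω k < X ω i).card :=
          pow_le_pow_of_le_one (by norm_num) (by norm_num) h5
        have hK1 : K * ((1 + c) ^ (R - 1) * (1 / 2) ^ C) = 1 := by
          rw [hK, one_div, inv_pow]
          have : (1 + c) ^ (R - 1) ≠ 0 := by positivity
          field_simp
        calc (1 : ℝ) = K * ((1 + c) ^ (R - 1) * (1 / 2) ^ C) := hK1.symm
          _ ≤ _ := by gcongr
      · rw [Set.indicator_of_notMem hω]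
        exact zero_le
    have hq : ∀ x, g x * (∫⁻ z, gapWeight ε (1 + c) (x, z) ∂(expMeasure 1)) ^ S.card ≤
        ENNReal.ofReal (K * Real.exp c) *
          ENNReal.ofReal (Real.exp (-(c * N * Real.exp (-x)))) := by
      intro x
      by_cases hx : ε ≤ x
      · rw [lintegral_gapWeight hε hx, hg]
        simp only [if_pos hx]
        have hex : Real.exp (-x) ≤ 1 := by rw [Real.exp_le_one_iff]; linarith
        rw [← ENNReal.ofReal_mul (by positivity), hcard]
        have h1 : (ENNReal.ofReal (1 - c * Real.exp (-x))) ^ (N - 1) ≤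
            ENNReal.ofReal (Real.exp (-(c * Real.exp (-x)) * (N - 1 : ℕ))) := by
          have h2 : 1 - c * Real.exp (-x) ≤ Real.exp (-(c * Real.exp (-x))) := by
            have := Real.add_one_le_exp (-(c * Real.exp (-x)))
            linarith
          calc _ ≤ (ENNReal.ofReal (Real.exp (-(c * Real.exp (-x))))) ^ (N - 1) := by
                gcongr
            _ = _ := by
                rw [← ENNReal.ofReal_pow (Real.exp_pos _).le, ← Real.exp_nat_mul]
                congr 2
                ring
        refine (mul_le_mul_right h1 _).trans ?_
        rw [← ENNReal.ofReal_mul hK0.le]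
        apply ENNReal.ofReal_le_ofReal
        -- The factor e^c pays for the exponent N - 1 in place of N, because e^{-x} ≤ 1.
        rw [mul_assoc, ← Real.exp_add]
        refine mul_le_mul_of_nonneg_left (Real.exp_le_exp.2 ?_) hK0.le
        rw [Nat.cast_sub hN]
        push_cast
        nlinarith
      · rw [hg]
        simp only [if_neg hx, zero_mul]
        exact zero_le
    calc P _ ≤ ∫⁻ ω, Set.indicator {ω | ε ≤ X ω i ∧
          R ≤ ((Finset.Icc 1 N).filter fun k => X ω i ≤ X ω k).card ∧
          ((Finset.Icc 1 N).filter fun k => X ω i - ε < X ω k ∧ X ω k < X ω i).card ≤ C}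
          (fun _ => (1 : ℝ≥0∞)) ω ∂P := by
          rw [lintegral_indicator₀]
          · simp
          · refine MeasurableSet.nullMeasurableSet ?_
            have hXi := h.measurable i (one_le_of_mem_Icc hi)
            have m1 : Measurable fun ω => ((Finset.Icc 1 N).filter fun k => X ω i ≤ X ω k) := by
              rw [measurable_finset_iff]
              intro k
              by_cases hk : k ∈ Finset.Icc 1 N
              · simp only [Finset.mem_filter, hk, true_and]
                exact measurableSet_setOfPred.1
                  (measurableSet_le hXi (h.measurable k (one_le_of_mem_Icc hk)))
              · simp only [Finset.mem_filter, hk, false_and]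
                exact measurable_const
            have m2 : Measurable fun ω => ((Finset.Icc 1 N).filter fun k =>
                X ω i - ε < X ω k ∧ X ω k < X ω i) := by
              rw [measurable_finset_iff]
              intro k
              by_cases hk : k ∈ Finset.Icc 1 N
              · simp only [Finset.mem_filter, hk, true_and]
                have hXk := h.measurable k (one_le_of_mem_Icc hk)
                exact measurableSet_setOfPred.1
                  ((measurableSet_lt (hXi.sub_const ε) hXk).inter (measurableSet_lt hXk hXi))
              · simp only [Finset.mem_filter, hk, false_and]
                exact measurable_const
            have mc : Measurable (Finset.card : Finset ℕ → ℕ) := measurable_of_countable _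
            exact (measurableSet_le measurable_const hXi).inter
              ((measurableSet_le measurable_const (mc.comp m1)).inter
                (measurableSet_le (mc.comp m2) measurable_const))
      _ ≤ ∫⁻ ω, g (X ω i) * ∏ k ∈ S, gapWeight ε (1 + c) (X ω i, X ω k) ∂P := lintegral_mono hpw
      _ = ∫⁻ x, g x * (∫⁻ z, gapWeight ε (1 + c) (x, z) ∂(expMeasure 1)) ^ S.card
            ∂(expMeasure 1) :=
          h.lintegral_prod_fresh (measurable_gapWeight _ _) (one_le_of_mem_Icc hi) S hS1 hiS hgm
      _ ≤ ∫⁻ x, ENNReal.ofReal (K * Real.exp c) *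
            ENNReal.ofReal (Real.exp (-(c * N * Real.exp (-x)))) ∂(expMeasure 1) :=
          lintegral_mono hq
      _ = ENNReal.ofReal (K * Real.exp c) *
            ∫⁻ x, ENNReal.ofReal (Real.exp (-(c * N * Real.exp (-x)))) ∂(expMeasure 1) :=
          lintegral_const_mul _ (by fun_prop)
      _ ≤ ENNReal.ofReal (K * Real.exp c) * ENNReal.ofReal (1 / (c * N)) :=
          mul_le_mul_right (lintegral_exp_neg_mul_exp_neg_le (by positivity)) _
      _ = _ := by
          rw [← ENNReal.ofReal_mul (by positivity), mul_assoc]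
  calc P {ω | gapEvent ε C R N (X ω)} ≤ P (⋃ i ∈ Finset.Icc 1 N, {ω | ε ≤ X ω i ∧
      R ≤ ((Finset.Icc 1 N).filter fun k => X ω i ≤ X ω k).card ∧
      ((Finset.Icc 1 N).filter fun k => X ω i - ε < X ω k ∧ X ω k < X ω i).card ≤ C}) := by
        refine measure_mono fun ω hω => ?_
        obtain ⟨i, hi, h1⟩ := hω
        exact Set.mem_biUnion hi h1
    _ ≤ ∑ i ∈ Finset.Icc 1 N, ENNReal.ofReal (K * (Real.exp c * (1 / (c * N)))) :=
        (measure_biUnion_finset_le _ _).trans (Finset.sum_le_sum key)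
    _ = ENNReal.ofReal (K * (Real.exp c / c)) := by
        rw [Finset.sum_const, Nat.card_Icc, Nat.add_sub_cancel, nsmul_eq_mul,
          ← ENNReal.ofReal_natCast, ← ENNReal.ofReal_mul hNr.le]
        congr 1
        field_simp

theorem IsExpSequence.exists_measure_gapEvent_le (h : IsExpSequence P X) {ε : ℝ} (hε : 0 < ε)
    (C : ℕ) {η : ℝ} (hη : 0 < η) :
    ∃ R : ℕ, ∀ N, P {ω | gapEvent ε C R N (X ω)} ≤ ENNReal.ofReal η := by
  set c := (Real.exp ε - 1) / 4 with hc
  have hc0 : 0 < c := by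
    have : 1 < Real.exp ε := by rw [Real.one_lt_exp_iff]; exact hε
    rw [hc]; linarith
  obtain ⟨j, hj⟩ := pow_unbounded_of_one_lt (2 ^ C * (Real.exp c / c) / η)
    (by linarith : 1 < 1 + c)
  refine ⟨j + 1, fun N => (h.measure_gapEvent_le hε C (j + 1) N).trans ?_⟩
  apply ENNReal.ofReal_le_ofReal
  rw [← hc, Nat.add_sub_cancel]
  rw [div_lt_iff₀ hη] at hj
  rw [div_mul_eq_mul_div, div_le_iff₀ (by positivity)]
  linarith

end

/-! ### Divergence of the thresholds: deterministic part -/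

/-- The number of `k ∈ {1, …, m}` with `δ_k = 1`. -/
def stallCount (r : ℕ → ℕ) (m : ℕ) : ℝ := m + 1 - r m

section

variable {r : ℕ → ℕ}

theorem stallCount_zero (hr : IsRankSequence r) : stallCount r 0 = 0 := by
  simp [stallCount, hr.1]

theorem stallCount_succ (hr : IsRankSequence r) (m : ℕ) :
    stallCount r (m + 1) = stallCount r m + delta r (m + 1) := by
  have h := hr.2 m
  unfold stallCount delta
  rw [Nat.add_sub_cancel]
  split_ifs with h1
  · rw [h1]; push_cast; ring
  · have : r (m + 1) = r m + 1 := by omega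
    rw [this]; push_cast; ring

theorem delta_nonneg (m : ℕ) : 0 ≤ delta r m := by
  unfold delta; split_ifs <;> norm_num

theorem delta_le_one (m : ℕ) : delta r m ≤ 1 := by
  unfold delta; split_ifs <;> norm_num

theorem stallCount_mono (hr : IsRankSequence r) : Monotone (stallCount r) :=
  monotone_nat_of_le_succ fun m => by
    rw [stallCount_succ hr]
    have := delta_nonneg (r := r) (m + 1)
    linarith

theorem stallCount_nonneg (hr : IsRankSequence r) (m : ℕ) : 0 ≤ stallCount r m := by
  rw [← stallCount_zero hr]
  exact stallCount_mono hr (Nat.zero_le m)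

theorem stallCount_le (hr : IsRankSequence r) (m : ℕ) : stallCount r m ≤ m := by
  have : (1 : ℝ) ≤ r m := by exact_mod_cast hr.one_le m
  unfold stallCount
  linarith

/-- Abel summation: the stall count is the partial sum of δ, and the weights 1/(j+1) have
differences 1/((j+1)(j+2)). -/
theorem sum_delta_div_eq (hr : IsRankSequence r) (K : ℕ) :
    ∑ j ∈ Finset.range K, delta r (j + 1) / ((j : ℝ) + 1) = stallCount r K / (K + 1) +
      ∑ j ∈ Finset.range K, stallCount r (j + 1) / (((j : ℝ) + 1) * (j + 2)) := by
  induction K with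
  | zero => simp [stallCount_zero hr]
  | succ K ih =>
    rw [Finset.sum_range_succ, Finset.sum_range_succ, ih, stallCount_succ hr]
    push_cast
    field_simp
    ring

theorem exists_card_acceptedValues_eq {x : ℕ → ℝ}
    (hunb : ∀ m, ∃ n, m ≤ (acceptedValues r x n).card) (m : ℕ) :
    ∃ n, (acceptedValues r x n).card = m := by
  classical
  have h := hunb m
  have h1 := Nat.find_spec h
  rcases Nat.eq_zero_or_pos (Nat.find h) with h0 | h0
  · refine ⟨0, ?_⟩
    rw [h0] at h1
    simp only [acceptedValues, Multiset.card_zero, nonpos_iff_eq_zero] at h1 ⊢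
    omega
  · have h2 := Nat.find_min h (Nat.sub_lt h0 one_pos)
    have h3 := card_acceptedValues_succ_le (r := r) (x := x) (Nat.find h - 1)
    rw [Nat.sub_add_cancel h0] at h3
    exact ⟨Nat.find h, by omega⟩

/-- If the thresholds stayed below c, all values above c would be accepted and would also count
towards r(M_n). The law of large numbers then makes M_n and r(m) grow at least linearly. Summability
along the random times passes to the deterministic series of stall counts, and Abel summation
contradicts the divergence of the series of δ_k / r(k). -/
theorem tendsto_threshold_of_summable (hr : IsRankSequence r)
    (hdiv : Tendsto (fun m : ℕ => ∑ k ∈ Finset.Icc 1 m, delta r k / (r k : ℝ)) atTop atTop)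
    {x : ℕ → ℝ}
    (hlln : ∀ c : ℕ, Tendsto (fun n : ℕ =>
      (((Finset.Icc 1 n).filter fun k => (c : ℝ) < x k).card : ℝ) / n) atTop
        (𝓝 (Real.exp (-c))))
    (hsum : Summable fun j : ℕ =>
      stallCount r (acceptedValues r x (j + 1)).card / (((j : ℝ) + 1) * (j + 2))) :
    Tendsto (fun n => threshold r (acceptedValues r x n)) atTop atTop := by
  by_contra hcon
  obtain ⟨c, hc⟩ : ∃ c : ℕ, ∀ n, threshold r (acceptedValues r x n) ≤ c := by
    rcases tendsto_atTop_of_monotone (threshold_acceptedValues_mono (x := x) hr) with h | ⟨l, hl⟩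
    · exact absurd h hcon
    · obtain ⟨c, hc⟩ := exists_nat_ge l
      exact ⟨c, fun n =>
        ((threshold_acceptedValues_mono (x := x) hr).ge_of_tendsto hl n).trans hc⟩
  set cnt : ℕ → ℕ := fun n => ((Finset.Icc 1 n).filter fun k => (c : ℝ) < x k).card with hcnt
  have hcard : ∀ n, cnt n ≤ (acceptedValues r x n).card := by
    intro n
    rw [hcnt]
    simp only
    rw [← card_filter_acceptedValues hr (fun v => (c : ℝ) < v) n
      fun v hv => lt_of_le_of_lt (hc n) hv]
    exact Multiset.card_le_card (Multiset.filter_le _ _)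
  have hrank : ∀ n, cnt n ≤ r (acceptedValues r x n).card := by
    intro n
    refine le_trans (Finset.card_le_card ?_) (card_above_threshold_lt (x := x) hr n).le
    intro k hk
    rw [Finset.mem_filter] at hk ⊢
    exact ⟨hk.1, lt_of_le_of_lt (hc n) hk.2⟩
  -- Any integer q > e^c works: eventually more than a proportion 1/q of the candidates exceed c.
  obtain ⟨q, hq⟩ := exists_nat_gt (Real.exp c)
  have hq0 : (0 : ℝ) < q := lt_trans (Real.exp_pos _) hq
  have hq1 : 1 ≤ q := by exact_mod_cast hq0
  obtain ⟨n₀, hn₀⟩ : ∃ n₀, ∀ n ≥ n₀, n ≤ q * cnt n := by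
    have h1 : (q : ℝ)⁻¹ < Real.exp (-c) := by
      rw [Real.exp_neg]
      exact inv_strictAnti₀ (Real.exp_pos _) hq
    obtain ⟨n₀, h2⟩ := eventually_atTop.1 ((hlln c).eventually (eventually_gt_nhds h1))
    refine ⟨n₀, fun n hn => ?_⟩
    rcases Nat.eq_zero_or_pos n with rfl | hpos
    · simp
    have h3 := h2 n hn
    have hn' : (0 : ℝ) < n := by exact_mod_cast hpos
    rw [lt_div_iff₀ hn', inv_mul_lt_iff₀ hq0] at h3
    exact_mod_cast h3.le
  have hunb : ∀ m, ∃ n, m ≤ (acceptedValues r x n).card := by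
    intro m
    refine ⟨q * (m + n₀), le_trans ?_ (hcard _)⟩
    have h1 := hn₀ (q * (m + n₀)) (by nlinarith)
    have h2 := Nat.le_of_mul_le_mul_left h1 (by omega)
    omega
  have hrm : ∀ m ≥ n₀, m ≤ q * r m := by
    intro m hm
    obtain ⟨n, hn⟩ := exists_card_acceptedValues_eq hunb m
    have h1 := card_acceptedValues_le (r := r) (x := x) n
    have h2 := hn₀ n (by omega)
    have h3 := hrank n
    rw [hn] at h3 h1
    exact h1.trans (h2.trans (Nat.mul_le_mul_left q h3))
  set a : ℕ → ℝ := fun j =>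
    stallCount r (acceptedValues r x (j + 1)).card / (((j : ℝ) + 1) * (j + 2)) with ha
  -- Only the times q(j+1) are kept. By then at least j+1 candidates have been accepted for large j,
  -- so the stall count there dominates that of j+1, and the denominators differ by a factor of at
  -- most q².
  have hsum2 : Summable fun j : ℕ => a (q * (j + 1) - 1) := by
    refine hsum.comp_injective fun i j hij => ?_
    have hij' : q * (i + 1) - 1 = q * (j + 1) - 1 := hij
    have h1 : 1 ≤ q * (i + 1) := Nat.mul_pos hq1 (by omega)
    have h2 : 1 ≤ q * (j + 1) := Nat.mul_pos hq1 (by omega)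
    have h3 : q * (i + 1) = q * (j + 1) := by omega
    have := Nat.eq_of_mul_eq_mul_left (by omega) h3
    omega
  have hsum3 : Summable fun j : ℕ => stallCount r (j + 1) / (((j : ℝ) + 1) * (j + 2)) := by
    rw [← summable_nat_add_iff n₀]
    refine Summable.of_nonneg_of_le (fun j => ?_) (fun j => ?_)
      (((summable_nat_add_iff n₀).2 hsum2).mul_left ((q : ℝ) ^ 2))
    · have := stallCount_nonneg hr (j + n₀ + 1)
      positivity
    · set m := j + n₀ with hm
      have hqm : 1 ≤ q * (m + 1) := Nat.mul_pos hq1 (by omega)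
      have h1 : m + 1 ≤ (acceptedValues r x (q * (m + 1))).card := by
        refine le_trans ?_ (hcard _)
        have h2 := hn₀ (q * (m + 1)) (by nlinarith)
        exact Nat.le_of_mul_le_mul_left h2 (by omega)
      have h2 := stallCount_mono hr h1
      have h0 := stallCount_nonneg hr (m + 1)
      have e1 : q * (m + 1) - 1 + 1 = q * (m + 1) := by omega
      have e2 : ((q * (m + 1) - 1 : ℕ) : ℝ) = q * (m + 1) - 1 := by
        rw [Nat.cast_sub hqm]; push_cast; ring
      have hq1' : (1 : ℝ) ≤ q := by exact_mod_cast hq1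
      simp only [ha]
      rw [e1, e2, ← mul_div_assoc, div_le_div_iff₀ (by positivity) (by
        have : (0 : ℝ) < q * (m + 1) := by positivity
        have h3 : (q : ℝ) * (m + 1) - 1 + 1 = q * (m + 1) := by ring
        rw [h3]
        refine mul_pos this (by linarith))]
      have h3 : (q : ℝ) * (m + 1) - 1 + 1 = q * (m + 1) := by ring
      have h4 : (q : ℝ) * (m + 1) - 1 + 2 ≤ q * (m + 2) := by nlinarith
      rw [h3]
      have hm0 : (0 : ℝ) ≤ m := Nat.cast_nonneg m
      calc stallCount r (m + 1) * (q * (m + 1) * (q * (m + 1) - 1 + 2))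
          ≤ stallCount r (m + 1) * (q * (m + 1) * (q * (m + 2))) := by gcongr
        _ = q ^ 2 * stallCount r (m + 1) * ((m + 1) * (m + 2)) := by ring
        _ ≤ _ := by gcongr
  set B : ℝ := ∑' j : ℕ, stallCount r (j + 1) / (((j : ℝ) + 1) * (j + 2)) with hB
  have hbound : ∀ K : ℕ, ∑ k ∈ Finset.Icc 1 K, delta r k / (r k : ℝ) ≤ q * (1 + B) + n₀ := by
    intro K
    have h1 : ∑ j ∈ Finset.range K, delta r (j + 1) / ((j : ℝ) + 1) ≤ 1 + B := by
      rw [sum_delta_div_eq hr]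
      refine add_le_add ?_ (hsum3.sum_le_tsum _ fun j _ => ?_)
      · rw [div_le_one (by positivity)]
        have := stallCount_le hr K
        linarith
      · have := stallCount_nonneg hr (j + 1)
        positivity
    have h2 : ∑ k ∈ Finset.Icc 1 K, delta r k / (r k : ℝ) =
        ∑ j ∈ Finset.range K, delta r (j + 1) / (r (j + 1) : ℝ) := by
      rw [Finset.range_eq_Ico, Finset.sum_Ico_add' (fun k => delta r k / (r k : ℝ)) 0 K 1]
      rfl
    -- From rank n₀ onwards 1/r(m) ≤ q/m; each of the at most n₀ earlier terms is bounded by 1.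
    have h3 : ∀ j ∈ Finset.range K, delta r (j + 1) / (r (j + 1) : ℝ) ≤
        q * (delta r (j + 1) / ((j : ℝ) + 1)) + if j < n₀ then 1 else 0 := by
      intro j _
      have hd := delta_nonneg (r := r) (j + 1)
      have hd1 := delta_le_one (r := r) (j + 1)
      have hr1 : (1 : ℝ) ≤ r (j + 1) := by exact_mod_cast hr.one_le (j + 1)
      split_ifs with hj
      · have h4 : delta r (j + 1) / (r (j + 1) : ℝ) ≤ 1 := by
          rw [div_le_one (by linarith)]; linarith
        have h5 : 0 ≤ (q : ℝ) * (delta r (j + 1) / ((j : ℝ) + 1)) := by positivity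
        linarith
      · have h4 : ((j + 1 : ℕ) : ℝ) ≤ q * r (j + 1) := by exact_mod_cast hrm (j + 1) (by omega)
        push_cast at h4
        rw [add_zero, ← mul_div_assoc, div_le_div_iff₀ (by linarith) (by positivity)]
        nlinarith
    rw [h2]
    refine (Finset.sum_le_sum h3).trans ?_
    rw [Finset.sum_add_distrib, ← Finset.mul_sum]
    refine add_le_add (mul_le_mul_of_nonneg_left h1 hq0.le) ?_
    rw [Finset.sum_ite, Finset.sum_const_zero, add_zero, Finset.sum_const, nsmul_eq_mul, mul_one]
    have h5 : ((Finset.range K).filter fun j => j < n₀).card ≤ n₀ := by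
      calc _ ≤ (Finset.range n₀).card := Finset.card_le_card fun j hj => by
            simpa using (Finset.mem_filter.1 hj).2
        _ = n₀ := Finset.card_range _
    exact_mod_cast h5
  obtain ⟨K, hK⟩ := (hdiv.eventually (eventually_gt_atTop (q * (1 + B) + n₀))).exists
  linarith [hbound K]

/-- A telescoping bound for averages of an antitone sequence. -/
theorem sum_average_sub_le {π : ℕ → ℝ} (hπ : Antitone π) (h0 : ∀ k, 0 ≤ π k) (K : ℕ) :
    ∑ j ∈ Finset.range K, (∑ k ∈ Finset.range (j + 1), (π k - π (j + 1))) /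
      (((j : ℝ) + 1) * (j + 2)) ≤ π 0 := by
  -- Adding the boundary term turns the estimate into an exact identity, provable by induction; the
  -- boundary term is nonnegative and then discarded.
  have key : ∑ j ∈ Finset.range K, (∑ k ∈ Finset.range (j + 1), (π k - π (j + 1))) /
      (((j : ℝ) + 1) * (j + 2)) + (∑ k ∈ Finset.range K, (π k - π K)) / (K + 1) = π 0 - π K := by
    induction K with
    | zero => simp
    | succ K ih =>
      have e : ∑ k ∈ Finset.range (K + 1), (π k - π (K + 1)) =
          ∑ k ∈ Finset.range K, (π k - π K) + (K + 1) * (π K - π (K + 1)) := by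
        rw [Finset.sum_range_succ]
        simp only [Finset.sum_sub_distrib, Finset.sum_const, Finset.card_range, nsmul_eq_mul]
        ring
      rw [Finset.sum_range_succ, e]
      have h1 : (K : ℝ) + 1 ≠ 0 := by positivity
      have h2 : (K : ℝ) + 2 ≠ 0 := by positivity
      push_cast
      have h3 : (K : ℝ) + 1 + 1 = K + 2 := by ring
      rw [h3]
      have h4 : π 0 - π (K + 1) = (π 0 - π K) + (π K - π (K + 1)) := by ring
      rw [h4, ← ih]
      field_simp
      ring
  have h1 : 0 ≤ (∑ k ∈ Finset.range K, (π k - π K)) / ((K : ℝ) + 1) := by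
    refine div_nonneg (Finset.sum_nonneg fun k hk => ?_) (by positivity)
    have := hπ (Finset.mem_range.1 hk).le
    linarith
  have := h0 K
  linarith

/-- Comparing empirical tail counts with `n e^{-y}`, uniformly in `y`, on a finite grid. -/
theorem mul_exp_neg_sub_card_le (x : ℕ → ℝ) (n : ℕ) {g : ℕ} (hg : 1 ≤ g) {y : ℝ} (hy : 0 ≤ y) :
    n * Real.exp (-y) - (((Finset.Icc 1 n).filter fun k => y < x k).card : ℝ) ≤
      n / g + ∑ i ∈ Finset.Icc 1 g,
        |(((Finset.Icc 1 n).filter fun k => Real.log (g / i) < x k).card : ℝ) -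
          n * Real.exp (-Real.log (g / i))| := by
  have hg0 : (0 : ℝ) < g := by exact_mod_cast hg
  have hn0 : (0 : ℝ) ≤ n := Nat.cast_nonneg n
  set S := ∑ i ∈ Finset.Icc 1 g,
        |(((Finset.Icc 1 n).filter fun k => Real.log (g / i) < x k).card : ℝ) -
          n * Real.exp (-Real.log (g / i))| with hS
  have hS0 : 0 ≤ S := Finset.sum_nonneg fun _ _ => abs_nonneg _
  -- Rounding e^{-y} down to i/g replaces y by the next higher grid level log(g/i), at a cost of
  -- n/g. When i = 0 no grid level is needed, since n e^{-y} is itself at most n/g.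
  set i := ⌊g * Real.exp (-y)⌋₊ with hi
  have h1 : (i : ℝ) ≤ g * Real.exp (-y) := Nat.floor_le (by positivity)
  have h2 : g * Real.exp (-y) < i + 1 := Nat.lt_floor_add_one _
  have hy1 : Real.exp (-y) ≤ 1 := by rw [Real.exp_le_one_iff]; linarith
  have h3 : n * Real.exp (-y) ≤ n * (i / g) + n / g := by
    have : Real.exp (-y) ≤ i / g + 1 / g := by
      rw [← add_div, le_div_iff₀ hg0]; linarith
    calc n * Real.exp (-y) ≤ n * (i / g + 1 / g) := mul_le_mul_of_nonneg_left this hn0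
      _ = _ := by ring
  rcases Nat.eq_zero_or_pos i with h0 | h0
  · rw [h0] at h3
    have : (0 : ℝ) ≤ ((Finset.Icc 1 n).filter fun k => y < x k).card := Nat.cast_nonneg _
    simp only [CharP.cast_eq_zero, zero_div, mul_zero, zero_add] at h3
    linarith
  · have hi0 : (0 : ℝ) < i := by exact_mod_cast h0
    have hig : i ≤ g := by
      have : (i : ℝ) ≤ g := by nlinarith
      exact_mod_cast this
    have hexp : Real.exp (-Real.log (g / i)) = i / g := by
      rw [Real.exp_neg, Real.exp_log (by positivity), inv_div]
    have hlog : y ≤ Real.log (g / i) := by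
      rw [Real.le_log_iff_exp_le (by positivity), le_div_iff₀ hi0]
      rw [Real.exp_neg] at h1
      have := Real.exp_pos y
      rw [← div_eq_mul_inv, le_div_iff₀ this] at h1
      linarith
    have h4 : |(((Finset.Icc 1 n).filter fun k => Real.log (g / i) < x k).card : ℝ) -
          n * Real.exp (-Real.log (g / i))| ≤ S :=
      Finset.single_le_sum (f := fun i : ℕ =>
        |(((Finset.Icc 1 n).filter fun k => Real.log (g / i) < x k).card : ℝ) -
          n * Real.exp (-Real.log (g / i))|) (fun _ _ => abs_nonneg _)
        (Finset.mem_Icc.2 ⟨h0, hig⟩)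
    rw [hexp] at h4
    have h5 := neg_abs_le ((((Finset.Icc 1 n).filter fun k => Real.log (g / i) < x k).card : ℝ) -
          n * (i / g))
    have h6 : (((Finset.Icc 1 n).filter fun k => Real.log (g / i) < x k).card : ℝ) ≤
        ((Finset.Icc 1 n).filter fun k => y < x k).card := by
      refine Nat.cast_le.2 (Finset.card_le_card fun k hk => ?_)
      rw [Finset.mem_filter] at hk ⊢
      exact ⟨hk.1, lt_of_le_of_lt hlog hk.2⟩
    linarith

end

/-! ### Divergence of the thresholds: probabilistic part -/

section

variable {Ω : Type*} [mΩ : MeasurableSpace Ω] {P : Measure Ω} [IsProbabilityMeasure P]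
  {X : Ω → ℕ → ℝ} {r : ℕ → ℕ}

/-- The indicator that the value of candidate `i + 1` exceeds `y`. -/
def overInd (X : Ω → ℕ → ℝ) (y : ℝ) (i : ℕ) (ω : Ω) : ℝ :=
  (Set.Ioi y).indicator (fun _ => (1 : ℝ)) (X ω (i + 1))

theorem sum_overInd (X : Ω → ℕ → ℝ) (y : ℝ) (n : ℕ) (ω : Ω) :
    ∑ i ∈ Finset.range n, overInd X y i ω =
      (((Finset.Icc 1 n).filter fun k => y < X ω k).card : ℝ) := by
  induction n with
  | zero => simp
  | succ n ih =>
    rw [Finset.sum_range_succ, ih, ← Finset.insert_Icc_right_eq_Icc_add_one (by omega),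
      Finset.filter_insert, overInd]
    by_cases h : y < X ω (n + 1)
    · rw [if_pos h, Finset.card_insert_of_notMem (by simp), Set.indicator_of_mem (by simpa using h)]
      push_cast; ring
    · rw [if_neg h, Set.indicator_of_notMem (by simpa using h), add_zero]

theorem overInd_mem_Icc (X : Ω → ℕ → ℝ) (y : ℝ) (i : ℕ) (ω : Ω) :
    overInd X y i ω ∈ Set.Icc (0 : ℝ) 1 := by
  unfold overInd
  by_cases h : X ω (i + 1) ∈ Set.Ioi y
  · rw [Set.indicator_of_mem h]; simp
  · rw [Set.indicator_of_notMem h]; simp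

theorem IsExpSequence.measurable_overInd (h : IsExpSequence P X) (y : ℝ) (i : ℕ) :
    Measurable (overInd X y i) :=
  (measurable_const.indicator measurableSet_Ioi).comp (h.measurable (i + 1) (by omega))

theorem IsExpSequence.memLp_overInd (h : IsExpSequence P X) (y : ℝ) (i : ℕ) :
    MemLp (overInd X y i) 2 P :=
  MemLp.of_bound (h.measurable_overInd y i).aestronglyMeasurable 1 (ae_of_all _ fun ω => by
    have := overInd_mem_Icc X y i ω
    rw [Real.norm_eq_abs, abs_of_nonneg this.1]
    exact this.2)

theorem IsExpSequence.integral_overInd (h : IsExpSequence P X) {y : ℝ} (hy : 0 ≤ y) (i : ℕ) :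
    ∫ ω, overInd X y i ω ∂P = Real.exp (-y) := by
  have h1 : ∫ x, (Set.Ioi y).indicator (fun _ => (1 : ℝ)) x ∂(P.map fun ω => X ω (i + 1)) =
      ∫ ω, overInd X y i ω ∂P :=
    integral_map (h.measurable (i + 1) (by omega)).aemeasurable
      (measurable_const.indicator measurableSet_Ioi).aestronglyMeasurable
  rw [← h1, h.law (i + 1) (by omega), integral_indicator measurableSet_Ioi]
  simp [expMeasure_real_Ioi hy]

theorem IsExpSequence.indepFun_overInd (h : IsExpSequence P X) (y : ℝ) {i j : ℕ} (hij : i ≠ j) :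
    IndepFun (overInd X y i) (overInd X y j) P :=
  (h.indep.indepFun hij).comp (measurable_const.indicator measurableSet_Ioi)
    (measurable_const.indicator measurableSet_Ioi)

theorem IsExpSequence.ae_tendsto_card_div (h : IsExpSequence P X) (c : ℕ) :
    ∀ᵐ ω ∂P, Tendsto (fun n : ℕ =>
      (((Finset.Icc 1 n).filter fun k => (c : ℝ) < X ω k).card : ℝ) / n) atTop
        (𝓝 (Real.exp (-c))) := by
  have := strong_law_ae_real (μ := P) (overInd X c) ((h.memLp_overInd c 0).integrable one_le_two)
    (fun i j hij => h.indepFun_overInd c hij) fun i =>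
      (IdentDistrib.mk (h.measurable (i + 1) (by omega)).aemeasurable
        (h.measurable (0 + 1) (by omega)).aemeasurable (by
          rw [h.law (i + 1) (by omega), h.law (0 + 1) (by omega)])).comp
        (measurable_const.indicator measurableSet_Ioi)
  filter_upwards [this] with ω hω
  rw [h.integral_overInd (Nat.cast_nonneg c)] at hω
  simpa only [sum_overInd] using hω

theorem IsExpSequence.integrable_card_sub (h : IsExpSequence P X) (y a : ℝ) (n : ℕ) :
    Integrable (fun ω => |(((Finset.Icc 1 n).filter fun k => y < X ω k).card : ℝ) - a|) P := by
  simp only [← sum_overInd]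
  exact ((integrable_finsetSum _ fun i _ =>
    (h.memLp_overInd y i).integrable one_le_two).sub (integrable_const _)).abs

/-- The variance of the count is at most n, so its mean absolute deviation is at most √n; again |d|
≤ d²/(2s) + s/2 stands in for Cauchy–Schwarz. -/
theorem IsExpSequence.integral_abs_card_sub_le (h : IsExpSequence P X) {y : ℝ} (hy : 0 ≤ y)
    {n : ℕ} (hn : 1 ≤ n) :
    ∫ ω, |(((Finset.Icc 1 n).filter fun k => y < X ω k).card : ℝ) - n * Real.exp (-y)| ∂P ≤
      Real.sqrt n := by
  set S : Ω → ℝ := ∑ i ∈ Finset.range n, overInd X y i with hS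
  have hSL : MemLp S 2 P := memLp_finsetSum' _ fun i _ => h.memLp_overInd y i
  have hmean : ∫ ω, S ω ∂P = n * Real.exp (-y) := by
    simp only [hS, Finset.sum_apply]
    rw [integral_finsetSum _ fun i _ => (h.memLp_overInd y i).integrable one_le_two]
    simp [h.integral_overInd hy]
  have hvar : variance S P ≤ n := by
    rw [hS, IndepFun.variance_sum (fun i _ => h.memLp_overInd y i)
      (fun i _ j _ hij => h.indepFun_overInd y hij)]
    calc ∑ i ∈ Finset.range n, variance (overInd X y i) P ≤ ∑ _i ∈ Finset.range n, (1 : ℝ) := by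
          refine Finset.sum_le_sum fun i _ => ?_
          have := variance_le_sq_of_bounded (μ := P) (a := 0) (b := 1) (X := overInd X y i)
            (ae_of_all _ fun ω => overInd_mem_Icc X y i ω) (h.measurable_overInd y i).aemeasurable
          norm_num at this
          linarith
      _ = n := by simp
  rw [variance_eq_integral hSL.aemeasurable, hmean] at hvar
  have hsq : Integrable (fun ω => (S ω - n * Real.exp (-y)) ^ 2) P :=
    (hSL.sub (memLp_const _)).integrable_sq
  have hn0 : (0 : ℝ) < n := by exact_mod_cast hn
  set s := Real.sqrt n with hs
  have hs0 : 0 < s := Real.sqrt_pos.2 hn0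
  have hss : s * s = n := Real.mul_self_sqrt hn0.le
  calc _ ≤ ∫ ω, (1 / (2 * s) * (S ω - n * Real.exp (-y)) ^ 2 + s / 2) ∂P := by
        refine integral_mono (h.integrable_card_sub y _ n)
          ((hsq.const_mul _).add (integrable_const _)) fun ω => ?_
        simp only [hS, Finset.sum_apply, sum_overInd]
        set d := (((Finset.Icc 1 n).filter fun k => y < X ω k).card : ℝ) - n * Real.exp (-y)
        have h4 : 1 / (2 * s) * d ^ 2 + s / 2 - |d| = (|d| - s) ^ 2 / (2 * s) := by
          rw [← sq_abs d]
          field_simp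
          ring
        have h5 : 0 ≤ (|d| - s) ^ 2 / (2 * s) := by positivity
        linarith
    _ = 1 / (2 * s) * ∫ ω, (S ω - n * Real.exp (-y)) ^ 2 ∂P + s / 2 := by
        rw [integral_add (hsq.const_mul _) (integrable_const _), integral_const_mul]
        simp
    _ ≤ 1 / (2 * s) * n + s / 2 := by gcongr
    _ = s := by rw [← hss]; field_simp; ring

/-- The expected value of `e^{-Y}`, for the threshold `Y` in force after `k` candidates. -/
def meanAcceptProb (P : Measure Ω) (X : Ω → ℕ → ℝ) (r : ℕ → ℕ) (k : ℕ) : ℝ :=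
  ∫ ω, Real.exp (-threshold r (acceptedValues r (X ω) k)) ∂P

theorem exp_neg_threshold_le_one (hr : IsRankSequence r) (x : ℕ → ℝ) (k : ℕ) :
    Real.exp (-threshold r (acceptedValues r x k)) ≤ 1 := by
  rw [Real.exp_le_one_iff]
  linarith [threshold_acceptedValues_nonneg (x := x) hr k]

theorem IsExpSequence.measurable_exp_neg_threshold (h : IsExpSequence P X) (hr : IsRankSequence r)
    (k : ℕ) : Measurable fun ω => Real.exp (-threshold r (acceptedValues r (X ω) k)) :=
  Real.measurable_exp.comp (h.measurable_threshold hr k).neg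

theorem IsExpSequence.integrable_exp_neg_threshold (h : IsExpSequence P X) (hr : IsRankSequence r)
    (k : ℕ) : Integrable (fun ω => Real.exp (-threshold r (acceptedValues r (X ω) k))) P :=
  Integrable.of_bound (h.measurable_exp_neg_threshold hr k).aestronglyMeasurable 1
    (ae_of_all _ fun ω => by
      rw [Real.norm_eq_abs, abs_of_pos (Real.exp_pos _)]
      exact exp_neg_threshold_le_one hr _ k)

/-- Candidate k+1 is independent of the past, and the exponential tail at the current threshold is
the integrand. This is the source of both the first claim and the mean of M_n. -/
theorem IsExpSequence.measure_accepted (h : IsExpSequence P X) (hr : IsRankSequence r) (k : ℕ)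
    {T : Set Ω} (hT : MeasurableSet[valuesAlg X (Finset.Icc 1 k)] T) :
    P (T ∩ {ω | threshold r (acceptedValues r (X ω) k) < X ω (k + 1)}) =
      ∫⁻ ω in T, ENNReal.ofReal (Real.exp (-threshold r (acceptedValues r (X ω) k))) ∂P := by
  have hT' : MeasurableSet T := h.valuesAlg_le (fun _ => one_le_of_mem_Icc) _ hT
  have h1 := h.setLIntegral_fresh (fun _ => one_le_of_mem_Icc) (k := k + 1) (by omega) (by simp)
    ((Hiring.measurable_threshold hr).comp (Hiring.measurable_acceptedValues (X := X) hr k)) hT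
    (g := fun z => {z : ℝ × ℝ | z.1 < z.2}.indicator (fun _ => (1 : ℝ≥0∞)) z)
    (measurable_const.indicator (measurableSet_lt measurable_fst measurable_snd))
  have hm : MeasurableSet {ω | threshold r (acceptedValues r (X ω) k) < X ω (k + 1)} :=
    measurableSet_lt (h.measurable_threshold hr k) (h.measurable (k + 1) (by omega))
  calc _ = ∫⁻ ω in T, {ω | threshold r (acceptedValues r (X ω) k) < X ω (k + 1)}.indicator
          (fun _ => (1 : ℝ≥0∞)) ω ∂P := by
        rw [lintegral_indicator hm, Measure.restrict_restrict hm, lintegral_const,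
          Measure.restrict_apply_univ, one_mul, Set.inter_comm]
    _ = _ := h1
    _ = _ := by
        refine lintegral_congr fun ω => ?_
        rw [← expMeasure_Ioi (threshold_acceptedValues_nonneg hr k)]
        have : ∀ x, {z : ℝ × ℝ | z.1 < z.2}.indicator (fun _ => (1 : ℝ≥0∞))
            ((threshold r ∘ fun ω => acceptedValues r (X ω) k) ω, x) =
            (Set.Ioi (threshold r (acceptedValues r (X ω) k))).indicator (fun _ => 1) x := by
          intro x
          simp [Set.indicator_apply]
        simp only [this]
        rw [lintegral_indicator measurableSet_Ioi]
        simp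

theorem IsExpSequence.integrable_card (h : IsExpSequence P X) (hr : IsRankSequence r) (n : ℕ) :
    Integrable (fun ω => ((acceptedValues r (X ω) n).card : ℝ)) P := by
  refine Integrable.of_bound (measurable_from_top.comp
    (measurable_multiset_card.comp (h.measurable_acceptedValues hr n))).aestronglyMeasurable n
    (ae_of_all _ fun ω => ?_)
  rw [Real.norm_eq_abs, abs_of_nonneg (Nat.cast_nonneg _)]
  exact_mod_cast card_acceptedValues_le n

theorem IsExpSequence.integral_card (h : IsExpSequence P X) (hr : IsRankSequence r) (n : ℕ) :
    ∫ ω, ((acceptedValues r (X ω) n).card : ℝ) ∂P =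
      ∑ k ∈ Finset.range n, meanAcceptProb P X r k := by
  induction n with
  | zero => simp [acceptedValues]
  | succ n ih =>
    have hm : MeasurableSet {ω | threshold r (acceptedValues r (X ω) n) < X ω (n + 1)} :=
      measurableSet_lt (h.measurable_threshold hr n) (h.measurable (n + 1) (by omega))
    have e : ∀ ω, ((acceptedValues r (X ω) (n + 1)).card : ℝ) =
        ((acceptedValues r (X ω) n).card : ℝ) +
          {ω | threshold r (acceptedValues r (X ω) n) < X ω (n + 1)}.indicator
            (fun _ => (1 : ℝ)) ω := by
      intro ω
      by_cases hω : threshold r (acceptedValues r (X ω) n) < X ω (n + 1)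
      · rw [acceptedValues_succ_of_lt hω, Multiset.card_cons, Set.indicator_of_mem (by exact hω)]
        push_cast; ring
      · rw [acceptedValues_succ_of_not_lt hω, Set.indicator_of_notMem (by exact hω), add_zero]
    simp only [e]
    rw [integral_add (h.integrable_card hr n) ((integrable_const _).indicator hm), ih,
      Finset.sum_range_succ, integral_indicator hm]
    congr 1
    have h1 := h.measure_accepted hr n (T := Set.univ) MeasurableSet.univ
    rw [Set.univ_inter, Measure.restrict_univ] at h1
    simp only [integral_const, MeasurableSet.univ, measureReal_restrict_apply, Set.univ_inter,
      smul_eq_mul, mul_one]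
    rw [measureReal_def, h1, meanAcceptProb, integral_eq_lintegral_of_nonneg_ae
      (ae_of_all _ fun _ => (Real.exp_pos _).le)
      (h.measurable_exp_neg_threshold hr n).aestronglyMeasurable]

theorem IsExpSequence.antitone_meanAcceptProb (h : IsExpSequence P X) (hr : IsRankSequence r) :
    Antitone (meanAcceptProb P X r) := fun i j hij =>
  integral_mono (h.integrable_exp_neg_threshold hr j) (h.integrable_exp_neg_threshold hr i)
    fun _ => Real.exp_le_exp.2 (neg_le_neg (threshold_acceptedValues_mono hr hij))

theorem meanAcceptProb_nonneg (k : ℕ) : 0 ≤ meanAcceptProb P X r k :=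
  integral_nonneg fun _ => (Real.exp_pos _).le

theorem IsExpSequence.integrable_stallCount (h : IsExpSequence P X) (hr : IsRankSequence r)
    (n : ℕ) : Integrable (fun ω => stallCount r (acceptedValues r (X ω) n).card) P := by
  refine Integrable.of_bound ((measurable_of_countable (stallCount r)).comp
    (measurable_multiset_card.comp (h.measurable_acceptedValues hr n))).aestronglyMeasurable n
    (ae_of_all _ fun _ => ?_)
  rw [Real.norm_eq_abs, abs_of_nonneg (stallCount_nonneg hr _)]
  exact (stallCount_le hr _).trans (by exact_mod_cast card_acceptedValues_le n)

/-- Pointwise, fewer than r(M_n) values exceed Y_n, so the stall count is at most M_n minus that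
number; the number is n e^{-Y_n} up to the grid error. Taking means uses
`IsExpSequence.integral_card`. -/
theorem IsExpSequence.integral_stallCount_le (h : IsExpSequence P X) (hr : IsRankSequence r)
    {n g : ℕ} (hn : 1 ≤ n) (hg : 1 ≤ g) :
    ∫ ω, stallCount r (acceptedValues r (X ω) n).card ∂P ≤
      ∑ k ∈ Finset.range n, (meanAcceptProb P X r k - meanAcceptProb P X r n) +
        (n / g + g * Real.sqrt n) := by
  set err : Ω → ℝ := fun ω => ∑ i ∈ Finset.Icc 1 g,
    |(((Finset.Icc 1 n).filter fun k => Real.log (g / i) < X ω k).card : ℝ) -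
      n * Real.exp (-Real.log (g / i))| with herr
  have herri : Integrable err P :=
    integrable_finsetSum _ fun i _ => h.integrable_card_sub _ _ n
  have hpw : ∀ ω, stallCount r (acceptedValues r (X ω) n).card ≤
      (((acceptedValues r (X ω) n).card : ℝ) -
        n * Real.exp (-threshold r (acceptedValues r (X ω) n))) + (n / g + err ω) := by
    intro ω
    have h1 := card_above_threshold_lt (x := X ω) hr n
    have h2 := mul_exp_neg_sub_card_le (X ω) n hg (threshold_acceptedValues_nonneg (x := X ω) hr n)
    have h3 : (((Finset.Icc 1 n).filter fun k =>
        threshold r (acceptedValues r (X ω) n) < X ω k).card : ℝ) + 1 ≤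
        r (acceptedValues r (X ω) n).card := by exact_mod_cast h1
    unfold stallCount
    simp only [herr]
    linarith
  have hE := (h.integrable_exp_neg_threshold hr n).const_mul (n : ℝ)
  have hA : Integrable (fun ω => ((acceptedValues r (X ω) n).card : ℝ) -
      n * Real.exp (-threshold r (acceptedValues r (X ω) n))) P := (h.integrable_card hr n).sub hE
  have hB : Integrable (fun ω => (n : ℝ) / g + err ω) P := (integrable_const _).add herri
  calc _ ≤ ∫ ω, ((((acceptedValues r (X ω) n).card : ℝ) -
        n * Real.exp (-threshold r (acceptedValues r (X ω) n))) + (n / g + err ω)) ∂P :=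
        integral_mono (h.integrable_stallCount hr n)
          (hA.add hB) hpw
    _ = (∑ k ∈ Finset.range n, meanAcceptProb P X r k - n * meanAcceptProb P X r n) +
          (n / g + ∫ ω, err ω ∂P) := by
        rw [integral_add hA hB,
          integral_sub (h.integrable_card hr n) hE, integral_add (integrable_const _) herri,
          h.integral_card hr n, integral_const_mul]
        simp [meanAcceptProb]
    _ ≤ _ := by
        refine add_le_add ?_ (add_le_add le_rfl ?_)
        · simp
        · simp only [herr]
          rw [integral_finsetSum _ fun i _ => h.integrable_card_sub _ _ n]
          calc _ ≤ ∑ _i ∈ Finset.Icc 1 g, Real.sqrt n := by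
                refine Finset.sum_le_sum fun i hi => h.integral_abs_card_sub_le ?_ hn
                rw [Finset.mem_Icc] at hi
                apply Real.log_nonneg
                rw [le_div_iff₀ (by exact_mod_cast hi.1)]
                rw [one_mul]
                exact_mod_cast hi.2
            _ = g * Real.sqrt n := by simp

theorem IsExpSequence.integral_stallCount_le_rpow (h : IsExpSequence P X) (hr : IsRankSequence r)
    {n : ℕ} (hn : 1 ≤ n) :
    ∫ ω, stallCount r (acceptedValues r (X ω) n).card ∂P ≤
      ∑ k ∈ Finset.range n, (meanAcceptProb P X r k - meanAcceptProb P X r n) +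
        3 * (n : ℝ) ^ (3 / 4 : ℝ) := by
  have hn1 : (1 : ℝ) ≤ n := by exact_mod_cast hn
  have hn0 : (0 : ℝ) < n := by linarith
  -- A grid of about n^{1/4} levels balances the discretisation error n/g against the fluctuation
  -- g√n.
  set g := ⌈(n : ℝ) ^ (1 / 4 : ℝ)⌉₊ with hg
  have hq1 : (1 : ℝ) ≤ (n : ℝ) ^ (1 / 4 : ℝ) := Real.one_le_rpow hn1 (by norm_num)
  have hgle : (n : ℝ) ^ (1 / 4 : ℝ) ≤ g := Nat.le_ceil _
  have hglt : (g : ℝ) < (n : ℝ) ^ (1 / 4 : ℝ) + 1 := Nat.ceil_lt_add_one (by positivity)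
  have hg1 : 1 ≤ g := by
    have : (1 : ℝ) ≤ g := hq1.trans hgle
    exact_mod_cast this
  refine (h.integral_stallCount_le hr hn hg1).trans (add_le_add le_rfl ?_)
  have e1 : (n : ℝ) / (n : ℝ) ^ (1 / 4 : ℝ) = (n : ℝ) ^ (3 / 4 : ℝ) := by
    rw [div_eq_iff (by positivity), ← Real.rpow_add hn0]
    norm_num
  have e2 : (n : ℝ) ^ (1 / 4 : ℝ) * Real.sqrt n = (n : ℝ) ^ (3 / 4 : ℝ) := by
    rw [Real.sqrt_eq_rpow, ← Real.rpow_add hn0]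
    norm_num
  have h1 : (n : ℝ) / g ≤ (n : ℝ) ^ (3 / 4 : ℝ) := by
    rw [← e1]
    exact div_le_div_of_nonneg_left hn0.le (by positivity) hgle
  have h2 : (g : ℝ) * Real.sqrt n ≤ 2 * (n : ℝ) ^ (3 / 4 : ℝ) := by
    rw [← e2]
    have := Real.sqrt_nonneg (n : ℝ)
    nlinarith
  linarith

/-- Divided by (j+1)(j+2), the main terms telescope by `sum_average_sub_le` and the errors are
O(j^{-5/4}). The expected sum of the series is therefore finite, and a nonnegative series with
finite mean converges a.s. -/
theorem IsExpSequence.ae_summable_stallCount (h : IsExpSequence P X) (hr : IsRankSequence r) :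
    ∀ᵐ ω ∂P, Summable fun j : ℕ =>
      stallCount r (acceptedValues r (X ω) (j + 1)).card / (((j : ℝ) + 1) * (j + 2)) := by
  set f : ℕ → Ω → ℝ := fun j ω =>
    stallCount r (acceptedValues r (X ω) (j + 1)).card / (((j : ℝ) + 1) * (j + 2)) with hf
  have hf0 : ∀ j ω, 0 ≤ f j ω := fun j ω => by
    have := stallCount_nonneg hr (acceptedValues r (X ω) (j + 1)).card
    simp only [hf]
    positivity
  have hfi : ∀ j, Integrable (f j) P := fun j => (h.integrable_stallCount hr (j + 1)).div_const _
  set v : ℕ → ℝ := fun j => 3 * ((j : ℝ) + 1) ^ (3 / 4 : ℝ) / (((j : ℝ) + 1) * (j + 2)) with hv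
  have hv0 : ∀ j, 0 ≤ v j := fun j => by simp only [hv]; positivity
  have hvs : Summable v := by
    have h1 : Summable fun j : ℕ => 3 * (1 / ((j + 1 : ℕ) : ℝ) ^ (5 / 4 : ℝ)) :=
      ((summable_nat_add_iff (f := fun j : ℕ => 1 / (j : ℝ) ^ (5 / 4 : ℝ)) 1).2
        (Real.summable_one_div_nat_rpow.2 (by norm_num))).mul_left 3
    refine Summable.of_nonneg_of_le hv0 (fun j => ?_) h1
    have hj : (0 : ℝ) < (j : ℝ) + 1 := by positivity
    simp only [hv]
    push_cast
    rw [mul_one_div, div_le_div_iff₀ (by positivity) (by positivity), mul_assoc,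
      ← Real.rpow_add hj]
    have : ((j : ℝ) + 1) ^ ((3 / 4 : ℝ) + 5 / 4) = ((j : ℝ) + 1) ^ 2 := by
      rw [← Real.rpow_natCast]; norm_num
    rw [this]
    nlinarith
  have hpart : ∀ K : ℕ, ∑ j ∈ Finset.range K, ∫ ω, f j ω ∂P ≤
      meanAcceptProb P X r 0 + ∑' j, v j := by
    intro K
    have h1 : ∀ j ∈ Finset.range K, ∫ ω, f j ω ∂P ≤
        (∑ k ∈ Finset.range (j + 1), (meanAcceptProb P X r k - meanAcceptProb P X r (j + 1))) /
          (((j : ℝ) + 1) * (j + 2)) + v j := by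
      intro j _
      have h2 := h.integral_stallCount_le_rpow hr (n := j + 1) (by omega)
      simp only [hf, hv]
      rw [integral_div, ← add_div]
      refine div_le_div_of_nonneg_right ?_ (by positivity)
      push_cast at h2
      exact h2
    refine (Finset.sum_le_sum h1).trans ?_
    rw [Finset.sum_add_distrib]
    exact add_le_add (sum_average_sub_le (h.antitone_meanAcceptProb hr)
      (fun k => meanAcceptProb_nonneg k) K) (hvs.sum_le_tsum _ fun j _ => hv0 j)
  have hsum : Summable fun j => ∫ ω, f j ω ∂P :=
    summable_of_sum_range_le (fun j => integral_nonneg (hf0 j)) hpart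
  have hfin : ∫⁻ ω, ∑' j, ENNReal.ofReal (f j ω) ∂P ≠ ∞ := by
    rw [lintegral_tsum fun j => (hfi j).aemeasurable.ennreal_ofReal]
    have e : ∀ j, ∫⁻ ω, ENNReal.ofReal (f j ω) ∂P = ENNReal.ofReal (∫ ω, f j ω ∂P) := fun j =>
      (ofReal_integral_eq_lintegral_ofReal (hfi j) (ae_of_all _ (hf0 j))).symm
    simp only [e]
    exact hsum.tsum_ofReal_ne_top
  have hae := ae_lt_top' (AEMeasurable.tsum fun j => (hfi j).aemeasurable.ennreal_ofReal)
    hfin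
  filter_upwards [hae] with ω hω
  have h1 := ENNReal.summable_toReal hω.ne
  refine h1.congr fun j => ?_
  rw [ENNReal.toReal_ofReal (hf0 j ω)]

/-- The thresholds tend to infinity almost surely. -/
theorem IsExpSequence.ae_tendsto_threshold (h : IsExpSequence P X) (hr : IsRankSequence r)
    (hdiv : Tendsto (fun m : ℕ => ∑ k ∈ Finset.Icc 1 m, delta r k / (r k : ℝ)) atTop atTop) :
    ∀ᵐ ω ∂P, Tendsto (fun n => threshold r (acceptedValues r (X ω) n)) atTop atTop := by
  have h1 : ∀ᵐ ω ∂P, ∀ c : ℕ, Tendsto (fun n : ℕ =>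
      (((Finset.Icc 1 n).filter fun k => (c : ℝ) < X ω k).card : ℝ) / n) atTop
        (𝓝 (Real.exp (-c))) := ae_all_iff.2 fun c => h.ae_tendsto_card_div c
  filter_upwards [h1, h.ae_summable_stallCount hr] with ω h2 h3
  exact tendsto_threshold_of_summable hr hdiv h2 h3

/-- The numbers of acceptances tend to infinity almost surely. -/
theorem tendsto_card_of_tendsto_threshold {x : ℕ → ℝ}
    (hx : Tendsto (fun n => threshold r (acceptedValues r x n)) atTop atTop) :
    Tendsto (fun n => (acceptedValues r x n).card) atTop atTop := by
  rcases tendsto_atTop_of_monotone (card_acceptedValues_mono (r := r) (x := x)) with h | ⟨l, hl⟩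
  · exact h
  · exfalso
    rw [nhds_discrete, tendsto_pure] at hl
    obtain ⟨n₀, hn₀⟩ := eventually_atTop.1 hl
    have hconst : ∀ n ≥ n₀, acceptedValues r x n = acceptedValues r x n₀ := by
      intro n hn
      induction n, hn using Nat.le_induction with
      | base => rfl
      | succ n hn ih =>
        rw [← ih]
        by_cases h : threshold r (acceptedValues r x n) < x (n + 1)
        · have h1 := hn₀ n hn
          have h2 := hn₀ (n + 1) (by omega)
          rw [acceptedValues_succ_of_lt h, Multiset.card_cons] at h2
          omega
        · exact acceptedValues_succ_of_not_lt h
    obtain ⟨n, h1, h2⟩ := ((hx.eventually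
      (eventually_gt_atTop (threshold r (acceptedValues r x n₀)))).and
        (eventually_ge_atTop n₀)).exists
    rw [hconst n h2] at h1
    exact lt_irrefl _ h1

end

/-! ### The starting time of the window -/

/-- The first time `t` at which the expected number of candidates among `t + 1, …, N` exceeding the
current threshold is at most `B`. -/
def windowStart (r : ℕ → ℕ) (B : ℝ) (N : ℕ) (x : ℕ → ℝ) : ℕ :=
  sInf {t : ℕ | ((N : ℝ) - t) * Real.exp (-threshold r (acceptedValues r x t)) ≤ B}

/-- After the time `t` the threshold hardly moves, and acceptance is decided by the threshold in
force at time `t`. -/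
structure WindowGood (r : ℕ → ℕ) (B ε : ℝ) (N : ℕ) (x : ℕ → ℝ) (t : ℕ) : Prop where
  le : t ≤ N
  threshold_le : threshold r (acceptedValues r x N) ≤ threshold r (acceptedValues r x t) + ε
  values_eq : acceptedValues r x N =
    overValues (threshold r (acceptedValues r x t)) x t N + acceptedValues r x t
  accepted_iff : ∀ k ∈ Finset.Ioc t N,
    (Accepted r x k ↔ k ∈ overSet (threshold r (acceptedValues r x t)) x t N)
  one_le : 1 ≤ threshold r (acceptedValues r x t)
  le_mul : B / 2 ≤ ((N : ℝ) - t) * Real.exp (-threshold r (acceptedValues r x t))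

section

variable {r : ℕ → ℕ} {B ε : ℝ} {N : ℕ} {x : ℕ → ℝ}

theorem windowStart_mem (hB : 0 ≤ B) :
    ((N : ℝ) - windowStart r B N x) *
      Real.exp (-threshold r (acceptedValues r x (windowStart r B N x))) ≤ B := by
  have : (windowStart r B N x) ∈
      {t : ℕ | ((N : ℝ) - t) * Real.exp (-threshold r (acceptedValues r x t)) ≤ B} :=
    Nat.sInf_mem ⟨N, by simpa using hB⟩
  exact this

theorem windowStart_le (hB : 0 ≤ B) : windowStart r B N x ≤ N :=
  Nat.sInf_le (by simpa using hB)

theorem lt_of_lt_windowStart {t : ℕ} (ht : t < windowStart r B N x) :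
    B < ((N : ℝ) - t) * Real.exp (-threshold r (acceptedValues r x t)) :=
  not_le.1 (Nat.notMem_of_lt_sInf ht)

theorem one_le_windowStart (hB : 0 ≤ B) (hN : B < N) : 1 ≤ windowStart r B N x := by
  by_contra! h
  have h0 : windowStart r B N x = 0 := by omega
  have := windowStart_mem (r := r) (N := N) (x := x) hB
  rw [h0] at this
  simp only [CharP.cast_eq_zero, sub_zero, acceptedValues] at this
  have e : threshold r 0 = 0 := by simp [threshold]
  rw [e, neg_zero, Real.exp_zero, mul_one] at this
  linarith

theorem windowStart_eq_iff (hB : 0 ≤ B) {t : ℕ} :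
    windowStart r B N x = t ↔
      ((N : ℝ) - t) * Real.exp (-threshold r (acceptedValues r x t)) ≤ B ∧
        ∀ s ∈ Finset.range t,
          B < ((N : ℝ) - s) * Real.exp (-threshold r (acceptedValues r x s)) := by
  constructor
  · rintro rfl
    exact ⟨windowStart_mem hB, fun s hs => lt_of_lt_windowStart (Finset.mem_range.1 hs)⟩
  · rintro ⟨h1, h2⟩
    refine le_antisymm (Nat.sInf_le h1) ?_
    by_contra! h
    have h3 := h2 _ (Finset.mem_range.2 h)
    exact absurd (windowStart_mem (r := r) (N := N) (x := x) hB) (not_le.2 h3)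

/-- For a fixed time T the quantity (N - T) e^{-Y_T} grows without bound in N, and the corresponding
quantities at earlier times are at least as large. -/
theorem tendsto_windowStart (hr : IsRankSequence r) (hB : 0 ≤ B) (x : ℕ → ℝ) :
    Tendsto (fun N => windowStart r B N x) atTop atTop := by
  refine tendsto_atTop.2 fun T => ?_
  have h1 : Tendsto (fun N : ℕ => ((N : ℝ) + (-T)) *
      Real.exp (-threshold r (acceptedValues r x T))) atTop atTop :=
    (tendsto_atTop_add_const_right _ _ tendsto_natCast_atTop_atTop).atTop_mul_const
      (Real.exp_pos _)
  filter_upwards [h1.eventually (eventually_gt_atTop B), eventually_ge_atTop T] with N h2 h3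
  by_contra! h
  have h4 := windowStart_mem (r := r) (N := N) (x := x) hB
  set t := windowStart r B N x
  have h5 : (t : ℝ) ≤ T := by exact_mod_cast h.le
  have h6 : (T : ℝ) ≤ N := by exact_mod_cast h3
  have h7 : Real.exp (-threshold r (acceptedValues r x T)) ≤
      Real.exp (-threshold r (acceptedValues r x t)) :=
    Real.exp_le_exp.2 (neg_le_neg (threshold_acceptedValues_mono hr h.le))
  have h8 : ((N : ℝ) + (-T)) * Real.exp (-threshold r (acceptedValues r x T)) ≤
      ((N : ℝ) - t) * Real.exp (-threshold r (acceptedValues r x t)) := by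
    refine mul_le_mul (by linarith) h7 (Real.exp_pos _).le (by linarith)
  linarith

/-- Every candidate accepted after `t` exceeds the threshold of time `t`, by monotonicity. -/
theorem card_acceptedValues_le_add (hr : IsRankSequence r) (x : ℕ → ℝ) {t k : ℕ} (htk : t ≤ k) :
    (acceptedValues r x k).card ≤ (acceptedValues r x t).card +
      (overSet (threshold r (acceptedValues r x t)) x t k).card := by
  induction k, htk using Nat.le_induction with
  | base => simp
  | succ k hk ih =>
    rw [overSet_succ _ _ hk]
    by_cases h : threshold r (acceptedValues r x k) < x (k + 1)
    · rw [if_pos (lt_of_le_of_lt (threshold_acceptedValues_mono hr hk) h),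
        acceptedValues_succ_of_lt h, Multiset.card_cons, Finset.card_insert_of_notMem]
      · omega
      · intro h2
        have := overSet_subset _ _ _ _ h2
        simp at this
    · rw [acceptedValues_succ_of_not_lt h]
      refine ih.trans (Nat.add_le_add_left ?_ _)
      split_ifs
      · exact Finset.card_le_card (Finset.subset_insert _ _)
      · exact le_rfl

/-- Boundedly many exceedances allow boundedly many acceptances, hence a threshold that passes
boundedly many values; without the gap event such a rise is at most ε. Since no later value lies
within ε of Y_t, exceeding the moving threshold is the same as exceeding Y_t. -/
theorem windowGood_of (hr : IsRankSequence r) (hB : 2 ≤ B) (hε0 : 0 < ε) (hε1 : ε ≤ 1 / 4)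
    {C R t : ℕ} (hC : 1 ≤ C) (ht : windowStart r B N x = t) (hN : B < N)
    (h1 : ∀ k ∈ Finset.Ioc t N, ¬(threshold r (acceptedValues r x t) - ε < x k ∧
      x k ≤ threshold r (acceptedValues r x t) + ε))
    (h2 : (overSet (threshold r (acceptedValues r x t)) x t N).card ≤ C)
    (h3 : R ≤ r (acceptedValues r x t).card) (h4 : 1 ≤ threshold r (acceptedValues r x t))
    (h5 : ¬ gapEvent ε (2 * C) R N x) : WindowGood r B ε N x t := by
  have hB0 : 0 ≤ B := by linarith
  set y := threshold r (acceptedValues r x t) with hy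
  have htN : t ≤ N := ht ▸ windowStart_le hB0
  have ht1 : 1 ≤ t := ht ▸ one_le_windowStart hB0 hN
  have hyN : y ≤ threshold r (acceptedValues r x N) := threshold_acceptedValues_mono hr htN
  -- If the rise exceeded ε, the sample value equal to Y_N would have at most 2C values in the
  -- interval of length ε below it: at most C old ones, passed by the threshold, and at most C later
  -- ones, which exceed Y_t.
  have h_upper : threshold r (acceptedValues r x N) ≤ y + ε := by
    by_contra! hlt
    set z := threshold r (acceptedValues r x N) with hz
    have hz0 : 0 < z := by linarith
    obtain ⟨i, hi, hxi⟩ := exists_eq_of_mem_acceptedValues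
      (threshold_mem hr (rank_le_card_of_threshold_pos hz0))
    refine h5 ⟨i, hi, by rw [hxi]; linarith, ?_, ?_⟩
    · rw [hxi]
      exact h3.trans ((hr.monotone (card_acceptedValues_mono htN)).trans
        (rank_le_card_ge_threshold hr hz0))
    · rw [hxi, ← hz]
      have hsub : ((Finset.Icc 1 N).filter fun k => z - ε < x k ∧ x k < z) ⊆
          ((Finset.Icc 1 t).filter fun k => y < x k ∧ x k < z) ∪ overSet y x t N := by
        intro k hk
        simp only [Finset.mem_union, Finset.mem_filter, Finset.mem_Icc, overSet,
          Finset.mem_Ioc] at hk ⊢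
        rcases le_or_gt k t with hkt | hkt
        · exact Or.inl ⟨⟨hk.1.1, hkt⟩, by linarith [hk.2.1], hk.2.2⟩
        · exact Or.inr ⟨⟨hkt, hk.1.2⟩, by linarith [hk.2.1]⟩
      have h6 := card_between_thresholds_le (x := x) hr htN
      have h7 := card_acceptedValues_le_add hr x htN
      rw [← hy, ← hz] at h6
      rw [← hy] at h7
      have h8 := (Finset.card_le_card hsub).trans (Finset.card_union_le _ _)
      omega
  -- The same argument for the single step from t-1 to t: at most one old value is passed, candidate
  -- t may contribute another, and `h1` excludes later ones, so C ≥ 1 suffices.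
  have h_lower : y ≤ threshold r (acceptedValues r x (t - 1)) + ε := by
    by_contra! hlt
    have hy0 : 0 < y := by linarith
    obtain ⟨i, hi, hxi⟩ := exists_eq_of_mem_acceptedValues
      (threshold_mem hr (rank_le_card_of_threshold_pos hy0))
    refine h5 ⟨i, Finset.Icc_subset_Icc le_rfl htN hi, by rw [hxi]; linarith, ?_, ?_⟩
    · rw [hxi]
      refine h3.trans ((rank_le_card_ge_threshold hr hy0).trans (Finset.card_le_card ?_))
      exact Finset.filter_subset_filter _ (Finset.Icc_subset_Icc le_rfl htN)
    · rw [hxi, ← hy]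
      have hsub : ((Finset.Icc 1 N).filter fun k => y - ε < x k ∧ x k < y) ⊆
          insert t ((Finset.Icc 1 (t - 1)).filter fun k =>
            threshold r (acceptedValues r x (t - 1)) < x k ∧ x k < y) := by
        intro k hk
        simp only [Finset.mem_insert, Finset.mem_filter, Finset.mem_Icc] at hk ⊢
        rcases lt_trichotomy k t with hkt | hkt | hkt
        · exact Or.inr ⟨⟨hk.1.1, by omega⟩, by linarith [hk.2.1], hk.2.2⟩
        · exact Or.inl hkt
        · exact absurd ⟨hk.2.1, by linarith [hk.2.2]⟩ (h1 k (Finset.mem_Ioc.2 ⟨hkt, hk.1.2⟩))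
      have h6 := card_between_thresholds_le (x := x) hr (Nat.sub_le t 1)
      have h7 := card_acceptedValues_succ_le (r := r) (x := x) (t - 1)
      rw [Nat.sub_add_cancel ht1] at h7
      rw [← hy] at h6
      have h8 := (Finset.card_le_card hsub).trans (Finset.card_insert_le _ _)
      omega
  have hiff : ∀ k, t ≤ k → k < N → (threshold r (acceptedValues r x k) < x (k + 1) ↔
      y < x (k + 1)) := by
    intro k hk hkN
    have hm1 : y ≤ threshold r (acceptedValues r x k) := threshold_acceptedValues_mono hr hk
    have hm2 : threshold r (acceptedValues r x k) ≤ threshold r (acceptedValues r x N) :=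
      threshold_acceptedValues_mono hr hkN.le
    constructor
    · intro h; linarith
    · intro h
      have := h1 (k + 1) (Finset.mem_Ioc.2 ⟨by omega, by omega⟩)
      by_contra! h6
      exact this ⟨by linarith, by linarith⟩
  refine ⟨htN, h_upper, ?_, ?_, h4, ?_⟩
  · have : ∀ k, t ≤ k → k ≤ N → acceptedValues r x k = overValues y x t k + acceptedValues r x t := by
      intro k hk
      induction k, hk using Nat.le_induction with
      | base => intro _; rw [overValues_self, zero_add]
      | succ k hk ih =>
        intro hkN
        rw [overValues_succ _ _ hk]
        by_cases h : threshold r (acceptedValues r x k) < x (k + 1)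
        · rw [if_pos ((hiff k hk (by omega)).1 h), acceptedValues_succ_of_lt h, ih (by omega),
            Multiset.cons_add]
        · rw [if_neg (fun h' => h ((hiff k hk (by omega)).2 h')), acceptedValues_succ_of_not_lt h,
            ih (by omega)]
    exact this N htN le_rfl
  · intro k hk
    have hk' := Finset.mem_Ioc.1 hk
    have h6 := hiff (k - 1) (by omega) (by omega)
    have h7 := accepted_succ_iff (r := r) (x := x) (n := k - 1)
    rw [Nat.sub_add_cancel (by omega)] at h6 h7
    rw [h7, h6]
    simp [overSet, hk'.1, hk'.2, ← hy]
  -- Minimality of t gives the opposite inequality at t-1. Passing to t costs a factor 1 - ε ≥ 3/4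
  -- and a summand e^{-Y_t} ≤ 1/2, and 3B/4 - 1/2 ≥ B/2 because B ≥ 2.
  · have h6 : B < ((N : ℝ) - (t - 1 : ℕ)) *
        Real.exp (-threshold r (acceptedValues r x (t - 1))) :=
      lt_of_lt_windowStart (by omega)
    rw [Nat.cast_sub ht1] at h6
    push_cast at h6
    set y' := threshold r (acceptedValues r x (t - 1))
    have h7 : Real.exp (-y') * (1 - ε) ≤ Real.exp (-y) := by
      have h8 : 1 - ε ≤ Real.exp (-ε) := by
        have := Real.add_one_le_exp (-ε); linarith
      calc Real.exp (-y') * (1 - ε) ≤ Real.exp (-y') * Real.exp (-ε) := by gcongr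
        _ = Real.exp (-(y' + ε)) := by rw [← Real.exp_add]; congr 1; ring
        _ ≤ Real.exp (-y) := Real.exp_le_exp.2 (by linarith)
    have h9 : Real.exp (-y) ≤ 1 / 2 := by
      have : Real.exp (-y) ≤ Real.exp (-1) := Real.exp_le_exp.2 (by linarith)
      have h10 := Real.exp_neg_one_lt_half
      linarith
    have hNt : (0 : ℝ) ≤ (N : ℝ) - t := by
      have : (t : ℝ) ≤ N := by exact_mod_cast htN
      linarith
    have h10 : B * (1 - ε) ≤ ((N : ℝ) - t + 1) * Real.exp (-y) := by
      calc B * (1 - ε) ≤ ((N : ℝ) - (t - 1)) * Real.exp (-y') * (1 - ε) := by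
            refine mul_le_mul_of_nonneg_right h6.le (by linarith)
        _ = ((N : ℝ) - t + 1) * (Real.exp (-y') * (1 - ε)) := by ring
        _ ≤ _ := mul_le_mul_of_nonneg_left h7 (by linarith)
    nlinarith

end

/-! ### Measurability and mean counts at the starting time. -/

section

variable {Ω : Type*} [mΩ : MeasurableSpace Ω] {P : Measure Ω} [IsProbabilityMeasure P]
  {X : Ω → ℕ → ℝ} {r : ℕ → ℕ}

theorem measurableSet_windowStart_eq_of {α : Type*} [MeasurableSpace α] {x : α → ℕ → ℝ}
    (hr : IsRankSequence r) {B : ℝ} (hB : 0 ≤ B) (N t : ℕ)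
    (hx : ∀ k ∈ Finset.Icc 1 t, Measurable fun a => x a k) :
    MeasurableSet {a | windowStart r B N (x a) = t} := by
  have hY : ∀ s ≤ t, Measurable fun a => ((N : ℝ) - s) *
      Real.exp (-threshold r (acceptedValues r (x a) s)) := fun s hs =>
    (Real.measurable_exp.comp ((measurable_threshold hr).comp (measurable_acceptedValues_of hr s
      fun k hk => hx k (Finset.Icc_subset_Icc le_rfl hs hk))).neg).const_mul _
  simp only [windowStart_eq_iff hB]
  have h2 : MeasurableSet {a | ∀ s ∈ Finset.range t,
      B < ((N : ℝ) - s) * Real.exp (-threshold r (acceptedValues r (x a) s))} := by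
    have e : {a | ∀ s ∈ Finset.range t,
        B < ((N : ℝ) - s) * Real.exp (-threshold r (acceptedValues r (x a) s))} =
        ⋂ s ∈ Finset.range t,
          {a | B < ((N : ℝ) - s) * Real.exp (-threshold r (acceptedValues r (x a) s))} := by
      ext a; simp
    rw [e]
    exact Finset.measurableSet_biInter _ fun s hs =>
      measurableSet_lt measurable_const (hY s (Finset.mem_range.1 hs).le)
  exact (measurableSet_le (hY t le_rfl) measurable_const).inter h2

/-- The starting time is a stopping time; this allows conditioning on the past on each event that it
equals a given t. -/
theorem measurableSet_windowStart_eq (hr : IsRankSequence r) {B : ℝ} (hB : 0 ≤ B) (N t : ℕ) :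
    MeasurableSet[valuesAlg X (Finset.Icc 1 t)] {ω | windowStart r B N (X ω) = t} :=
  @measurableSet_windowStart_eq_of r Ω (valuesAlg X (Finset.Icc 1 t)) X hr B hB N t
    fun _ hk => measurable_valuesAlg hk

theorem IsExpSequence.measurableSet_windowStart_eq (h : IsExpSequence P X) (hr : IsRankSequence r)
    {B : ℝ} (hB : 0 ≤ B) (N t : ℕ) : MeasurableSet {ω | windowStart r B N (X ω) = t} :=
  measurableSet_windowStart_eq_of hr hB N t fun k hk => h.measurable k (one_le_of_mem_Icc hk)

theorem IsExpSequence.measurable_windowStart (h : IsExpSequence P X) (hr : IsRankSequence r)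
    {B : ℝ} (hB : 0 ≤ B) (N : ℕ) : Measurable fun ω => windowStart r B N (X ω) :=
  measurable_to_countable' fun t => h.measurableSet_windowStart_eq hr hB N t

theorem IsExpSequence.lintegral_eq_tsum_windowStart (h : IsExpSequence P X) (hr : IsRankSequence r)
    {B : ℝ} (hB : 0 ≤ B) (N : ℕ) (f : Ω → ℝ≥0∞) :
    ∫⁻ ω, f ω ∂P = ∑' t, ∫⁻ ω in {ω | windowStart r B N (X ω) = t}, f ω ∂P := by
  rw [← lintegral_iUnion (h.measurableSet_windowStart_eq hr hB N), ← setLIntegral_univ]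
  · congr 2
    ext ω
    simp
  · intro i j hij
    rw [Function.onFun, Set.disjoint_left]
    intro ω h1 h2
    exact hij (h1.symm.trans h2)

theorem IsExpSequence.measurable_windowStart_values (h : IsExpSequence P X)
    (hr : IsRankSequence r) {B : ℝ} (hB : 0 ≤ B) (N : ℕ) :
    Measurable fun ω => acceptedValues r (X ω) (windowStart r B N (X ω)) := by
  have h1 : Measurable fun z : ℕ × Ω => acceptedValues r (X z.2) z.1 :=
    measurable_from_prod_countable_right fun n => h.measurable_acceptedValues hr n
  exact h1.comp ((h.measurable_windowStart hr hB N).prodMk measurable_id)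

theorem IsExpSequence.measurable_windowStart_filter (h : IsExpSequence P X)
    (hr : IsRankSequence r) {B : ℝ} (hB : 0 ≤ B) (N : ℕ) {D : ℝ → ℝ → Prop}
    [∀ y z, Decidable (D y z)] (hD : MeasurableSet {z : ℝ × ℝ | D z.1 z.2}) :
    Measurable fun ω => (Finset.Ioc (windowStart r B N (X ω)) N).filter fun k =>
      D (threshold r (acceptedValues r (X ω) (windowStart r B N (X ω)))) (X ω k) := by
  rw [measurable_finset_iff]
  intro k
  by_cases hk : 1 ≤ k
  · simp only [Finset.mem_filter, Finset.mem_Ioc]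
    refine measurableSet_setOfPred.1 (MeasurableSet.inter (MeasurableSet.inter ?_ ?_) ?_)
    · exact measurableSet_lt (h.measurable_windowStart hr hB N) measurable_const
    · exact MeasurableSet.const _
    · exact ((Hiring.measurable_threshold hr).comp
        (h.measurable_windowStart_values hr hB N)).prodMk (h.measurable k hk) hD
  · have : ∀ ω, k ∉ (Finset.Ioc (windowStart r B N (X ω)) N).filter fun k =>
        D (threshold r (acceptedValues r (X ω) (windowStart r B N (X ω)))) (X ω k) := by
      intro ω hkm
      have := Finset.mem_Ioc.1 (Finset.mem_filter.1 hkm).1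
      omega
    simp only [this]
    exact measurable_const

/-- The expected number of candidates in the window whose values stand in a given relation to the
threshold at its start. -/
theorem IsExpSequence.lintegral_windowStart_card_le (h : IsExpSequence P X)
    (hr : IsRankSequence r) {B : ℝ} (hB : 0 ≤ B) (N : ℕ) {D : ℝ → ℝ → Prop}
    [∀ y z, Decidable (D y z)] (hD : MeasurableSet {z : ℝ × ℝ | D z.1 z.2}) {θ : ℝ} (hθ : 0 ≤ θ)
    (hDθ : ∀ y, 0 ≤ y → expMeasure 1 {z | D y z} ≤ ENNReal.ofReal (θ * Real.exp (-y))) :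
    ∫⁻ ω, (((Finset.Ioc (windowStart r B N (X ω)) N).filter fun k =>
      D (threshold r (acceptedValues r (X ω) (windowStart r B N (X ω)))) (X ω k)).card : ℝ≥0∞) ∂P ≤
      ENNReal.ofReal (θ * B) := by
  rw [h.lintegral_eq_tsum_windowStart hr hB N]
  have key : ∀ t, ∫⁻ ω in {ω | windowStart r B N (X ω) = t},
      (((Finset.Ioc (windowStart r B N (X ω)) N).filter fun k =>
        D (threshold r (acceptedValues r (X ω) (windowStart r B N (X ω)))) (X ω k)).card : ℝ≥0∞) ∂P ≤
      ENNReal.ofReal (θ * B) * P {ω | windowStart r B N (X ω) = t} := by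
    intro t
    have hTm := h.measurableSet_windowStart_eq hr hB N t
    set g : ℝ × ℝ → ℝ≥0∞ := {z : ℝ × ℝ | D z.1 z.2}.indicator fun _ => 1 with hg
    have hgm : Measurable g := measurable_const.indicator hD
    have hY : Measurable fun ω => threshold r (acceptedValues r (X ω) t) :=
      h.measurable_threshold hr t
    have e1 : ∀ ω ∈ {ω | windowStart r B N (X ω) = t},
        (((Finset.Ioc (windowStart r B N (X ω)) N).filter fun k =>
          D (threshold r (acceptedValues r (X ω) (windowStart r B N (X ω)))) (X ω k)).card : ℝ≥0∞) =
        ∑ k ∈ Finset.Ioc t N, g (threshold r (acceptedValues r (X ω) t), X ω k) := by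
      intro ω hω
      have hω' : windowStart r B N (X ω) = t := hω
      rw [hω', Finset.card_filter]
      push_cast
      refine Finset.sum_congr rfl fun k _ => ?_
      simp only [hg, Set.indicator_apply, Set.mem_ofPred_eq]
    rw [setLIntegral_congr_fun hTm e1, lintegral_finsetSum'
      (f := fun k ω => g (threshold r (acceptedValues r (X ω) t), X ω k)) _ fun k hk =>
      (hgm.comp (hY.prodMk (h.measurable k (by have := Finset.mem_Ioc.1 hk; omega)))).aemeasurable]
    -- On the event that the starting time is t, later candidates are fresh; each contributes at
    -- most θ e^{-Y_t}, and (N - t) e^{-Y_t} ≤ B by definition of the starting time.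
    have e2 : ∀ k ∈ Finset.Ioc t N, ∫⁻ ω in {ω | windowStart r B N (X ω) = t},
        g (threshold r (acceptedValues r (X ω) t), X ω k) ∂P ≤
        ∫⁻ ω in {ω | windowStart r B N (X ω) = t},
          ENNReal.ofReal (θ * Real.exp (-threshold r (acceptedValues r (X ω) t))) ∂P := by
      intro k hk
      have hk' := Finset.mem_Ioc.1 hk
      rw [h.setLIntegral_fresh (W := fun ω => threshold r (acceptedValues r (X ω) t)) (k := k)
        (fun _ => one_le_of_mem_Icc) (by omega)
        (by rw [Finset.mem_Icc]; omega)
        ((Hiring.measurable_threshold hr).comp (Hiring.measurable_acceptedValues (X := X) hr t))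
        (Hiring.measurableSet_windowStart_eq hr hB N t) hgm]
      refine lintegral_mono fun ω => ?_
      have h0 := threshold_acceptedValues_nonneg (x := X ω) hr t
      refine le_trans (le_of_eq ?_) (hDθ _ h0)
      have hDy : MeasurableSet {z | D (threshold r (acceptedValues r (X ω) t)) z} :=
        measurable_prodMk_left hD
      rw [← lintegral_indicator_one hDy]
      rfl
    refine (Finset.sum_le_sum e2).trans ?_
    rw [Finset.sum_const, Nat.card_Ioc, nsmul_eq_mul, ← lintegral_const_mul' _ _ (by simp)]
    calc _ ≤ ∫⁻ _ω in {ω | windowStart r B N (X ω) = t}, ENNReal.ofReal (θ * B) ∂P := by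
          refine setLIntegral_mono measurable_const fun ω hω => ?_
          have hω' : windowStart r B N (X ω) = t := hω
          rw [← ENNReal.ofReal_natCast, ← ENNReal.ofReal_mul (Nat.cast_nonneg _)]
          apply ENNReal.ofReal_le_ofReal
          have h1 := windowStart_mem (r := r) (N := N) (x := X ω) hB
          have h2 := windowStart_le (r := r) (N := N) (x := X ω) hB
          rw [hω'] at h1 h2
          rw [Nat.cast_sub h2]
          nlinarith
      _ = _ := by rw [setLIntegral_const]
  refine (ENNReal.tsum_le_tsum key).trans ?_
  rw [ENNReal.tsum_mul_left]
  have h1 := h.lintegral_eq_tsum_windowStart hr hB N fun _ => (1 : ℝ≥0∞)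
  simp only [lintegral_const, measure_univ, mul_one, Measure.restrict_apply_univ, one_mul] at h1
  rw [← h1, mul_one]

end

/-! ### The window is good with high probability -/

section

variable {Ω : Type*} [mΩ : MeasurableSpace Ω] {P : Measure Ω} [IsProbabilityMeasure P]
  {X : Ω → ℕ → ℝ} {r : ℕ → ℕ}

theorem expMeasure_Ioc_le {y ε : ℝ} (hy : 0 ≤ y) (hε : 0 ≤ ε) :
    expMeasure 1 (Set.Ioc (y - ε) (y + ε)) ≤
      ENNReal.ofReal (2 * (Real.exp ε - 1) * Real.exp (-y)) := by
  -- The lower endpoint y - ε may be negative, where only this one-sided bound on the distribution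
  -- function holds.
  have h1 : ∀ z : ℝ, 1 - Real.exp (-z) ≤ (expMeasure 1).real (Set.Iic z) := by
    intro z
    rcases le_or_gt 0 z with hz | hz
    · rw [expMeasure_real_Iic hz]
    · have : 1 ≤ Real.exp (-z) := Real.one_le_exp (by linarith)
      have := measureReal_nonneg (μ := expMeasure 1) (s := Set.Iic z)
      linarith
  have h2 : (expMeasure 1).real (Set.Ioc (y - ε) (y + ε)) ≤
      Real.exp (-(y - ε)) - Real.exp (-(y + ε)) := by
    rw [← Set.Iic_sdiff_Iic, measureReal_sdiff (Set.Iic_subset_Iic.2 (by linarith))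
      measurableSet_Iic, expMeasure_real_Iic (by linarith)]
    have := h1 (y - ε)
    linarith
  rw [← ENNReal.ofReal_toReal (measure_ne_top (expMeasure 1) _)]
  apply ENNReal.ofReal_le_ofReal
  refine h2.trans ?_
  have e1 : Real.exp (-(y - ε)) = Real.exp ε * Real.exp (-y) := by
    rw [← Real.exp_add]; congr 1; ring
  have e2 : Real.exp (-(y + ε)) = Real.exp (-ε) * Real.exp (-y) := by
    rw [← Real.exp_add]; congr 1; ring
  rw [e1, e2, ← sub_mul]
  refine mul_le_mul_of_nonneg_right ?_ (Real.exp_pos _).le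
  have h3 := Real.add_one_le_exp ε
  have h4 : Real.exp ε * Real.exp (-ε) = 1 := by rw [← Real.exp_add]; simp
  nlinarith [Real.exp_pos (-ε), Real.exp_pos ε, sq_nonneg (Real.exp ε - 1)]

/-- An integer-valued variable with small mean vanishes with high probability. -/
theorem measure_le_of_lintegral_natCast_le {f : Ω → ℕ} (hf : Measurable f) {b : ℝ}
    {c : ℕ} (hc : 0 < c) (hfb : ∫⁻ ω, (f ω : ℝ≥0∞) ∂P ≤ ENNReal.ofReal b) :
    P {ω | c ≤ f ω} ≤ ENNReal.ofReal (b / c) := by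
  have hf' : Measurable fun ω => (f ω : ℝ≥0∞) := (measurable_of_countable _).comp hf
  have h1 := mul_meas_ge_le_lintegral (μ := P) hf' (c : ℝ≥0∞)
  have hc' : (0 : ℝ) < c := by exact_mod_cast hc
  rw [ENNReal.ofReal_div_of_pos hc', ENNReal.le_div_iff_mul_le (by simp [hc.ne']) (by simp),
    mul_comm, ENNReal.ofReal_natCast]
  refine le_trans ?_ (h1.trans hfb)
  gcongr
  intro hle
  exact_mod_cast hle

/-- Almost surely the starting time, the threshold and the rank all tend to infinity, so the
exceptional events have indicators converging a.s. to 0. -/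
theorem IsExpSequence.eventually_measure_start_le (h : IsExpSequence P X) (hr : IsRankSequence r)
    (hdiv : Tendsto (fun m : ℕ => ∑ k ∈ Finset.Icc 1 m, delta r k / (r k : ℝ)) atTop atTop)
    (hr_top : Tendsto r atTop atTop) {B : ℝ} (hB : 0 ≤ B) (R : ℕ) (b : ℝ) {η : ℝ} (hη : 0 < η) :
    ∀ᶠ N in atTop, P {ω | ¬(R ≤ r (acceptedValues r (X ω) (windowStart r B N (X ω))).card ∧
      b ≤ threshold r (acceptedValues r (X ω) (windowStart r B N (X ω))))} ≤ ENNReal.ofReal η := by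
  set s : ℕ → Set Ω := fun N => {ω | ¬(R ≤ r (acceptedValues r (X ω)
    (windowStart r B N (X ω))).card ∧
      b ≤ threshold r (acceptedValues r (X ω) (windowStart r B N (X ω))))} with hs
  have hsm : ∀ N, MeasurableSet (s N) := by
    intro N
    have hV := h.measurable_windowStart_values hr hB N
    refine MeasurableSet.compl (MeasurableSet.inter ?_ ?_)
    · exact measurableSet_le measurable_const
        ((measurable_of_countable r).comp (measurable_multiset_card.comp hV))
    · exact measurableSet_le measurable_const ((Hiring.measurable_threshold hr).comp hV)
  have hlim : Tendsto (fun N => P (s N)) atTop (𝓝 (P ∅)) := by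
    refine tendsto_measure_of_ae_tendsto_indicator_of_isFiniteMeasure atTop MeasurableSet.empty
      hsm ?_
    filter_upwards [h.ae_tendsto_threshold hr hdiv] with ω hω
    have h1 := tendsto_windowStart hr hB (X ω)
    have h2 := (hr_top.comp (tendsto_card_of_tendsto_threshold hω)).comp h1
    have h3 := hω.comp h1
    filter_upwards [h2.eventually (eventually_ge_atTop R),
      h3.eventually (eventually_ge_atTop b)] with N h4 h5
    simp only [hs, Set.mem_ofPred_eq, Set.mem_empty_iff_false, iff_false, not_not]
    exact ⟨h4, h5⟩
  rw [measure_empty] at hlim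
  filter_upwards [hlim.eventually (ge_mem_nhds (ENNReal.ofReal_pos.2 hη))] with N hN using hN

/-- Four exceptional events receive η/4 each: a value close to Y_t, too many exceedances, a start
with small rank or threshold, and a gap. The constants are chosen in turn: C from B and η, then R
from C and ε, and finally N large. -/
theorem IsExpSequence.eventually_measure_not_windowGood_le (h : IsExpSequence P X)
    (hr : IsRankSequence r)
    (hdiv : Tendsto (fun m : ℕ => ∑ k ∈ Finset.Icc 1 m, delta r k / (r k : ℝ)) atTop atTop)
    (hr_top : Tendsto r atTop atTop) {B : ℝ} (hB : 2 ≤ B) {ε : ℝ} (hε0 : 0 < ε) (hε1 : ε ≤ 1 / 4)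
    {η : ℝ} (hη : 0 < η) (hεη : 2 * (Real.exp ε - 1) * B ≤ η / 4) :
    ∀ᶠ N in atTop, P {ω | ¬WindowGood r B ε N (X ω) (windowStart r B N (X ω))} ≤
      ENNReal.ofReal η := by
  classical
  have hB0 : 0 ≤ B := by linarith
  -- At most B exceedances are expected, so Markov's inequality bounds the probability of C+1 or
  -- more by η/4.
  obtain ⟨C, hC⟩ := exists_nat_ge (4 * B / η)
  obtain ⟨R, hR⟩ := h.exists_measure_gapEvent_le hε0 (2 * (C + 1)) (by linarith : 0 < η / 4)
  have hNB : ∀ᶠ N : ℕ in atTop, B < N := tendsto_natCast_atTop_atTop.eventually_gt_atTop B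
  filter_upwards [h.eventually_measure_start_le hr hdiv hr_top hB0 R 1
    (by linarith : 0 < η / 4), hNB] with N hN1 hN2
  set τ := fun ω => windowStart r B N (X ω) with hτ
  set D1 : Ω → Finset ℕ := fun ω => (Finset.Ioc (τ ω) N).filter fun k =>
    threshold r (acceptedValues r (X ω) (τ ω)) - ε < X ω k ∧
      X ω k ≤ threshold r (acceptedValues r (X ω) (τ ω)) + ε with hD1
  set D2 : Ω → Finset ℕ := fun ω => (Finset.Ioc (τ ω) N).filter fun k =>
    threshold r (acceptedValues r (X ω) (τ ω)) < X ω k with hD2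
  have hs1 : MeasurableSet {z : ℝ × ℝ | z.1 - ε < z.2 ∧ z.2 ≤ z.1 + ε} :=
    (measurableSet_lt (measurable_fst.sub_const ε) measurable_snd).inter
      (measurableSet_le measurable_snd (measurable_fst.add_const ε))
  have hs2 : MeasurableSet {z : ℝ × ℝ | z.1 < z.2} :=
    measurableSet_lt (by fun_prop) (by fun_prop)
  have hexp : 0 ≤ Real.exp ε - 1 := by linarith [Real.add_one_le_exp ε]
  have hP1 : P {ω | 1 ≤ (D1 ω).card} ≤ ENNReal.ofReal (η / 4) := by
    have hm : Measurable fun ω => (D1 ω).card := (measurable_of_countable Finset.card).comp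
      (h.measurable_windowStart_filter hr hB0 N (D := fun y z => y - ε < z ∧ z ≤ y + ε) hs1)
    refine (measure_le_of_lintegral_natCast_le hm one_pos (h.lintegral_windowStart_card_le hr hB0 N
      (D := fun y z => y - ε < z ∧ z ≤ y + ε) hs1 (θ := 2 * (Real.exp ε - 1)) (by linarith)
      fun y hy => expMeasure_Ioc_le hy hε0.le)).trans ?_
    apply ENNReal.ofReal_le_ofReal
    simpa using hεη
  have hP2 : P {ω | C + 1 ≤ (D2 ω).card} ≤ ENNReal.ofReal (η / 4) := by
    have hm : Measurable fun ω => (D2 ω).card := (measurable_of_countable Finset.card).comp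
      (h.measurable_windowStart_filter hr hB0 N (D := fun y z => y < z) hs2)
    refine (measure_le_of_lintegral_natCast_le hm C.succ_pos (h.lintegral_windowStart_card_le hr
      hB0 N (D := fun y z => y < z) hs2 (θ := 1) (by linarith)
      fun y hy => by rw [one_mul]; exact (expMeasure_Ioi hy).le)).trans ?_
    apply ENNReal.ofReal_le_ofReal
    rw [div_le_iff₀ hη] at hC
    rw [div_le_iff₀ (by positivity)]
    push_cast
    nlinarith
  have hsub : {ω | ¬WindowGood r B ε N (X ω) (τ ω)} ⊆
      {ω | 1 ≤ (D1 ω).card} ∪ {ω | C + 1 ≤ (D2 ω).card} ∪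
      {ω | ¬(R ≤ r (acceptedValues r (X ω) (τ ω)).card ∧
        1 ≤ threshold r (acceptedValues r (X ω) (τ ω)))} ∪
      {ω | gapEvent ε (2 * (C + 1)) R N (X ω)} := by
    intro ω hω
    by_contra hcon
    simp only [Set.mem_union, Set.mem_ofPred_eq, not_or, not_not, not_le] at hcon
    obtain ⟨⟨⟨h1, h2⟩, h3, h4⟩, h5⟩ := hcon
    refine hω (windowGood_of hr hB hε0 hε1 (C := C + 1) (R := R) (by omega) rfl hN2 ?_ ?_ h3 h4 h5)
    · intro k hk hk2
      have : D1 ω = ∅ := Finset.card_eq_zero.1 (by omega)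
      have h6 : k ∈ D1 ω := Finset.mem_filter.2 ⟨hk, hk2⟩
      rw [this] at h6
      exact Finset.notMem_empty _ h6
    · exact h2.le
  refine (measure_mono hsub).trans ?_
  refine (measure_union_le _ _).trans ?_
  have e : ENNReal.ofReal η = ENNReal.ofReal (η / 4) + ENNReal.ofReal (η / 4) +
      ENNReal.ofReal (η / 4) + ENNReal.ofReal (η / 4) := by
    rw [← ENNReal.ofReal_add, ← ENNReal.ofReal_add, ← ENNReal.ofReal_add] <;>
      first | positivity | (congr 1; ring)
  rw [e]
  gcongr
  · exact (measure_union_le _ _).trans (by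
      gcongr
      exact (measure_union_le _ _).trans (by gcongr))
  · exact hR N

end

/-! ### Comparison with Bernoulli indicators -/

theorem measurable_bernWeight (S c : Finset ℕ) : Measurable fun p => bernWeight p S c := by
  unfold bernWeight
  refine Finset.measurable_fun_prod _ fun k _ => ?_
  split_ifs
  · exact measurable_id
  · exact measurable_const.sub measurable_id

theorem measurable_bernSum (S : Finset ℕ) {φ : ℝ → Finset ℕ → ℝ}
    (hφ : ∀ c, Measurable fun p => φ p c) : Measurable fun p => bernSum p S (φ p) := by
  unfold bernSum
  exact Finset.measurable_fun_sum _ fun c _ => (measurable_bernWeight S c).mul (hφ c)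

theorem bernSum_mem_Icc {p : ℝ} (h0 : 0 ≤ p) (h1 : p ≤ 1) (S : Finset ℕ) {f : Finset ℕ → ℝ}
    (hf : ∀ c, 0 ≤ f c ∧ f c ≤ 1) : 0 ≤ bernSum p S f ∧ bernSum p S f ≤ 1 := by
  constructor
  · rw [← bernSum_const (p := p) S 0]
    exact bernSum_mono h0 h1 fun c _ => (hf c).1
  · rw [← bernSum_const (p := p) S 1]
    exact bernSum_mono h0 h1 fun c _ => (hf c).2

theorem ofReal_bernSum_integral {U : Type*} [MeasurableSpace U] (ρ : ℕ → Measure U)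
    [∀ i, IsProbabilityMeasure (ρ i)] {p : ℝ} (h0 : 0 ≤ p) (h1 : p ≤ 1) (S : Finset ℕ) {G : Set U}
    (hG : MeasurableSet G) {F : U → Finset ℕ → ℝ} (hFm : ∀ c, Measurable fun u => F u c)
    (hF : ∀ u c, 0 ≤ F u c ∧ F u c ≤ 1) :
    ∑ c ∈ S.powerset, ENNReal.ofReal (bernWeight p S c) *
      ∫⁻ u, G.indicator (fun u => ENNReal.ofReal (F u c)) u ∂(ρ c.card) =
      ENNReal.ofReal (bernSum p S fun c => ∫ u in G, F u c ∂(ρ c.card)) := by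
  unfold bernSum
  rw [ENNReal.ofReal_sum_of_nonneg fun c _ => mul_nonneg (bernWeight_nonneg h0 h1 S c)
    (integral_nonneg fun u => (hF u c).1)]
  refine Finset.sum_congr rfl fun c _ => ?_
  rw [ENNReal.ofReal_mul (bernWeight_nonneg h0 h1 S c), lintegral_indicator hG,
    ofReal_integral_eq_lintegral_ofReal]
  · exact (Integrable.of_bound (hFm c).aestronglyMeasurable 1 (ae_of_all _ fun u => by
      rw [Real.norm_eq_abs, abs_of_nonneg (hF u c).1]; exact (hF u c).2)).integrableOn
  · exact ae_of_all _ fun u => (hF u c).1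

/-- The lower limit N + 1 - b, rather than N - b, makes the bound exactly b. It arises because
candidate n = N + 1 is treated separately. -/
theorem card_filter_window_le {N : ℕ} {b : ℝ} (hb : 0 ≤ b) {S : Finset ℕ}
    (hS : ∀ k ∈ S, k ≤ N ∧ (N : ℝ) + 1 - b ≤ k) : (S.card : ℝ) ≤ b := by
  have hsub : S ⊆ Finset.Icc (N + 1 - ⌊b⌋₊) N := by
    intro k hk
    refine Finset.mem_Icc.2 ⟨?_, (hS k hk).1⟩
    have h1 := (hS k hk).2
    have h2 : ((N + 1 - k : ℕ) : ℝ) ≤ b := by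
      rw [Nat.cast_sub (by have := (hS k hk).1; omega)]
      push_cast
      linarith
    have h3 := Nat.le_floor h2
    omega
  have h1 := Finset.card_le_card hsub
  rw [Nat.card_Icc] at h1
  have h2 : S.card ≤ ⌊b⌋₊ := by omega
  exact (Nat.cast_le.2 h2).trans (Nat.floor_le hb)

/-- Replacing the acceptance pattern of the window by independent Bernoulli indicators, the
parameter `q` being a function of the excesses. -/
theorem bernSum_integral_window_le {U : Type*} [MeasurableSpace U] (ρ : ℕ → Measure U)
    [∀ i, IsProbabilityMeasure (ρ i)] {p ε a v B : ℝ} {t N : ℕ} (htN : t ≤ N) (hp0 : 0 < p)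
    (hp1 : p ≤ 1 / 2) (hε0 : 0 ≤ ε) (hε : Real.exp ε ≤ 2) (ha : 0 < a) (hv : 0 < v)
    (hB : 4 * v ^ 2 + 4 * a + 2 ≤ B) (hBp : B / 2 ≤ ((N : ℝ) - t) * p)
    {q : U → ℝ} (hq : Measurable q) (hq01 : ∀ u, 0 < q u ∧ q u ≤ 1) {φ : ℝ → Finset ℕ → ℝ}
    (hφm : ∀ c, Measurable fun p => φ p c) (hφ : ∀ p c, 0 ≤ φ p c ∧ φ p c ≤ 1)
    (hφl : ∀ p, 0 < p → ∀ c, φ p c = φ p (c.filter fun k : ℕ => (N : ℝ) + 1 - a / p ≤ k)) :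
    bernSum p (Finset.Ioc t N) (fun c =>
      ∫ u in {u | p ≤ Real.exp ε * q u ∧ q u ≤ p}, φ (q u) c ∂(ρ c.card)) ≤
    bernSum p (Finset.Ioc t N) (fun c =>
      ∫ u in {u | p ≤ Real.exp ε * q u ∧ q u ≤ p},
        bernSum (q u) (Finset.Icc 1 N) (φ (q u)) ∂(ρ c.card)) +
      (2 * a / v + a * (Real.exp ε - 1)) := by
  classical
  have he : 0 < Real.exp ε := Real.exp_pos ε
  set G : Set U := {u | p ≤ Real.exp ε * q u ∧ q u ≤ p} with hG
  have hGm : MeasurableSet G := (measurableSet_le measurable_const (hq.const_mul _)).inter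
    (measurableSet_le hq measurable_const)
  -- The window of length a/q depends on u. On `G` one has a/q ≤ a e^ε/p, so the deterministic set
  -- `L` contains all these windows, and `E` holds the remaining, earlier indices.
  set L := (Finset.Ioc t N).filter fun k : ℕ => (N : ℝ) + 1 - a * Real.exp ε / p ≤ k with hL
  set E := (Finset.Ioc t N).filter fun k : ℕ => ¬ (N : ℝ) + 1 - a * Real.exp ε / p ≤ k with hE
  have hEL : Disjoint E L := (Finset.disjoint_filter_filter_not _ _ _).symm
  have hELu : E ∪ L = Finset.Ioc t N := by
    rw [Finset.union_comm]; exact Finset.filter_union_filter_not_eq _ _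
  have hLcard : (L.card : ℝ) ≤ a * Real.exp ε / p := by
    refine card_filter_window_le (N := N) (by positivity) fun k hk => ?_
    have h1 := Finset.mem_filter.1 hk
    exact ⟨(Finset.mem_Ioc.1 h1.1).2, h1.2⟩
  have hLp : (L.card : ℝ) * p ≤ 2 * a := by
    rw [le_div_iff₀ hp0] at hLcard
    nlinarith
  have hEcard : (E.card : ℝ) + L.card = N - t := by
    have h1 : E.card + L.card = N - t := by
      rw [← Finset.card_union_of_disjoint hEL, hELu, Nat.card_Ioc]
    have h2 : ((E.card + L.card : ℕ) : ℝ) = ((N - t : ℕ) : ℝ) := by rw [h1]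
    rw [Nat.cast_sub htN] at h2
    push_cast at h2
    exact h2
  -- The early successes have mean at least B/2 - 2a; with 1 - p ≥ 1/2 the lower bound imposed on B
  -- makes their variance at least v².
  have hEp : B / 2 - 2 * a ≤ E.card * p := by nlinarith
  have hv2 : v ^ 2 ≤ (E.card + 1) * p * (1 - p) := by nlinarith
  have hqG : ∀ u ∈ G, a / q u ≤ a * Real.exp ε / p := by
    intro u hu
    rw [div_le_div_iff₀ (hq01 u).1 hp0]
    nlinarith [hu.1]
  have hwin : ∀ u ∈ G, ∀ k : ℕ, k ≤ N → (N : ℝ) + 1 - a / q u ≤ k → k ∈ L := by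
    intro u hu k hkN hk
    have h1 := hqG u hu
    refine Finset.mem_filter.2 ⟨Finset.mem_Ioc.2 ⟨?_, hkN⟩, by linarith⟩
    have h2 : a * Real.exp ε / p ≤ (N : ℝ) - t := by
      rw [div_le_iff₀ hp0]
      nlinarith [sq_nonneg v]
    have h3 : (t : ℝ) < k := by linarith
    exact_mod_cast h3
  have hloc : ∀ u ∈ G, ∀ c : Finset ℕ, (∀ k ∈ c, k ≤ N) → ∀ d : Finset ℕ,
      (∀ k ∈ L, (N : ℝ) + 1 - a / q u ≤ k → k ∈ d) → φ (q u) c = φ (q u) (c ∩ d) := by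
    intro u hu c hc d hd
    rw [hφl _ (hq01 u).1 c, hφl _ (hq01 u).1 (c ∩ d)]
    congr 1
    ext k
    simp only [Finset.mem_filter, Finset.mem_inter]
    constructor
    · rintro ⟨h1, h2⟩
      exact ⟨⟨h1, hd k (hwin u hu k (hc k h1) h2) h2⟩, h2⟩
    · rintro ⟨⟨h1, -⟩, h2⟩
      exact ⟨h1, h2⟩
  have hη : 0 ≤ a * (Real.exp ε - 1) := by nlinarith [Real.add_one_le_exp ε]
  have key := bernSum_integral_le ρ hp0 (by linarith : p < 1) hEL hGm
    (F := fun u c => φ (q u) c) (fun c => (hφm c).comp hq) (fun u c => hφ _ c)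
    (fun u hu c hc => hloc u hu c (fun k hk => by
      have := hc hk
      rw [hELu] at this
      exact (Finset.mem_Ioc.1 this).2) L fun k hk _ => hk)
    (Φ := fun u => bernSum (q u) (Finset.Icc 1 N) (φ (q u)))
    ((measurable_bernSum (Finset.Icc 1 N) hφm).comp hq)
    (fun u => bernSum_mem_Icc (hq01 u).1.le (hq01 u).2 _ (hφ _)) hη
    (fun u hu => ?_) hv hv2
  · rw [hELu] at key
    refine key.trans ?_
    have : L.card * p * (1 / v) ≤ 2 * a / v := by
      rw [mul_one_div]
      gcongr
    linarith
  -- For fixed u only the true window matters. It has at most a/q points, and on `G` |p - q| ≤ q(e^ε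
  -- - 1), so replacing p by q costs at most a(e^ε - 1).
  · set Wd := L.filter fun k : ℕ => (N : ℝ) + 1 - a / q u ≤ k with hWd
    have hWL : Wd ⊆ L := Finset.filter_subset _ _
    have hLN : L ⊆ Finset.Icc 1 N := by
      intro k hk
      have := Finset.mem_Ioc.1 (Finset.mem_filter.1 hk).1
      exact Finset.mem_Icc.2 ⟨by omega, this.2⟩
    have hW : ∀ c ⊆ Finset.Icc 1 N, φ (q u) c = φ (q u) (c ∩ Wd) := fun c hc =>
      hloc u hu c (fun k hk => (Finset.mem_Icc.1 (hc hk)).2) Wd fun k hk hk2 =>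
        Finset.mem_filter.2 ⟨hk, hk2⟩
    have e1 := bernSum_of_inter (p := p) hWL (f := φ (q u)) fun c hc => hW c (hc.trans hLN)
    have e2 := bernSum_of_inter (p := q u) (hWL.trans hLN) (f := φ (q u)) hW
    have e3 := bernSum_le_bernSum_add hp0.le (by linarith) (hq01 u).1.le (hq01 u).2 Wd (hφ (q u))
    have hWc : (Wd.card : ℝ) ≤ a / q u := by
      have hq0 := (hq01 u).1
      refine card_filter_window_le (N := N) (by positivity) fun k hk => ?_
      have h1 := Finset.mem_filter.1 hk
      exact ⟨(Finset.mem_Icc.1 (hLN h1.1)).2, h1.2⟩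
    have hpq : |p - q u| ≤ q u * (Real.exp ε - 1) := by
      rw [abs_of_nonneg (by linarith [hu.2])]
      nlinarith [hu.1]
    have e4 : (Wd.card : ℝ) * |p - q u| ≤ a * (Real.exp ε - 1) := by
      calc (Wd.card : ℝ) * |p - q u| ≤ a / q u * (q u * (Real.exp ε - 1)) :=
            mul_le_mul hWc hpq (abs_nonneg _) (div_nonneg ha.le (hq01 u).1.le)
        _ = _ := by
          have := (hq01 u).1.ne'
          field_simp
    rw [e1, e2]
    linarith

/-! ### From a fixed starting time to the comparison before the last candidate. -/

section

variable {Ω : Type*} [mΩ : MeasurableSpace Ω] {P : Measure Ω} [IsProbabilityMeasure P]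
  {X : Ω → ℕ → ℝ} {r : ℕ → ℕ}

/-- The acceptance probability after adding the values `z.2` to the accepted values `z.1`. -/
def laterProb (r : ℕ → ℕ) (z : Multiset ℝ × Multiset ℝ) : ℝ :=
  min 1 (Real.exp (-threshold r (z.2 + z.1)))

theorem measurable_laterProb (hr : IsRankSequence r) : Measurable (laterProb r) :=
  measurable_const.min (Real.measurable_exp.comp ((measurable_threshold hr).comp
    (measurable_multiset_add.comp (measurable_snd.prodMk measurable_fst))).neg)

theorem laterProb_mem (z : Multiset ℝ × Multiset ℝ) : 0 < laterProb r z ∧ laterProb r z ≤ 1 :=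
  ⟨lt_min one_pos (Real.exp_pos _), min_le_left _ _⟩

/-- The pairs for which the acceptance probability decreases by a factor of at most `exp ε`. -/
def laterClose (r : ℕ → ℕ) (ε : ℝ) : Set (Multiset ℝ × Multiset ℝ) :=
  {z | Real.exp (-threshold r z.1) ≤ Real.exp ε * laterProb r z ∧
    laterProb r z ≤ Real.exp (-threshold r z.1)}

theorem measurableSet_laterClose (hr : IsRankSequence r) (ε : ℝ) :
    MeasurableSet (laterClose r ε) :=
  have h1 : Measurable fun z : Multiset ℝ × Multiset ℝ => Real.exp (-threshold r z.1) :=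
    Real.measurable_exp.comp ((measurable_threshold hr).comp measurable_fst).neg
  (measurableSet_le h1 ((measurable_laterProb hr).const_mul _)).inter
    (measurableSet_le (measurable_laterProb hr) h1)

section

variable {B ε a : ℝ} {N t : ℕ} {x : ℕ → ℝ}

/-- The cap at 1 in `laterProb` is inactive along actual paths, where thresholds are nonnegative; it
only serves arbitrary multisets. -/
theorem WindowGood.laterProb_eq (hr : IsRankSequence r) (hg : WindowGood r B ε N x t) :
    laterProb r (acceptedValues r x t, overValues (threshold r (acceptedValues r x t)) x t N) =
      Real.exp (-threshold r (acceptedValues r x N)) := by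
  unfold laterProb
  simp only
  rw [← hg.values_eq]
  exact min_eq_right (exp_neg_threshold_le_one hr x N)

theorem WindowGood.exp_le (hg : WindowGood r B ε N x t) :
    Real.exp (-threshold r (acceptedValues r x t)) ≤
      Real.exp ε * Real.exp (-threshold r (acceptedValues r x N)) := by
  rw [← Real.exp_add]
  exact Real.exp_le_exp.2 (by linarith [hg.threshold_le])

theorem WindowGood.mem_laterClose (hr : IsRankSequence r) (hg : WindowGood r B ε N x t) :
    (acceptedValues r x t, overValues (threshold r (acceptedValues r x t)) x t N) ∈
      laterClose r ε := by
  refine ⟨?_, ?_⟩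
  · rw [hg.laterProb_eq hr]
    exact hg.exp_le
  · rw [hg.laterProb_eq hr]
    exact Real.exp_le_exp.2 (neg_le_neg (threshold_acceptedValues_mono hr hg.le))

/-- The window of length a/q fits after time `t`: the expected number of exceedances is at least B/2
and q is at least half the initial probability, so (N - t) q ≥ B/4 ≥ a. -/
theorem WindowGood.div_le (hg : WindowGood r B ε N x t) (hε : Real.exp ε ≤ 2)
    (hB : 4 * a ≤ B) :
    a / Real.exp (-threshold r (acceptedValues r x N)) ≤ (N : ℝ) - t := by
  have h1 := hg.exp_le
  have h2 := hg.le_mul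
  have hp := Real.exp_pos (-threshold r (acceptedValues r x t))
  have hq := Real.exp_pos (-threshold r (acceptedValues r x N))
  have ht : (t : ℝ) ≤ N := by exact_mod_cast hg.le
  rw [div_le_iff₀ hq]
  nlinarith [mul_le_mul_of_nonneg_left (h1.trans (mul_le_mul_of_nonneg_right hε hq.le))
    (by linarith : (0 : ℝ) ≤ (N : ℝ) - t)]

theorem WindowGood.filter_eq (hg : WindowGood r B ε N x t) (hε : Real.exp ε ≤ 2)
    (hB : 4 * a ≤ B) :
    ((acceptedSet r x N).filter fun k : ℕ =>
      (N : ℝ) + 1 - a / Real.exp (-threshold r (acceptedValues r x N)) ≤ k) =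
    (overSet (threshold r (acceptedValues r x t)) x t N).filter fun k : ℕ =>
      (N : ℝ) + 1 - a / Real.exp (-threshold r (acceptedValues r x N)) ≤ k := by
  have h1 := hg.div_le hε hB
  ext k
  simp only [Finset.mem_filter, mem_acceptedSet]
  constructor
  · rintro ⟨⟨h2, h3⟩, h4⟩
    have h5 : t < k := by
      have : (t : ℝ) < k := by linarith
      exact_mod_cast this
    exact ⟨(hg.accepted_iff k (Finset.mem_Ioc.2 ⟨h5, h2.2⟩)).1 h3, h4⟩
  · rintro ⟨h2, h4⟩
    have h3 := overSet_subset _ _ _ _ h2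
    have h5 := Finset.mem_Ioc.1 h3
    exact ⟨⟨⟨by omega, h5.2⟩, (hg.accepted_iff k h3).2 h2⟩, h4⟩

end

/-- Both sides are rewritten by `IsExpSequence.setLIntegral_over` as averages over a Bernoulli set
and independent excesses. The comparison then holds for each fixed past, by
`bernSum_integral_window_le`. -/
theorem IsExpSequence.setLIntegral_window_le (h : IsExpSequence P X) (hr : IsRankSequence r)
    {B ε a v : ℝ} (hε0 : 0 ≤ ε) (hε : Real.exp ε ≤ 2) (ha : 0 < a) (hv : 0 < v)
    (hB : 4 * v ^ 2 + 4 * a + 2 ≤ B) {t N : ℕ} (htN : t ≤ N) {T : Set Ω}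
    (hT : MeasurableSet[valuesAlg X (Finset.Icc 1 t)] T)
    (hT1 : ∀ ω ∈ T, 1 ≤ threshold r (acceptedValues r (X ω) t))
    (hT2 : ∀ ω ∈ T, B / 2 ≤ ((N : ℝ) - t) * Real.exp (-threshold r (acceptedValues r (X ω) t)))
    {φ : ℝ → Finset ℕ → ℝ}
    (hφm : ∀ c, Measurable fun p => φ p c) (hφ : ∀ p c, 0 ≤ φ p c ∧ φ p c ≤ 1)
    (hφl : ∀ p, 0 < p → ∀ c, φ p c = φ p (c.filter fun k : ℕ => (N : ℝ) + 1 - a / p ≤ k)) :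
    ∫⁻ ω in T, (laterClose r ε).indicator
        (fun z => ENNReal.ofReal (φ (laterProb r z)
          (overSet (threshold r (acceptedValues r (X ω) t)) (X ω) t N)))
        (acceptedValues r (X ω) t, overValues (threshold r (acceptedValues r (X ω) t)) (X ω) t N)
        ∂P ≤
      ∫⁻ ω in T, (laterClose r ε).indicator
        (fun z => ENNReal.ofReal (bernSum (laterProb r z) (Finset.Icc 1 N) (φ (laterProb r z))))
        (acceptedValues r (X ω) t, overValues (threshold r (acceptedValues r (X ω) t)) (X ω) t N)
        ∂P + ENNReal.ofReal (2 * a / v + a * (Real.exp ε - 1)) * P T := by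
  have hTm : MeasurableSet T := h.valuesAlg_le (fun _ => one_le_of_mem_Icc) _ hT
  have hlm := measurable_laterProb hr
  have hcm := measurableSet_laterClose hr ε
  have hΦm : Measurable fun p => bernSum p (Finset.Icc 1 N) (φ p) := measurable_bernSum _ hφm
  have e1 := h.setLIntegral_over (Hiring.measurable_acceptedValues (X := X) hr t) hT
    (Hiring.measurable_threshold hr) (fun ω => threshold_acceptedValues_nonneg hr t) htN
    (fun c => (laterClose r ε).indicator fun z => ENNReal.ofReal (φ (laterProb r z) c))
    fun c => (((hφm c).comp hlm).ennreal_ofReal).indicator hcm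
  have e2 := h.setLIntegral_over (Hiring.measurable_acceptedValues (X := X) hr t) hT
    (Hiring.measurable_threshold hr) (fun ω => threshold_acceptedValues_nonneg hr t) htN
    (fun _ => (laterClose r ε).indicator fun z =>
      ENNReal.ofReal (bernSum (laterProb r z) (Finset.Icc 1 N) (φ (laterProb r z))))
    fun c => ((hΦm.comp hlm).ennreal_ofReal).indicator hcm
  rw [e1, e2, ← setLIntegral_const, ← lintegral_add_right _ measurable_const]
  refine setLIntegral_mono' hTm fun ω hω => ?_
  set A := acceptedValues r (X ω) t with hA
  set y := threshold r A with hy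
  have hy1 : 1 ≤ y := hT1 ω hω
  have hp1 : Real.exp (-y) ≤ 1 / 2 := by
    have h1 : Real.exp (-y) ≤ Real.exp (-1) := Real.exp_le_exp.2 (by linarith)
    linarith [Real.exp_neg_one_lt_half]
  have hqm : Measurable fun u => laterProb r (A, u) := hlm.comp measurable_prodMk_left
  set G : Set (Multiset ℝ) := {u | Real.exp (-y) ≤ Real.exp ε * laterProb r (A, u) ∧
    laterProb r (A, u) ≤ Real.exp (-y)} with hG
  have hGm : MeasurableSet G := (measurableSet_le measurable_const (hqm.const_mul _)).inter
    (measurableSet_le hqm measurable_const)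
  have hind : ∀ (f : Multiset ℝ × Multiset ℝ → ℝ≥0∞) u, (laterClose r ε).indicator f (A, u) =
      G.indicator (fun u => f (A, u)) u := fun f u => rfl
  simp only [hind]
  rw [ofReal_bernSum_integral (excessLaw y) (Real.exp_pos _).le (by linarith) _ hGm
      (F := fun u c => φ (laterProb r (A, u)) c) (fun c => (hφm c).comp hqm) (fun u c => hφ _ c),
    ofReal_bernSum_integral (excessLaw y) (Real.exp_pos _).le (by linarith) _ hGm
      (F := fun u _ => bernSum (laterProb r (A, u)) (Finset.Icc 1 N) (φ (laterProb r (A, u))))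
      (fun c => hΦm.comp hqm)
      (fun u c => bernSum_mem_Icc (laterProb_mem _).1.le (laterProb_mem _).2 _ (hφ _))]
  refine le_trans (ENNReal.ofReal_le_ofReal (bernSum_integral_window_le (excessLaw y) htN
    (Real.exp_pos _) hp1 hε0 hε ha hv hB (hT2 ω hω) hqm (fun u => laterProb_mem _) hφm hφ hφl)) ?_
  exact ENNReal.ofReal_add_le

/-- The comparison is summed over the values of the starting time. The bad event is paid for twice:
once when the actual pattern is replaced by the exceedance set, and once when the probability
predicted from the excesses is replaced by the actual one. -/
theorem IsExpSequence.lintegral_window_le (h : IsExpSequence P X) (hr : IsRankSequence r)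
    {B ε a v : ℝ} (hε0 : 0 ≤ ε) (hε : Real.exp ε ≤ 2) (ha : 0 < a) (hv : 0 < v)
    (hB : 4 * v ^ 2 + 4 * a + 2 ≤ B) (N : ℕ) {φ : ℝ → Finset ℕ → ℝ}
    (hφm : ∀ c, Measurable fun p => φ p c) (hφ : ∀ p c, 0 ≤ φ p c ∧ φ p c ≤ 1)
    (hφl : ∀ p, 0 < p → ∀ c, φ p c = φ p (c.filter fun k : ℕ => (N : ℝ) + 1 - a / p ≤ k)) :
    ∫⁻ ω, ENNReal.ofReal (φ (Real.exp (-threshold r (acceptedValues r (X ω) N)))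
        (acceptedSet r (X ω) N)) ∂P ≤
      ∫⁻ ω, ENNReal.ofReal (bernSum (Real.exp (-threshold r (acceptedValues r (X ω) N)))
        (Finset.Icc 1 N) (φ (Real.exp (-threshold r (acceptedValues r (X ω) N))))) ∂P +
      2 * P {ω | ¬WindowGood r B ε N (X ω) (windowStart r B N (X ω))} +
      ENNReal.ofReal (2 * a / v + a * (Real.exp ε - 1)) := by
  have hB0 : 0 ≤ B := by nlinarith [sq_nonneg v]
  -- A measurable hull of the same measure spares proving that goodness of the window is a
  -- measurable event.
  set Bd := toMeasurable P {ω | ¬WindowGood r B ε N (X ω) (windowStart r B N (X ω))} with hBd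
  have hBdm : MeasurableSet Bd := measurableSet_toMeasurable _ _
  set bad : Ω → ℝ≥0∞ := Bd.indicator fun _ => 1 with hbad
  have hbadm : Measurable bad := measurable_const.indicator hBdm
  set f : Ω → ℝ≥0∞ := fun ω => ENNReal.ofReal
    (φ (Real.exp (-threshold r (acceptedValues r (X ω) N))) (acceptedSet r (X ω) N)) with hf
  set g : Ω → ℝ≥0∞ := fun ω => ENNReal.ofReal
    (bernSum (Real.exp (-threshold r (acceptedValues r (X ω) N))) (Finset.Icc 1 N)
      (φ (Real.exp (-threshold r (acceptedValues r (X ω) N))))) with hg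
  set κ := ENNReal.ofReal (2 * a / v + a * (Real.exp ε - 1)) with hκ
  have hcard : ∀ ω ∉ Bd, WindowGood r B ε N (X ω) (windowStart r B N (X ω)) := by
    intro ω hω
    by_contra hcon
    exact hω (subset_toMeasurable _ _ hcon)
  have hbad1 : ∀ ω ∈ Bd, bad ω = 1 := fun ω hω => by simp [hbad, hω]
  have key : ∀ t, ∫⁻ ω in {ω | windowStart r B N (X ω) = t}, f ω ∂P ≤
      ∫⁻ ω in {ω | windowStart r B N (X ω) = t}, (g ω + bad ω + bad ω + κ) ∂P := by
    intro t
    have hSm := h.measurableSet_windowStart_eq hr hB0 N t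
    set S := {ω | windowStart r B N (X ω) = t} with hS
    rcases lt_or_ge N t with hNt | htN
    · have : S = ∅ := by
        ext ω
        have := windowStart_le (r := r) (N := N) (x := X ω) hB0
        simp only [hS, Set.mem_ofPred_eq, Set.mem_empty_iff_false, iff_false]
        omega
      simp [this]
    set T := S ∩ {ω | 1 ≤ threshold r (acceptedValues r (X ω) t) ∧
      B / 2 ≤ ((N : ℝ) - t) * Real.exp (-threshold r (acceptedValues r (X ω) t))} with hT
    have hY : Measurable[valuesAlg X (Finset.Icc 1 t)] fun ω =>
        threshold r (acceptedValues r (X ω) t) :=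
      (Hiring.measurable_threshold hr).comp (Hiring.measurable_acceptedValues (X := X) hr t)
    have hTm : MeasurableSet[valuesAlg X (Finset.Icc 1 t)] T := by
      refine (Hiring.measurableSet_windowStart_eq hr hB0 N t).inter (MeasurableSet.inter ?_ ?_)
      · exact hY measurableSet_Ici
      · exact ((Real.measurable_exp.comp hY.neg).const_mul _) measurableSet_Ici
    have hTm' : MeasurableSet T := h.valuesAlg_le (fun _ => one_le_of_mem_Icc) _ hTm
    have hTS : T ⊆ S := Set.inter_subset_left
    have main := h.setLIntegral_window_le hr hε0 hε ha hv hB htN hTm (fun ω hω => hω.2.1)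
      (fun ω hω => hω.2.2) hφm hφ hφl
    set H : Ω → ℝ≥0∞ := fun ω => (laterClose r ε).indicator
        (fun z => ENNReal.ofReal (φ (laterProb r z)
          (overSet (threshold r (acceptedValues r (X ω) t)) (X ω) t N)))
        (acceptedValues r (X ω) t,
          overValues (threshold r (acceptedValues r (X ω) t)) (X ω) t N) with hH
    set K : Ω → ℝ≥0∞ := fun ω => (laterClose r ε).indicator
        (fun z => ENNReal.ofReal (bernSum (laterProb r z) (Finset.Icc 1 N) (φ (laterProb r z))))
        (acceptedValues r (X ω) t,
          overValues (threshold r (acceptedValues r (X ω) t)) (X ω) t N) with hK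
    have hgood : ∀ ω ∈ S, ω ∉ Bd → WindowGood r B ε N (X ω) t := by
      intro ω hω hω2
      have := hcard ω hω2
      rwa [show windowStart r B N (X ω) = t from hω] at this
    have s1 : ∀ ω ∈ S, f ω ≤ T.indicator H ω + bad ω := by
      intro ω hω
      by_cases hb : ω ∈ Bd
      · rw [hbad1 ω hb]
        refine le_add_left ?_
        rw [← ENNReal.ofReal_one]
        exact ENNReal.ofReal_le_ofReal (hφ _ _).2
      · have hgd := hgood ω hω hb
        have hωT : ω ∈ T := ⟨hω, hgd.one_le, hgd.le_mul⟩
        refine le_add_right (le_of_eq ?_)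
        rw [Set.indicator_of_mem hωT, hH]
        simp only
        rw [Set.indicator_of_mem (hgd.mem_laterClose hr), hgd.laterProb_eq hr]
        simp only [hf]
        rw [hφl _ (Real.exp_pos _) (acceptedSet r (X ω) N),
          hφl _ (Real.exp_pos _) (overSet _ _ _ _),
          hgd.filter_eq hε (by nlinarith [sq_nonneg v])]
    have s2 : ∀ ω ∈ T, K ω ≤ g ω + bad ω := by
      intro ω hω
      by_cases hb : ω ∈ Bd
      · rw [hbad1 ω hb]
        refine le_add_left ?_
        rw [hK]
        refine (Set.indicator_le_self _ _ _).trans ?_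
        rw [← ENNReal.ofReal_one]
        exact ENNReal.ofReal_le_ofReal
          (bernSum_mem_Icc (laterProb_mem _).1.le (laterProb_mem _).2 _ (hφ _)).2
      · have hgd := hgood ω hω.1 hb
        refine le_add_right (le_of_eq ?_)
        rw [hK]
        simp only
        rw [Set.indicator_of_mem (hgd.mem_laterClose hr), hgd.laterProb_eq hr]
    calc ∫⁻ ω in S, f ω ∂P ≤ ∫⁻ ω in S, (T.indicator H ω + bad ω) ∂P := setLIntegral_mono' hSm s1
      _ = ∫⁻ ω in S, T.indicator H ω ∂P + ∫⁻ ω in S, bad ω ∂P := lintegral_add_right _ hbadm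
      _ = ∫⁻ ω in T, H ω ∂P + ∫⁻ ω in S, bad ω ∂P := by
        rw [setLIntegral_indicator hTm', Set.inter_eq_left.2 hTS]
      _ ≤ (∫⁻ ω in T, K ω ∂P + κ * P T) + ∫⁻ ω in S, bad ω ∂P := by gcongr
      _ ≤ (∫⁻ ω in T, (g ω + bad ω) ∂P + κ * P T) + ∫⁻ ω in S, bad ω ∂P := by
        gcongr 1
        gcongr 1
        exact setLIntegral_mono' hTm' s2
      _ ≤ (∫⁻ ω in S, (g ω + bad ω) ∂P + κ * P S) + ∫⁻ ω in S, bad ω ∂P := by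
        gcongr
      _ = ∫⁻ ω in S, (g ω + bad ω + bad ω + κ) ∂P := by
        have e1 : ∫⁻ ω in S, (g ω + bad ω + bad ω + κ) ∂P =
            ∫⁻ ω in S, (g ω + bad ω + bad ω) ∂P + ∫⁻ _ω in S, κ ∂P :=
          lintegral_add_right _ measurable_const
        have e2 : ∫⁻ ω in S, (g ω + bad ω + bad ω) ∂P =
            ∫⁻ ω in S, (g ω + bad ω) ∂P + ∫⁻ ω in S, bad ω ∂P := lintegral_add_right _ hbadm
        rw [e1, e2, setLIntegral_const]
        ring
  rw [h.lintegral_eq_tsum_windowStart hr hB0 N]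
  refine (ENNReal.tsum_le_tsum key).trans ?_
  rw [← h.lintegral_eq_tsum_windowStart hr hB0 N, lintegral_add_right _ measurable_const,
    lintegral_add_right _ hbadm, lintegral_add_right _ hbadm, lintegral_const, measure_univ,
    mul_one, hbad, lintegral_indicator_const hBdm, one_mul, hBd, measure_toMeasurable, two_mul,
    add_assoc (∫⁻ ω, g ω ∂P)]

end

/-! ### Tests on the window and their comparison with Bernoulli sets. -/

section

variable {Ω : Type*} [mΩ : MeasurableSpace Ω] {P : Measure Ω} [IsProbabilityMeasure P]
  {X : Ω → ℕ → ℝ} {r : ℕ → ℕ}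

/-- A function of the acceptance probability and the set of accepted candidates, with values in
`[0, 1]`, which depends on the window of length `a / p` before `n` only. -/
structure IsWindowTest (a : ℝ) (n : ℕ) (φ : ℝ → Finset ℕ → ℝ) : Prop where
  measurable : ∀ c, Measurable fun p => φ p c
  mem_Icc : ∀ p c, 0 ≤ φ p c ∧ φ p c ≤ 1
  filter_eq : ∀ p, 0 < p → ∀ c, φ p c = φ p (c.filter fun k : ℕ => (n : ℝ) - a / p ≤ k)

/-- The accepted candidates in the window before `n` compare, up to `η`, with a Bernoulli set. -/
structure WindowComparison (P : Measure Ω) (X : Ω → ℕ → ℝ) (r : ℕ → ℕ) (a η : ℝ) (n : ℕ) :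
    Prop where
  measure_le : P {ω | (n : ℝ) - a / acceptProb r (X ω) n < 1} ≤ ENNReal.ofReal η
  lintegral_le : ∀ φ, IsWindowTest a n φ →
    ∫⁻ ω, ENNReal.ofReal (φ (acceptProb r (X ω) n) (acceptedSet r (X ω) n)) ∂P ≤
      ∫⁻ ω, ENNReal.ofReal (bernSum (acceptProb r (X ω) n) (Finset.Icc 1 n)
        (φ (acceptProb r (X ω) n))) ∂P + ENNReal.ofReal η

/-- The last candidate is accepted with conditional probability `p`. -/
theorem IsExpSequence.lintegral_acceptedSet_succ (h : IsExpSequence P X) (hr : IsRankSequence r)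
    (N : ℕ) {φ : ℝ → Finset ℕ → ℝ} (hφm : ∀ c, Measurable fun p => φ p c)
    (hφ : ∀ p c, 0 ≤ φ p c ∧ φ p c ≤ 1) :
    ∫⁻ ω, ENNReal.ofReal (φ (acceptProb r (X ω) (N + 1)) (acceptedSet r (X ω) (N + 1))) ∂P =
      ∫⁻ ω, ENNReal.ofReal
        ((1 - Real.exp (-threshold r (acceptedValues r (X ω) N))) *
          φ (Real.exp (-threshold r (acceptedValues r (X ω) N))) (acceptedSet r (X ω) N) +
        Real.exp (-threshold r (acceptedValues r (X ω) N)) *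
          φ (Real.exp (-threshold r (acceptedValues r (X ω) N)))
            (insert (N + 1) (acceptedSet r (X ω) N))) ∂P := by
  set g : (ℝ × Finset ℕ) × ℝ → ℝ≥0∞ := fun z =>
    if z.1.1 < z.2 then ENNReal.ofReal (φ (Real.exp (-z.1.1)) (insert (N + 1) z.1.2))
    else ENNReal.ofReal (φ (Real.exp (-z.1.1)) z.1.2) with hg
  have hφu : Measurable fun z : Finset ℕ × ℝ => φ z.2 z.1 :=
    measurable_from_prod_countable_right fun c => hφm c
  have hgm : Measurable g := by
    refine Measurable.ite (measurableSet_lt (by fun_prop) (by fun_prop)) ?_ ?_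
    · exact (hφu.comp (f := fun z : (ℝ × Finset ℕ) × ℝ =>
        (insert (N + 1) z.1.2, Real.exp (-z.1.1)))
        (((measurable_of_countable fun c : Finset ℕ => insert (N + 1) c).comp
          (by fun_prop)).prodMk (by fun_prop))).ennreal_ofReal
    · exact (hφu.comp (f := fun z : (ℝ × Finset ℕ) × ℝ => (z.1.2, Real.exp (-z.1.1)))
        (by fun_prop)).ennreal_ofReal
  have hW : Measurable[valuesAlg X (Finset.Icc 1 N)] fun ω =>
      (threshold r (acceptedValues r (X ω) N), acceptedSet r (X ω) N) :=
    ((Hiring.measurable_threshold hr).comp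
      (Hiring.measurable_acceptedValues (X := X) hr N)).prodMk
      (Hiring.measurable_acceptedSet (X := X) hr N)
  have step := h.lintegral_fresh (fun _ => one_le_of_mem_Icc) (k := N + 1) (by omega) (by simp)
    hW hgm
  have e1 : ∀ ω, ENNReal.ofReal (φ (acceptProb r (X ω) (N + 1)) (acceptedSet r (X ω) (N + 1))) =
      g ((threshold r (acceptedValues r (X ω) N), acceptedSet r (X ω) N), X ω (N + 1)) := by
    intro ω
    rw [acceptedSet_succ, acceptProb_succ, hg]
    by_cases hlt : threshold r (acceptedValues r (X ω) N) < X ω (N + 1)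
    · simp [hlt]
    · simp [hlt]
  simp only [e1]
  rw [step]
  refine lintegral_congr fun ω => ?_
  set y := threshold r (acceptedValues r (X ω) N) with hy
  have hy0 : 0 ≤ y := threshold_acceptedValues_nonneg hr N
  have hp1 : Real.exp (-y) ≤ 1 := by rw [Real.exp_le_one_iff]; linarith
  rw [← lintegral_add_compl _ (measurableSet_Ioi (a := y)), Set.compl_Ioi, add_comm,
    ENNReal.ofReal_add (mul_nonneg (by linarith) (hφ _ _).1)
      (mul_nonneg (Real.exp_pos _).le (hφ _ _).1), ENNReal.ofReal_mul (by linarith),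
    ENNReal.ofReal_mul (Real.exp_pos _).le, ← expMeasure_Iic hy0, ← expMeasure_Ioi hy0,
    mul_comm, mul_comm (expMeasure 1 (Set.Ioi y)), ← setLIntegral_const, ← setLIntegral_const]
  congr 1
  · refine setLIntegral_congr_fun measurableSet_Iic fun x hx => ?_
    simp only [hg]
    rw [if_neg (not_lt.2 (Set.mem_Iic.1 hx))]
  · refine setLIntegral_congr_fun measurableSet_Ioi fun x hx => ?_
    simp only [hg]
    rw [if_pos (Set.mem_Ioi.1 hx)]

theorem IsExpSequence.eventually_windowComparison (h : IsExpSequence P X) (hr : IsRankSequence r)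
    (hdiv : Tendsto (fun m : ℕ => ∑ k ∈ Finset.Icc 1 m, delta r k / (r k : ℝ)) atTop atTop)
    (hr_top : Tendsto r atTop atTop) {a η : ℝ} (ha : 0 < a) (hη : 0 < η) :
    ∀ᶠ n in atTop, WindowComparison P X r a η n := by
  -- This choice makes the decoupling error 2a/v equal to η/4; B is then the smallest value admitted
  -- by `IsExpSequence.lintegral_window_le`.
  set v := 8 * a / η with hv
  have hv0 : 0 < v := by positivity
  set B := 4 * v ^ 2 + 4 * a + 2 with hB
  have hBa : 4 * a ≤ B := by nlinarith [sq_nonneg v]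
  have hB2 : 2 ≤ B := by nlinarith [sq_nonneg v]
  -- Since e^ε - 1 ≤ 2ε, this ε makes both the error a(e^ε - 1) and the chance of a value near the
  -- threshold small relative to η.
  set ε := min (1 / 4) (η / (128 * B)) with hε
  have hε0 : 0 < ε := lt_min (by norm_num) (by positivity)
  have hε1 : ε ≤ 1 / 4 := min_le_left _ _
  have hεB : B * ε ≤ η / 128 := by
    have h1 : ε ≤ η / (128 * B) := min_le_right _ _
    rw [le_div_iff₀ (by positivity)] at h1
    linarith
  have hexp : Real.exp ε - 1 ≤ 2 * ε := by
    have h1 : 1 - ε ≤ Real.exp (-ε) := by linarith [Real.add_one_le_exp (-ε)]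
    have h2 : Real.exp ε * Real.exp (-ε) = 1 := by rw [← Real.exp_add]; simp
    nlinarith [Real.exp_pos ε]
  have hexp2 : Real.exp ε ≤ 2 := by linarith
  have hexp0 : 0 ≤ Real.exp ε - 1 := by linarith [Real.add_one_le_exp ε]
  have hgood := h.eventually_measure_not_windowGood_le hr hdiv hr_top hB2 hε0 hε1
    (η := η / 8) (by positivity) (by nlinarith)
  have e1 : 2 * a / v = η / 4 := by
    rw [hv]
    field_simp
    norm_num
  have e2 : a * (Real.exp ε - 1) ≤ η / 4 := by nlinarith
  rw [← map_add_atTop_eq_nat 1, eventually_map]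
  filter_upwards [hgood] with N hN
  refine ⟨?_, fun φ hφ => ?_⟩
  · refine (measure_mono fun ω hω => ?_).trans (hN.trans (ENNReal.ofReal_le_ofReal (by linarith)))
    simp only [Set.mem_ofPred_eq, acceptProb_succ] at hω ⊢
    intro hg
    have h1 := hg.div_le hexp2 hBa
    push_cast at hω
    have h2 : (0 : ℝ) ≤ windowStart r B N (X ω) := Nat.cast_nonneg _
    linarith
  -- Tests are required to lie in [0,1] for every real p, so the mixing probability is clipped; on
  -- genuine acceptance probabilities the clipping does nothing.
  · set c01 : ℝ → ℝ := fun p => max 0 (min 1 p) with hc01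
    have hc0 : ∀ p, 0 ≤ c01 p := fun p => le_max_left _ _
    have hc1 : ∀ p, c01 p ≤ 1 := fun p => max_le zero_le_one (min_le_left _ _)
    have hceq : ∀ p, 0 ≤ p → p ≤ 1 → c01 p = p := fun p h0 h1 => by
      rw [hc01]
      simp only
      rw [min_eq_right h1, max_eq_right h0]
    have hcm : Measurable c01 := measurable_const.max (measurable_const.min measurable_id)
    -- Candidate N+1 is an exact Bernoulli trial with parameter P_n; averaging over it reduces a
    -- test at n to one at N.
    set ψ : ℝ → Finset ℕ → ℝ := fun p c =>
      (1 - c01 p) * φ p c + c01 p * φ p (insert (N + 1) c) with hψ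
    have hψm : ∀ c, Measurable fun p => ψ p c := fun c =>
      ((measurable_const.sub hcm).mul (hφ.measurable c)).add (hcm.mul (hφ.measurable _))
    have hψ01 : ∀ p c, 0 ≤ ψ p c ∧ ψ p c ≤ 1 := by
      intro p c
      have h1 := hφ.mem_Icc p c
      have h2 := hφ.mem_Icc p (insert (N + 1) c)
      have h3 := hc0 p
      have h4 := hc1 p
      constructor <;> simp only [hψ] <;> nlinarith
    have hψl : ∀ p, 0 < p → ∀ c,
        ψ p c = ψ p (c.filter fun k : ℕ => (N : ℝ) + 1 - a / p ≤ k) := by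
      intro p hp c
      have h1 : (N : ℝ) + 1 - a / p ≤ (N + 1 : ℕ) := by
        have : 0 < a / p := by positivity
        push_cast
        linarith
      have h2 := hφ.filter_eq p hp c
      have h3 := hφ.filter_eq p hp (insert (N + 1) c)
      push_cast at h2 h3
      rw [Finset.filter_insert, if_pos (by exact_mod_cast h1)] at h3
      simp only [hψ]
      rw [← h2, ← h3]
    have main := h.lintegral_window_le hr hε0.le hexp2 ha hv0 (B := B) le_rfl N hψm hψ01 hψl
    rw [h.lintegral_acceptedSet_succ hr N hφ.measurable hφ.mem_Icc]
    have hb : ∀ ω, bernSum (acceptProb r (X ω) (N + 1)) (Finset.Icc 1 (N + 1))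
        (φ (acceptProb r (X ω) (N + 1))) =
        bernSum (Real.exp (-threshold r (acceptedValues r (X ω) N))) (Finset.Icc 1 N)
          (ψ (Real.exp (-threshold r (acceptedValues r (X ω) N)))) := by
      intro ω
      rw [acceptProb_succ, ← Finset.insert_Icc_right_eq_Icc_add_one (by omega),
        bernSum_insert (by simp), ← bernSum_const_mul, ← bernSum_const_mul, ← bernSum_add]
      simp only [hψ, hceq _ (Real.exp_pos _).le (exp_neg_threshold_le_one hr (X ω) N)]
    simp only [hb]
    simp only [hψ, hceq _ (Real.exp_pos _).le (exp_neg_threshold_le_one hr (X _) N)] at main ⊢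
    refine main.trans ?_
    rw [add_assoc]
    gcongr
    calc _ ≤ 2 * ENNReal.ofReal (η / 8) + ENNReal.ofReal (η / 4 + η / 4) :=
          add_le_add (by gcongr) (ENNReal.ofReal_le_ofReal (by linarith))
      _ = ENNReal.ofReal (3 / 4 * η) := by
          rw [← ENNReal.ofReal_ofNat, ← ENNReal.ofReal_mul (by norm_num),
            ← ENNReal.ofReal_add (by positivity) (by positivity)]
          congr 1
          ring
      _ ≤ ENNReal.ofReal η := ENNReal.ofReal_le_ofReal (by linarith)

end

/-! ### The conditional probability of acceptance -/

section

variable {Ω : Type*} [mΩ : MeasurableSpace Ω] {P : Measure Ω} [IsProbabilityMeasure P]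
  {X : Ω → ℕ → ℝ} {r : ℕ → ℕ}

theorem IsExpSequence.measurableSet_accepted (h : IsExpSequence P X) (hr : IsRankSequence r)
    {n : ℕ} (hn : 1 ≤ n) : MeasurableSet {ω | Accepted r (X ω) n} :=
  measurableSet_lt (h.measurable_threshold hr (n - 1)) (h.measurable n hn)

theorem IsExpSequence.condExp_accepted (h : IsExpSequence P X) (hr : IsRankSequence r) {n : ℕ}
    (hn : 1 ≤ n) :
    P⟦{ω | Accepted r (X ω) n} | valuesAlg X (Finset.Icc 1 (n - 1))⟧ =ᵐ[P]
      fun ω => acceptProb r (X ω) n := by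
  have hle := h.valuesAlg_le (S := Finset.Icc 1 (n - 1)) fun _ => one_le_of_mem_Icc
  have hAm := h.measurableSet_accepted hr hn
  have hp0 : ∀ ω, 0 ≤ acceptProb r (X ω) n := fun ω => (acceptProb_pos _ _).le
  have hpi : Integrable (fun ω => acceptProb r (X ω) n) P :=
    Integrable.of_bound (h.measurable_acceptProb hr n).aestronglyMeasurable 1
      (ae_of_all _ fun ω => by
        rw [Real.norm_eq_abs, abs_of_nonneg (hp0 ω)]
        exact acceptProb_le_one hr _ _)
  symm
  refine ae_eq_condExp_of_forall_setIntegral_eq hle ((integrable_const 1).indicator hAm)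
    (fun _ _ _ => hpi.integrableOn) (fun T hT _ => ?_) ?_
  · rw [setIntegral_indicator hAm, setIntegral_const, smul_eq_mul, mul_one,
      integral_eq_lintegral_of_nonneg_ae (ae_of_all _ hp0)
        (h.measurable_acceptProb hr n).aestronglyMeasurable, Measure.real]
    congr 1
    obtain ⟨m, rfl⟩ : ∃ m, n = m + 1 := ⟨n - 1, by omega⟩
    have := h.measure_accepted hr m hT
    simp only [accepted_succ_iff, acceptProb_succ]
    exact this.symm
  · exact (Real.measurable_exp.comp ((Hiring.measurable_threshold hr).comp
      (Hiring.measurable_acceptedValues (X := X) hr (n - 1))).neg).aestronglyMeasurable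

theorem IsExpSequence.ae_tendsto_acceptProb (h : IsExpSequence P X) (hr : IsRankSequence r)
    (hdiv : Tendsto (fun m : ℕ => ∑ k ∈ Finset.Icc 1 m, delta r k / (r k : ℝ)) atTop atTop) :
    ∀ᵐ ω ∂P, Tendsto (fun n => acceptProb r (X ω) n) atTop (𝓝 0) := by
  filter_upwards [h.ae_tendsto_threshold hr hdiv] with ω hω
  rw [← tendsto_add_atTop_iff_nat 1]
  simp only [acceptProb_succ]
  exact Real.tendsto_exp_neg_atTop_nhds_zero.comp hω

end

/-! ### Total variation on the natural numbers -/

section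

variable {μ ν : Measure ℕ}

theorem measure_le_of_singleton_le {A : Set ℕ} (hA : ∀ j ∈ A, μ {j} ≤ ν {j}) : μ A ≤ ν A := by
  rw [← μ.tsum_indicator_apply_singleton A .of_discrete,
    ← ν.tsum_indicator_apply_singleton A .of_discrete]
  refine ENNReal.tsum_le_tsum fun j => ?_
  by_cases hj : j ∈ A
  · simpa [hj] using hA j hj
  · simp [hj]

theorem dTV_nonneg : 0 ≤ dTV μ ν := Real.iSup_nonneg fun _ => abs_nonneg _

variable [IsProbabilityMeasure μ] [IsProbabilityMeasure ν]

/-- The set where the mass function of μ exceeds that of ν maximises the difference, as in a Hahn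
decomposition. -/
theorem measureReal_sub_le_of_singleton (A : Set ℕ) :
    μ.real A - ν.real A ≤ μ.real {j | ν {j} < μ {j}} - ν.real {j | ν {j} < μ {j}} := by
  set s := {j | ν {j} < μ {j}} with hs
  have h1 : μ.real (A \ s) ≤ ν.real (A \ s) :=
    ENNReal.toReal_mono (measure_ne_top _ _) (measure_le_of_singleton_le fun j hj =>
      not_lt.1 hj.2)
  have h2 : ν.real (s \ A) ≤ μ.real (s \ A) :=
    ENNReal.toReal_mono (measure_ne_top _ _) (measure_le_of_singleton_le fun j hj =>
      (show ν {j} < μ {j} from hj.1).le)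
  have e1 := measureReal_inter_add_sdiff (μ := μ) (s := A) (t := s) .of_discrete
  have e2 := measureReal_inter_add_sdiff (μ := ν) (s := A) (t := s) .of_discrete
  have e3 := measureReal_inter_add_sdiff (μ := μ) (s := s) (t := A) .of_discrete
  have e4 := measureReal_inter_add_sdiff (μ := ν) (s := s) (t := A) .of_discrete
  rw [Set.inter_comm s A] at e3 e4
  linarith

theorem dTV_le_of_singleton :
    dTV μ ν ≤ μ.real {j | ν {j} < μ {j}} - ν.real {j | ν {j} < μ {j}} := by
  have : Nonempty {A : Set ℕ // MeasurableSet A} := ⟨⟨∅, .empty⟩⟩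
  refine ciSup_le fun ⟨A, hA⟩ => abs_le.2 ⟨?_, measureReal_sub_le_of_singleton A⟩
  have h1 := measureReal_sub_le_of_singleton (μ := μ) (ν := ν) Aᶜ
  rw [probReal_compl_eq_one_sub hA, probReal_compl_eq_one_sub hA] at h1
  linarith

theorem le_dTV {A : Set ℕ} : μ.real A - ν.real A ≤ dTV μ ν := by
  refine (le_abs_self _).trans (le_ciSup (f := fun A : {A : Set ℕ // MeasurableSet A} =>
    |μ.real A - ν.real A|) ⟨1, ?_⟩ ⟨A, .of_discrete⟩)
  rintro _ ⟨B, rfl⟩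
  have h1 : μ.real B ≤ 1 := measureReal_le_one
  have h2 : ν.real B ≤ 1 := measureReal_le_one
  have h3 : 0 ≤ μ.real B := measureReal_nonneg
  have h4 : 0 ≤ ν.real B := measureReal_nonneg
  exact abs_le.2 ⟨by linarith, by linarith⟩

theorem abs_integral_sub_le_dTV {f : ℕ → ℝ} {C : ℝ} (hf : ∀ j, |f j| ≤ C) :
    |∫ j, f j ∂μ - ∫ j, f j ∂ν| ≤ 2 * C * dTV μ ν := by
  have hi : ∀ (g : ℕ → ℝ) (D : ℝ) (_ : ∀ j, |g j| ≤ D) (ρ : Measure ℕ) [IsProbabilityMeasure ρ],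
      Integrable g ρ := fun g D hg ρ _ =>
    Integrable.of_bound (measurable_of_countable g).aestronglyMeasurable D (ae_of_all _ hg)
  have hC : 0 ≤ C := (abs_nonneg _).trans (hf 0)
  have key : ∀ g : ℕ → ℝ, (∀ j, |g j| ≤ C) →
      ∫ j, g j ∂μ - ∫ j, g j ∂ν ≤ 2 * C * dTV μ ν := by
    intro g hg
    set s := {j | ν {j} < μ {j}} with hs
    have hsm : MeasurableSet s := .of_discrete
    have hr1 : μ.restrict sᶜ ≤ ν.restrict sᶜ := by
      refine Measure.le_iff.2 fun A hA => ?_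
      rw [Measure.restrict_apply hA, Measure.restrict_apply hA]
      exact measure_le_of_singleton_le fun j hj => not_lt.1 hj.2
    have hr2 : ν.restrict s ≤ μ.restrict s := by
      refine Measure.le_iff.2 fun A hA => ?_
      rw [Measure.restrict_apply hA, Measure.restrict_apply hA]
      exact measure_le_of_singleton_le fun j hj => (show ν {j} < μ {j} from hj.2).le
    have hg1 : ∀ j, |g j + C| ≤ 2 * C := fun j => by
      have := abs_le.1 (hg j)
      exact abs_le.2 ⟨by linarith, by linarith⟩
    have hg2 : ∀ j, |C - g j| ≤ 2 * C := fun j => by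
      have := abs_le.1 (hg j)
      exact abs_le.2 ⟨by linarith, by linarith⟩
    -- On each half of the decomposition one measure dominates, and g + C or C - g is the
    -- nonnegative integrand to compare. Adding both gives 2C times the excess on `s`.
    have h1 : ∫ j in sᶜ, (g j + C) ∂μ ≤ ∫ j in sᶜ, (g j + C) ∂ν :=
      integral_mono_measure hr1 (ae_of_all _ fun j => by
        have := abs_le.1 (hg j)
        simp only [Pi.zero_apply]
        linarith) (hi _ _ hg1 ν).integrableOn
    have h2 : ∫ j in s, (C - g j) ∂ν ≤ ∫ j in s, (C - g j) ∂μ :=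
      integral_mono_measure hr2 (ae_of_all _ fun j => by
        have := abs_le.1 (hg j)
        simp only [Pi.zero_apply]
        linarith) (hi _ _ hg2 μ).integrableOn
    have hgi := fun (ρ : Measure ℕ) [IsProbabilityMeasure ρ] => hi g C hg ρ
    rw [integral_add (hgi μ).integrableOn (integrable_const C),
      integral_add (hgi ν).integrableOn (integrable_const C), setIntegral_const,
      setIntegral_const, probReal_compl_eq_one_sub hsm, probReal_compl_eq_one_sub hsm,
      smul_eq_mul, smul_eq_mul] at h1
    rw [integral_sub (integrable_const C) (hgi ν).integrableOn,
      integral_sub (integrable_const C) (hgi μ).integrableOn, setIntegral_const,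
      setIntegral_const, smul_eq_mul, smul_eq_mul] at h2
    have e1 := integral_add_compl hsm (hgi μ)
    have e2 := integral_add_compl hsm (hgi ν)
    have h3 : μ.real s - ν.real s ≤ dTV μ ν := le_dTV
    nlinarith
  have h1 := key f hf
  have h2 := key (fun j => -f j) fun j => by rw [abs_neg]; exact hf j
  rw [integral_neg, integral_neg] at h2
  exact abs_le.2 ⟨by linarith, h1⟩

end

/-! ### The geometric distribution -/

section

variable {p : ℝ}

theorem geomFromOne_apply (A : Set ℕ) : geomFromOne p A =
    ∑' j : ℕ, ENNReal.ofReal (p * (1 - p) ^ j) * A.indicator 1 (j + 1) := by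
  rw [geomFromOne, Measure.sum_apply _ .of_discrete]
  simp [Measure.dirac_apply' _ MeasurableSet.of_discrete]

theorem geomFromOne_singleton_zero : geomFromOne p {0} = 0 := by
  rw [geomFromOne_apply]
  simp

theorem geomFromOne_singleton_succ (j : ℕ) :
    geomFromOne p {j + 1} = ENNReal.ofReal (p * (1 - p) ^ j) := by
  rw [geomFromOne_apply, tsum_eq_single j]
  · simp
  · intro i hi
    simp [hi]

theorem isProbabilityMeasure_geomFromOne (h0 : 0 < p) (h1 : p ≤ 1) :
    IsProbabilityMeasure (geomFromOne p) := by
  constructor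
  rw [geomFromOne_apply]
  simp only [Set.indicator_univ, Pi.one_apply, mul_one]
  rw [← ENNReal.ofReal_tsum_of_nonneg
    (fun j => mul_nonneg h0.le (pow_nonneg (by linarith) j))
    ((summable_geometric_of_lt_one (by linarith) (by linarith)).mul_left p), tsum_mul_left,
    tsum_geometric_of_lt_one (by linarith) (by linarith)]
  rw [sub_sub_cancel, mul_inv_cancel₀ h0.ne', ENNReal.ofReal_one]

theorem measurable_geomFromOne_singleton (j : ℕ) : Measurable fun p => geomFromOne p {j} := by
  cases j with
  | zero => simp only [geomFromOne_singleton_zero]; exact measurable_const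
  | succ j => simp only [geomFromOne_singleton_succ]; fun_prop

/-- A geometric variable is obtained by rounding up an exponential one. -/
theorem geomFromOne_eq_map (h0 : 0 < p) (h1 : p < 1) :
    geomFromOne p = (expMeasure 1).map fun x => ⌈x / (-Real.log (1 - p))⌉₊ := by
  set l := -Real.log (1 - p) with hl
  have hl0 : 0 < l := by
    rw [hl, neg_pos]
    exact Real.log_neg (by linarith) (by linarith)
  have hm : Measurable fun x : ℝ => ⌈x / l⌉₊ := Nat.measurable_ceil.comp (measurable_id.div_const l)
  refine Measure.ext_of_singleton fun j => ?_
  rw [Measure.map_apply hm (measurableSet_singleton j)]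
  cases j with
  | zero =>
    rw [geomFromOne_singleton_zero]
    have : (fun x : ℝ => ⌈x / l⌉₊) ⁻¹' {0} = Set.Iic 0 := by
      ext x
      simp [Nat.ceil_eq_zero, div_nonpos_iff, hl0.not_ge, hl0.le]
    rw [this, expMeasure_Iic le_rfl]
    simp
  | succ j =>
    rw [geomFromOne_singleton_succ]
    have : (fun x : ℝ => ⌈x / l⌉₊) ⁻¹' {j + 1} = Set.Iic ((j + 1) * l) \ Set.Iic (j * l) := by
      ext x
      simp only [Set.mem_preimage, Set.mem_singleton_iff, Nat.ceil_eq_iff (Nat.succ_ne_zero j),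
        Set.mem_sdiff, Set.mem_Iic, not_le, lt_div_iff₀ hl0, div_le_iff₀ hl0]
      push_cast
      exact and_comm
    have hexp : ∀ i : ℕ, Real.exp (-(i * l)) = (1 - p) ^ i := by
      intro i
      rw [hl, mul_neg, neg_neg, Real.exp_nat_mul, Real.exp_log (by linarith)]
    rw [this, ← ENNReal.ofReal_toReal (measure_ne_top (expMeasure 1) _)]
    congr 1
    have h2 : (j : ℝ) * l ≤ (j + 1) * l := by nlinarith
    rw [← Measure.real, measureReal_sdiff (Set.Iic_subset_Iic.2 h2) measurableSet_Iic,
      expMeasure_real_Iic (by positivity), expMeasure_real_Iic (by positivity), hexp,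
      show (-((j + 1 : ℝ) * l)) = -(((j + 1 : ℕ) : ℝ) * l) by push_cast; ring, hexp]
    ring

/-- Realising all geometric laws by rounding one exponential variable x reduces the claim to p⌈x /
(-log(1-p))⌉ → x for each x > 0, followed by dominated convergence. -/
theorem tendsto_integral_geomFromOne (f : ℝ →ᵇ ℝ) :
    Tendsto (fun p => ∫ j : ℕ, f (p * j) ∂(geomFromOne p)) (𝓝[>] 0)
      (𝓝 (∫ x, f x ∂(expMeasure 1))) := by
  have h1 : ∀ᶠ p : ℝ in 𝓝[>] 0, p < 1 :=
    eventually_nhdsWithin_of_eventually_nhds (eventually_lt_nhds one_pos)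
  have h0 : ∀ᶠ p : ℝ in 𝓝[>] 0, 0 < p := eventually_mem_nhdsWithin
  have e : ∀ᶠ p : ℝ in 𝓝[>] 0, ∫ j : ℕ, f (p * j) ∂(geomFromOne p) =
      ∫ x, f (p * ⌈x / (-Real.log (1 - p))⌉₊) ∂(expMeasure 1) := by
    filter_upwards [h0, h1] with p hp0 hp1
    rw [geomFromOne_eq_map hp0 hp1, integral_map]
    · exact (Nat.measurable_ceil.comp (measurable_id.div_const _)).aemeasurable
    · exact (measurable_of_countable _).aestronglyMeasurable
  rw [tendsto_congr' e]
  have hlog : Tendsto (fun p : ℝ => p / (-Real.log (1 - p))) (𝓝[>] 0) (𝓝 1) := by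
    have hd : HasDerivAt (fun p : ℝ => -Real.log (1 - p)) 1 0 := by
      have h2 := ((hasDerivAt_id (0 : ℝ)).const_sub 1).log (by norm_num)
      exact HasDerivAt.congr_deriv (f := fun p : ℝ => -Real.log (1 - p)) h2.neg (by simp)
    have h3 := hd.tendsto_slope_zero_right
    simp only [zero_add, sub_zero, Real.log_one, neg_zero, smul_eq_mul] at h3
    have h4 := h3.inv₀ one_ne_zero
    rw [inv_one] at h4
    refine h4.congr fun p => ?_
    rw [mul_inv, inv_inv, div_eq_mul_inv]
  refine tendsto_integral_filter_of_dominated_convergence (fun _ => ‖f‖) ?_ ?_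
    (integrable_const _) ?_
  · refine Eventually.of_forall fun p => (f.continuous.measurable.comp ?_).aestronglyMeasurable
    exact ((measurable_of_countable fun j : ℕ => (j : ℝ)).comp
      (Nat.measurable_ceil.comp (measurable_id.div_const _))).const_mul p
  · exact Eventually.of_forall fun p => ae_of_all _ fun x => f.norm_coe_le_norm _
  · have hpos : ∀ᵐ x ∂(expMeasure 1), 0 < x := by
      rw [ae_iff]
      have : {x : ℝ | ¬ 0 < x} = Set.Iic 0 := by ext; simp
      rw [this, expMeasure_Iic le_rfl]
      simp
    filter_upwards [hpos] with x hx
    refine (f.continuous.tendsto x).comp ?_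
    have hl : Tendsto (fun p : ℝ => x * (p / (-Real.log (1 - p)))) (𝓝[>] 0) (𝓝 x) := by
      simpa using hlog.const_mul x
    have hid : Tendsto (fun p : ℝ => p) (𝓝[>] 0) (𝓝 0) := tendsto_nhdsWithin_of_tendsto_nhds tendsto_id
    have hu : Tendsto (fun p : ℝ => x * (p / (-Real.log (1 - p))) + p) (𝓝[>] 0) (𝓝 x) := by
      simpa using hl.add hid
    refine tendsto_of_tendsto_of_tendsto_of_le_of_le' hl hu ?_ ?_
    · filter_upwards [h0] with p hp
      rw [show x * (p / (-Real.log (1 - p))) = p * (x / (-Real.log (1 - p))) by ring]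
      exact mul_le_mul_of_nonneg_left (Nat.le_ceil _) hp.le
    · filter_upwards [h0, h1] with p hp hp1
      have hl0 : 0 < -Real.log (1 - p) := neg_pos.2 (Real.log_neg (by linarith) (by linarith))
      have := (Nat.ceil_lt_add_one (div_pos hx hl0).le).le
      calc p * (⌈x / (-Real.log (1 - p))⌉₊ : ℝ) ≤ p * (x / (-Real.log (1 - p)) + 1) :=
            mul_le_mul_of_nonneg_left this hp.le
        _ = _ := by ring

end

/-! ### The time since the last acceptance -/

/-- When nobody has been accepted, N_0 = 0 and the empty supremum agree, so no separate convention
is needed. -/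
theorem lastGap_eq_sup (r : ℕ → ℕ) (x : ℕ → ℝ) (n : ℕ) :
    lastGap r x n = n - (acceptedSet r x n).sup id := by
  rcases (acceptedSet r x n).eq_empty_or_nonempty with he | hne
  · have : numAccepted r x n = 0 := by 
      rw [← card_acceptedValues, ← card_acceptedSet, he, Finset.card_empty]
    rw [he, lastGap, this, acceptIndex]
    simp
  · obtain ⟨m, hm, hsup⟩ := Finset.exists_mem_eq_sup _ hne id
    rw [hsup]
    exact lastGap_eq hm fun k hk => hsup ▸ Finset.le_sup (f := id) hk

/-- The distance from `n` to the last point of a Bernoulli set. -/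
theorem bernSum_last (p : ℝ) {m n : ℕ} (hmn : m ≤ n) (f : ℕ → ℝ) :
    bernSum p (Finset.Ioc m n) (fun c => if c = ∅ then 1 else f (n - c.sup id)) =
      (1 - p) ^ (n - m) + ∑ j ∈ Finset.range (n - m), p * (1 - p) ^ j * f j := by
  induction n, hmn using Nat.le_induction generalizing f with
  | base => simp [bernSum_empty]
  | succ n hn ih =>
    rw [Ioc_succ_eq_insert hn, bernSum_insert (by simp),
      bernSum_congr (g := fun c => if c = ∅ then 1 else f (n - c.sup id + 1)),
      ih fun j => f (j + 1), bernSum_congr (g := fun _ => f 0), bernSum_const,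
      Nat.succ_sub hn, Finset.sum_range_succ', mul_add, Finset.mul_sum]
    · rw [pow_succ]
      have : ∀ j, (1 - p) * (p * (1 - p) ^ j * f (j + 1)) = p * (1 - p) ^ (j + 1) * f (j + 1) :=
        fun j => by ring
      simp only [this]
      ring
    · intro c hc
      have h1 : (insert (n + 1) c).sup id = n + 1 := by
        rw [Finset.sup_insert]
        refine sup_eq_left.2 (Finset.sup_le fun k hk => ?_)
        have := Finset.mem_Ioc.1 (hc hk)
        simp only [id]
        omega
      simp [h1]
    · intro c hc
      have h1 : c.sup id ≤ n := Finset.sup_le fun k hk => (Finset.mem_Ioc.1 (hc hk)).2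
      rw [Nat.succ_sub h1]

/-- The indicator that the pair of `p` and the distance from `n` to the last element of `c` lies
in `s`; replaced by `1` if `c` has no element in the window. -/
def lastTest (s : Set (ℝ × ℕ)) (a : ℝ) (n : ℕ) (p : ℝ) (c : Finset ℕ) : ℝ :=
  if (c.filter fun k : ℕ => (n : ℝ) - a / p ≤ k) = ∅ then 1
  else s.indicator 1 (p, n - (c.filter fun k : ℕ => (n : ℝ) - a / p ≤ k).sup id)

theorem indicator_one_mem_Icc {α : Type*} (s : Set α) (x : α) :
    0 ≤ s.indicator (1 : α → ℝ) x ∧ s.indicator (1 : α → ℝ) x ≤ 1 := by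
  by_cases hx : x ∈ s <;> simp [hx]

theorem ofReal_indicator_one {α : Type*} (s : Set α) (x : α) :
    ENNReal.ofReal (s.indicator (1 : α → ℝ) x) = s.indicator (1 : α → ℝ≥0∞) x := by
  by_cases hx : x ∈ s <;> simp [hx]

theorem measurable_filter_window (a : ℝ) (n : ℕ) (c : Finset ℕ) :
    Measurable fun p : ℝ => c.filter fun k : ℕ => (n : ℝ) - a / p ≤ k := by
  rw [measurable_finset_iff]
  intro k
  simp only [Finset.mem_filter]
  have h2 : Measurable fun p : ℝ => (n : ℝ) - a / p := by fun_prop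
  exact measurableSet_setOfPred.1 ((MeasurableSet.const _).inter
    (measurableSet_le h2 measurable_const))

theorem isWindowTest_lastTest {s : Set (ℝ × ℕ)} (hs : MeasurableSet s) (a : ℝ) (n : ℕ) :
    IsWindowTest a n (lastTest s a n) := by
  refine ⟨fun c => ?_, fun p c => ?_, fun p _ c => ?_⟩
  · have h2 : Measurable fun z : Finset ℕ × ℝ =>
        if z.1 = ∅ then 1 else s.indicator (1 : ℝ × ℕ → ℝ) (z.2, n - z.1.sup id) := by
      refine measurable_from_prod_countable_right fun d => ?_
      by_cases hd : d = ∅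
      · simp [hd]
      · simp only [hd, if_false]
        exact (measurable_one.indicator hs).comp measurable_prodMk_right
    exact h2.comp ((measurable_filter_window a n c).prodMk measurable_id)
  · unfold lastTest
    split_ifs
    · simp
    · exact indicator_one_mem_Icc _ _
  · unfold lastTest
    simp only [Finset.filter_filter, and_self]

/-- If any accepted candidate lies in the window, so does the last one; otherwise the test takes the
default value 1, which keeps it an upper bound. -/
theorem indicator_lastGap_le (s : Set (ℝ × ℕ)) (a p : ℝ) (r : ℕ → ℕ) (x : ℕ → ℝ) (n : ℕ) :
    s.indicator 1 (p, lastGap r x n) ≤ lastTest s a n p (acceptedSet r x n) := by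
  unfold lastTest
  split_ifs with h
  · exact (indicator_one_mem_Icc _ _).2
  · rw [lastGap_eq_sup]
    set C := acceptedSet r x n
    set d := C.filter fun k : ℕ => (n : ℝ) - a / p ≤ k with hd
    have : C.sup id = d.sup id := by
      refine le_antisymm ?_ (Finset.sup_mono (Finset.filter_subset _ _))
      obtain ⟨i, hi⟩ := Finset.nonempty_iff_ne_empty.2 h
      have hi' := Finset.mem_filter.1 hi
      obtain ⟨m, hm, hsup⟩ := Finset.exists_mem_eq_sup C ⟨i, hi'.1⟩ id
      rw [hsup]
      refine Finset.le_sup (f := id) (Finset.mem_filter.2 ⟨hm, hi'.2.trans ?_⟩)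
      have h1 : i ≤ C.sup id := Finset.le_sup (f := id) hi'.1
      rw [hsup] at h1
      exact_mod_cast h1
    rw [this]

/-- The term e^{-a} bounds the probability of no success among at least a/p trials. The term p
arises because the distance to the last success is geometric starting at 0 instead of 1. -/
theorem ofReal_bernSum_lastTest_le (s : Set (ℝ × ℕ)) {a p : ℝ} (ha : 0 < a) {n : ℕ} (h0 : 0 < p)
    (h1 : p ≤ 1) (hn : 1 ≤ (n : ℝ) - a / p) :
    ENNReal.ofReal (bernSum p (Finset.Icc 1 n) (lastTest s a n p)) ≤
      geomFromOne p {j | (p, j) ∈ s} + ENNReal.ofReal (p + Real.exp (-a)) := by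
  have hap : 0 < a / p := by positivity
  set w := ⌈(n : ℝ) - a / p⌉₊ with hw
  have hw1 : 1 ≤ w := Nat.one_le_ceil_iff.2 (by linarith)
  have hwn : w ≤ n := Nat.ceil_le.2 (by linarith)
  have hmem : ∀ k : ℕ, k ∈ Finset.Ioc (w - 1) n ↔ k ≤ n ∧ (n : ℝ) - a / p ≤ k := by
    intro k
    rw [Finset.mem_Ioc, ← Nat.ceil_le, ← hw, and_comm]
    exact and_congr_right fun _ => by omega
  have hsub : Finset.Ioc (w - 1) n ⊆ Finset.Icc 1 n := by
    intro k hk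
    rw [Finset.mem_Ioc] at hk
    rw [Finset.mem_Icc]
    omega
  set f : ℕ → ℝ := fun j => s.indicator 1 (p, j) with hf
  have hf01 : ∀ j, 0 ≤ f j ∧ f j ≤ 1 := fun j => indicator_one_mem_Icc _ _
  have e1 : bernSum p (Finset.Icc 1 n) (lastTest s a n p) =
      bernSum p (Finset.Ioc (w - 1) n) fun c => if c = ∅ then 1 else f (n - c.sup id) := by
    rw [bernSum_of_inter hsub]
    · refine bernSum_congr fun c hc => ?_
      unfold lastTest
      rw [Finset.filter_true_of_mem fun k hk => ((hmem k).1 (hc hk)).2]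
    · intro c hc
      unfold lastTest
      have : ((c ∩ Finset.Ioc (w - 1) n).filter fun k : ℕ => (n : ℝ) - a / p ≤ k) =
          c.filter fun k : ℕ => (n : ℝ) - a / p ≤ k := by
        ext k
        simp only [Finset.mem_filter, Finset.mem_inter, hmem]
        constructor
        · rintro ⟨⟨h2, -⟩, h3⟩
          exact ⟨h2, h3⟩
        · rintro ⟨h2, h3⟩
          exact ⟨⟨h2, (Finset.mem_Icc.1 (hc h2)).2, h3⟩, h3⟩
      rw [this]
  rw [e1, bernSum_last p (by omega)]
  set M := n - (w - 1) with hM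
  have hMa : a / p ≤ M := by
    have h2 := Nat.ceil_lt_add_one (by linarith : (0 : ℝ) ≤ (n : ℝ) - a / p)
    rw [← hw] at h2
    rw [hM, Nat.cast_sub (by omega), Nat.cast_sub hw1]
    push_cast
    linarith
  have hpow : (1 - p) ^ M ≤ Real.exp (-a) := by
    have h2 : 1 - p ≤ Real.exp (-p) := by linarith [Real.add_one_le_exp (-p)]
    calc (1 - p) ^ M ≤ Real.exp (-p) ^ M := pow_le_pow_left₀ (by linarith) h2 M
      _ = Real.exp (-(M * p)) := by rw [← Real.exp_nat_mul]; congr 1; ring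
      _ ≤ Real.exp (-a) := by
        rw [div_le_iff₀ h0] at hMa
        exact Real.exp_le_exp.2 (by linarith)
  have hterm : ∀ i, 0 ≤ p * (1 - p) ^ i * f (i + 1) := fun i =>
    mul_nonneg (mul_nonneg h0.le (pow_nonneg (by linarith) i)) (hf01 _).1
  -- The term j = 0 costs at most p; after the index shift, the remaining ones only decrease by a
  -- factor 1 - p.
  have hsum : ∑ j ∈ Finset.range M, p * (1 - p) ^ j * f j ≤
      p + ∑ i ∈ Finset.range M, p * (1 - p) ^ i * f (i + 1) := by
    obtain ⟨m, hm⟩ : ∃ m, M = m + 1 := ⟨M - 1, by omega⟩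
    rw [hm, Finset.sum_range_succ', Finset.sum_range_succ, add_comm]
    have h2 : ∑ i ∈ Finset.range m, p * (1 - p) ^ (i + 1) * f (i + 1) ≤
        ∑ i ∈ Finset.range m, p * (1 - p) ^ i * f (i + 1) := by
      refine Finset.sum_le_sum fun i _ => ?_
      have h3 := hterm i
      rw [pow_succ]
      nlinarith
    have h4 := hterm m
    have h5 := (hf01 0).2
    nlinarith
  have hgeom : ENNReal.ofReal (∑ i ∈ Finset.range M, p * (1 - p) ^ i * f (i + 1)) ≤
      geomFromOne p {j | (p, j) ∈ s} := by
    rw [ENNReal.ofReal_sum_of_nonneg fun i _ => hterm i, geomFromOne_apply]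
    refine le_trans (le_of_eq (Finset.sum_congr rfl fun i _ => ?_)) (ENNReal.sum_le_tsum _)
    rw [ENNReal.ofReal_mul (mul_nonneg h0.le (pow_nonneg (by linarith) i))]
    congr 1
    exact ofReal_indicator_one s (p, i + 1)
  calc _ ≤ ENNReal.ofReal (∑ i ∈ Finset.range M, p * (1 - p) ^ i * f (i + 1) +
        (p + Real.exp (-a))) := ENNReal.ofReal_le_ofReal (by linarith)
    _ ≤ _ := ENNReal.ofReal_add_le.trans (by gcongr)

section

variable {Ω : Type*} [mΩ : MeasurableSpace Ω] {P : Measure Ω} [IsProbabilityMeasure P]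
  {X : Ω → ℕ → ℝ} {r : ℕ → ℕ}

theorem IsExpSequence.measurable_lastGap (h : IsExpSequence P X) (hr : IsRankSequence r) (n : ℕ) :
    Measurable fun ω => lastGap r (X ω) n := by
  simp only [lastGap_eq_sup]
  exact (measurable_of_countable fun c : Finset ℕ => n - c.sup id).comp
    (h.measurable_acceptedSet hr n)

theorem IsExpSequence.tendsto_lintegral_acceptProb (h : IsExpSequence P X) (hr : IsRankSequence r)
    (hdiv : Tendsto (fun m : ℕ => ∑ k ∈ Finset.Icc 1 m, delta r k / (r k : ℝ)) atTop atTop) :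
    Tendsto (fun n => ∫⁻ ω, ENNReal.ofReal (acceptProb r (X ω) n) ∂P) atTop (𝓝 0) := by
  have := tendsto_lintegral_of_dominated_convergence (μ := P) (fun _ => 1)
    (F := fun n ω => ENNReal.ofReal (acceptProb r (X ω) n)) (f := fun _ => 0)
    (fun n => (h.measurable_acceptProb hr n).ennreal_ofReal)
    (fun n => ae_of_all _ fun ω => by
      rw [← ENNReal.ofReal_one]
      exact ENNReal.ofReal_le_ofReal (acceptProb_le_one hr _ _)) (by simp) (by
      filter_upwards [h.ae_tendsto_acceptProb hr hdiv] with ω hω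
      simpa using ENNReal.tendsto_ofReal hω)
  simpa using this

/-- A measurable bound for the total variation distance between the conditional law of the time
since the last acceptance and the geometric law. -/
theorem IsExpSequence.exists_dTV_le (h : IsExpSequence P X) (hr : IsRankSequence r)
    {a η : ℝ} (ha : 0 < a) {n : ℕ} (hc : WindowComparison P X r a η n) :
    ∃ D : Ω → ℝ≥0∞, Measurable D ∧
      (∀ ω, ENNReal.ofReal (dTV (condDistrib (fun ω' => lastGap r (X ω') n)
        (fun ω' => acceptProb r (X ω') n) P (acceptProb r (X ω) n))
        (geomFromOne (acceptProb r (X ω) n))) ≤ D ω) ∧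
      ∫⁻ ω, D ω ∂P ≤ ∫⁻ ω, ENNReal.ofReal (acceptProb r (X ω) n) ∂P +
        ENNReal.ofReal (Real.exp (-a)) + 2 * ENNReal.ofReal η := by
  set Z : Ω → ℝ := fun ω => acceptProb r (X ω) n with hZ
  set V : Ω → ℕ := fun ω => lastGap r (X ω) n with hV
  have hZm : Measurable Z := h.measurable_acceptProb hr n
  have hVm : Measurable V := h.measurable_lastGap hr n
  have hZ0 : ∀ ω, 0 < Z ω := fun ω => acceptProb_pos _ _
  have hZ1 : ∀ ω, Z ω ≤ 1 := fun ω => acceptProb_le_one hr _ _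
  set κ := condDistrib V Z P with hκ
  -- For each p the section of `s` attains the total variation distance, so a single window test
  -- controls its mean over P_n. The one-sided comparison suffices for this reason.
  set s : Set (ℝ × ℕ) := {z | geomFromOne z.1 {z.2} < κ z.1 {z.2}} with hs
  have hsm : MeasurableSet s := measurableSet_lt
    (measurable_from_prod_countable_left fun j => measurable_geomFromOne_singleton j)
    (measurable_from_prod_countable_left fun j =>
      show Measurable fun p => κ p {j} from Kernel.measurable_coe κ .of_discrete)
  have hprob := fun ω => isProbabilityMeasure_geomFromOne (hZ0 ω) (hZ1 ω)
  have hpt : ∀ ω, ENNReal.ofReal (dTV (κ (Z ω)) (geomFromOne (Z ω))) +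
      geomFromOne (Z ω) {j | (Z ω, j) ∈ s} ≤ κ (Z ω) {j | (Z ω, j) ∈ s} := by
    intro ω
    have := hprob ω
    have h1 := dTV_le_of_singleton (μ := κ (Z ω)) (ν := geomFromOne (Z ω))
    have h2 := dTV_nonneg (μ := κ (Z ω)) (ν := geomFromOne (Z ω))
    change ENNReal.ofReal _ + geomFromOne (Z ω) {j | geomFromOne (Z ω) {j} < κ (Z ω) {j}} ≤
      κ (Z ω) {j | geomFromOne (Z ω) {j} < κ (Z ω) {j}}
    rw [← ENNReal.ofReal_toReal (measure_ne_top (geomFromOne (Z ω)) _),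
      ← ENNReal.ofReal_toReal (measure_ne_top (κ (Z ω)) _),
      ← ENNReal.ofReal_add h2 ENNReal.toReal_nonneg]
    apply ENNReal.ofReal_le_ofReal
    simp only [Measure.real] at h1
    linarith
  set G : Ω → ℝ≥0∞ := fun ω => geomFromOne (Z ω) {j | (Z ω, j) ∈ s} with hG
  set K : Ω → ℝ≥0∞ := fun ω => κ (Z ω) {j | (Z ω, j) ∈ s} with hK
  have hKm : Measurable K := (Kernel.measurable_kernel_prodMk_left hsm).comp hZm
  have hGm : Measurable G := by
    simp only [hG, geomFromOne_apply]
    refine Measurable.tsum fun j => Measurable.mul (by fun_prop) ?_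
    exact (measurable_one.indicator hsm).comp (hZm.prodMk (measurable_const (a := j + 1)))
  have hGK : ∀ ω, G ω ≤ K ω := fun ω => le_trans le_add_self (hpt ω)
  have hGfin : ∀ ω, G ω ≠ ∞ := fun ω => by
    have := hprob ω
    exact measure_ne_top _ _
  refine ⟨fun ω => K ω - G ω, hKm.sub hGm,
    fun ω => ENNReal.le_sub_of_add_le_right (hGfin ω) (hpt ω), ?_⟩
  have hlaw : ∫⁻ ω, κ (Z ω) {j | (Z ω, j) ∈ s} ∂P =
      ∫⁻ ω, ENNReal.ofReal (s.indicator 1 (Z ω, V ω)) ∂P := by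
    have h1 : ∫⁻ ω, κ (Z ω) {j | (Z ω, j) ∈ s} ∂P = (P.map Z ⊗ₘ κ) s := by
      rw [Measure.compProd_apply hsm,
        lintegral_map (Kernel.measurable_kernel_prodMk_left hsm) hZm]
      rfl
    rw [h1, hκ, compProd_map_condDistrib hVm.aemeasurable, Measure.map_apply (hZm.prodMk hVm) hsm,
      ← lintegral_indicator_one ((hZm.prodMk hVm) hsm)]
    refine lintegral_congr fun ω => ?_
    exact (ofReal_indicator_one s (Z ω, V ω)).symm
  have hbadm : MeasurableSet {ω | (n : ℝ) - a / Z ω < 1} :=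
    measurableSet_lt (by fun_prop) measurable_const
  set bad : Ω → ℝ≥0∞ := {ω | (n : ℝ) - a / Z ω < 1}.indicator fun _ => 1 with hbad
  have hbadmm : Measurable bad := measurable_const.indicator hbadm
  have hbern : ∀ ω, ENNReal.ofReal (bernSum (Z ω) (Finset.Icc 1 n) (lastTest s a n (Z ω))) ≤
      geomFromOne (Z ω) {j | (Z ω, j) ∈ s} + ENNReal.ofReal (Z ω + Real.exp (-a)) + bad ω := by
    intro ω
    by_cases hω : (n : ℝ) - a / Z ω < 1
    · have : bad ω = 1 := by simp only [hbad, Set.indicator_apply, Set.mem_ofPred_eq, hω, if_true]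
      rw [this]
      refine le_add_left ?_
      rw [← ENNReal.ofReal_one]
      exact ENNReal.ofReal_le_ofReal (bernSum_mem_Icc (hZ0 ω).le (hZ1 ω) _
        ((isWindowTest_lastTest hsm a n).mem_Icc _)).2
    · exact le_add_right (ofReal_bernSum_lastTest_le s ha (hZ0 ω) (hZ1 ω) (not_lt.1 hω))
  have hfin : ∫⁻ ω, geomFromOne (Z ω) {j | (Z ω, j) ∈ s} ∂P ≠ ∞ := by
    refine ne_of_lt (lt_of_le_of_lt (lintegral_mono (g := fun _ => 1) fun ω => ?_) (by simp))
    have := hprob ω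
    exact prob_le_one
  have hsplit : ∫⁻ ω, ENNReal.ofReal (Z ω + Real.exp (-a)) ∂P ≤
      ∫⁻ ω, ENNReal.ofReal (Z ω) ∂P + ENNReal.ofReal (Real.exp (-a)) := by
    refine (lintegral_mono fun ω => ENNReal.ofReal_add_le).trans ?_
    rw [lintegral_add_right _ measurable_const]
    simp
  refine ENNReal.le_of_add_le_add_right hfin ?_
  calc ∫⁻ ω, (K ω - G ω) ∂P + ∫⁻ ω, G ω ∂P = ∫⁻ ω, K ω ∂P := by
        rw [← lintegral_add_right _ hGm]
        exact lintegral_congr fun ω => tsub_add_cancel_of_le (hGK ω)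
    _ ≤ ∫⁻ ω, ENNReal.ofReal (lastTest s a n (Z ω) (acceptedSet r (X ω) n)) ∂P := by
        rw [hlaw]
        exact lintegral_mono fun ω => ENNReal.ofReal_le_ofReal (indicator_lastGap_le s a _ r _ n)
    _ ≤ ∫⁻ ω, ENNReal.ofReal (bernSum (Z ω) (Finset.Icc 1 n) (lastTest s a n (Z ω))) ∂P +
        ENNReal.ofReal η := hc.lintegral_le _ (isWindowTest_lastTest hsm a n)
    _ ≤ ∫⁻ ω, (geomFromOne (Z ω) {j | (Z ω, j) ∈ s} + ENNReal.ofReal (Z ω + Real.exp (-a)) +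
        bad ω) ∂P + ENNReal.ofReal η := by gcongr with ω; exact hbern ω
    _ = ∫⁻ ω, geomFromOne (Z ω) {j | (Z ω, j) ∈ s} ∂P +
        ∫⁻ ω, ENNReal.ofReal (Z ω + Real.exp (-a)) ∂P + P {ω | (n : ℝ) - a / Z ω < 1} +
        ENNReal.ofReal η := by
        rw [lintegral_add_right _ hbadmm,
          lintegral_add_right _ (hZm.add_const _).ennreal_ofReal, hbad,
          lintegral_indicator_const hbadm, one_mul]
    _ ≤ ∫⁻ ω, geomFromOne (Z ω) {j | (Z ω, j) ∈ s} ∂P +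
        (∫⁻ ω, ENNReal.ofReal (Z ω) ∂P + ENNReal.ofReal (Real.exp (-a))) + ENNReal.ofReal η +
        ENNReal.ofReal η := by
        gcongr
        exact hc.measure_le
    _ = _ := by ring

theorem IsExpSequence.tendstoInMeasure_dTV (h : IsExpSequence P X) (hr : IsRankSequence r)
    (hdiv : Tendsto (fun m : ℕ => ∑ k ∈ Finset.Icc 1 m, delta r k / (r k : ℝ)) atTop atTop)
    (hr_top : Tendsto r atTop atTop) :
    TendstoInMeasure P (fun n ω => dTV (condDistrib (fun ω' => lastGap r (X ω') n)
      (fun ω' => acceptProb r (X ω') n) P (acceptProb r (X ω) n))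
      (geomFromOne (acceptProb r (X ω) n))) atTop (fun _ => 0) := by
  set D : ℕ → Ω → ℝ := fun n ω => dTV (condDistrib (fun ω' => lastGap r (X ω') n)
      (fun ω' => acceptProb r (X ω') n) P (acceptProb r (X ω) n))
      (geomFromOne (acceptProb r (X ω) n)) with hD
  rw [tendstoInMeasure_iff_norm]
  intro ε hε
  refine ENNReal.tendsto_nhds_zero.2 fun δ hδ => ?_
  obtain ⟨η, hη, hηδ⟩ : ∃ η : ℝ, 0 < η ∧ ENNReal.ofReal (4 * η / ε) ≤ δ := by
    rcases eq_or_ne δ ∞ with rfl | hδt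
    · exact ⟨1, one_pos, le_top⟩
    · have := ENNReal.toReal_pos hδ.ne' hδt
      refine ⟨δ.toReal * ε / 4, by positivity, le_of_eq ?_⟩
      rw [mul_div_cancel₀ _ (by norm_num), mul_div_cancel_right₀ _ hε.ne',
        ENNReal.ofReal_toReal hδt]
  -- With a = 1/η one has e^{-a} ≤ η, so all four error terms are at most η and Markov's inequality
  -- concludes.
  have ha : 0 < 1 / η := by positivity
  have hexp : Real.exp (-(1 / η)) ≤ η := by
    rw [Real.exp_neg]
    refine inv_le_of_inv_le₀ hη ?_
    rw [← one_div]
    linarith [Real.add_one_le_exp (1 / η)]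
  filter_upwards [h.eventually_windowComparison hr hdiv hr_top ha hη,
    (h.tendsto_lintegral_acceptProb hr hdiv).eventually
      (ge_mem_nhds (ENNReal.ofReal_pos.2 hη))] with n hn1 hn2
  obtain ⟨E, hEm, hDE, hE⟩ := h.exists_dTV_le hr ha hn1
  have hsum : ∫⁻ ω, E ω ∂P ≤ ENNReal.ofReal (4 * η) := by
    refine hE.trans ?_
    calc _ ≤ ENNReal.ofReal η + ENNReal.ofReal η + 2 * ENNReal.ofReal η := by gcongr
      _ = ENNReal.ofReal (4 * η) := by
        rw [← ENNReal.ofReal_ofNat, ← ENNReal.ofReal_mul (by norm_num),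
          ← ENNReal.ofReal_add hη.le hη.le, ← ENNReal.ofReal_add (by positivity) (by positivity)]
        congr 1
        ring
  calc P {ω | ε ≤ ‖D n ω - 0‖} ≤ P {ω | ENNReal.ofReal ε ≤ E ω} := by
        refine measure_mono fun ω hω => ?_
        simp only [Set.mem_ofPred_eq, sub_zero, Real.norm_eq_abs,
          abs_of_nonneg (show 0 ≤ D n ω from dTV_nonneg)] at hω ⊢
        exact (ENNReal.ofReal_le_ofReal hω).trans (hDE ω)
    _ ≤ (∫⁻ ω, E ω ∂P) / ENNReal.ofReal ε :=
        meas_ge_le_lintegral_div hEm.aemeasurable (by simpa using hε) (by simp)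
    _ ≤ ENNReal.ofReal (4 * η) / ENNReal.ofReal ε := by gcongr
    _ = ENNReal.ofReal (4 * η / ε) := (ENNReal.ofReal_div_of_pos hε).symm
    _ ≤ δ := hηδ

end

/-! ### From the geometric approximation to the exponential limit. -/

section

variable {Ω : Type*} [mΩ : MeasurableSpace Ω] {P : Measure Ω} [IsProbabilityMeasure P]
  {X : Ω → ℕ → ℝ} {r : ℕ → ℕ}

/-- Both sides are versions of the conditional expectation of f(ZV) given Z. -/
theorem integral_condDistrib_mul_natCast {Z : Ω → ℝ} {V : Ω → ℕ} (hZ : Measurable Z)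
    (hV : Measurable V) (f : ℝ →ᵇ ℝ) :
    (fun ω => ∫ v, f v ∂(condDistrib (fun ω' => Z ω' * (V ω' : ℝ)) Z P (Z ω))) =ᵐ[P]
      fun ω => ∫ j : ℕ, f (Z ω * j) ∂(condDistrib V Z P (Z ω)) := by
  have hW : Measurable fun ω' => Z ω' * (V ω' : ℝ) :=
    hZ.mul ((measurable_of_countable fun j : ℕ => (j : ℝ)).comp hV)
  have hfi : Integrable (fun ω => f (Z ω * (V ω : ℝ))) P :=
    Integrable.of_bound (f.continuous.measurable.comp hW).aestronglyMeasurable ‖f‖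
      (ae_of_all _ fun ω => f.norm_coe_le_norm _)
  have h1 := condExp_ae_eq_integral_condDistrib hZ hW.aemeasurable
    f.continuous.stronglyMeasurable hfi
  have hg : Measurable fun z : ℝ × ℕ => f (z.1 * (z.2 : ℝ)) :=
    f.continuous.measurable.comp (measurable_fst.mul
      ((measurable_of_countable fun j : ℕ => (j : ℝ)).comp measurable_snd))
  have h2 := condExp_prod_ae_eq_integral_condDistrib (μ := P) hZ hV.aemeasurable
    (f := fun z : ℝ × ℕ => f (z.1 * (z.2 : ℝ))) hg.stronglyMeasurable hfi
  exact h1.symm.trans h2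

/-- The rescaled time since the last acceptance is asymptotically exponential. -/
theorem IsExpSequence.condTendstoInDistribution (h : IsExpSequence P X) (hr : IsRankSequence r)
    (hdiv : Tendsto (fun m : ℕ => ∑ k ∈ Finset.Icc 1 m, delta r k / (r k : ℝ)) atTop atTop)
    (hr_top : Tendsto r atTop atTop) :
    CondTendstoInDistribution P
      (fun n ω => acceptProb r (X ω) n * (lastGap r (X ω) n : ℝ))
      (fun n ω => acceptProb r (X ω) n) (expMeasure 1) := by
  intro f
  have hdTV := (tendstoInMeasure_iff_norm.1 (h.tendstoInMeasure_dTV hr hdiv hr_top))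
  have hPn := tendstoInMeasure_iff_norm.1 (tendstoInMeasure_of_tendsto_ae
    (fun n => (h.measurable_acceptProb hr n).aestronglyMeasurable)
    (h.ae_tendsto_acceptProb hr hdiv))
  rw [tendstoInMeasure_iff_norm]
  intro ε hε
  have hlim := tendsto_integral_geomFromOne f
  obtain ⟨δ, hδ, hδf⟩ : ∃ δ > 0, ∀ p, 0 < p → p < δ →
      |∫ j : ℕ, f (p * j) ∂(geomFromOne p) - ∫ x, f x ∂(expMeasure 1)| < ε / 2 := by
    have h1 := (Metric.tendsto_nhds.1 hlim) (ε / 2) (by positivity)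
    rw [eventually_nhdsWithin_iff, Metric.eventually_nhds_iff] at h1
    obtain ⟨δ, hδ, h2⟩ := h1
    refine ⟨δ, hδ, fun p hp0 hp => ?_⟩
    have := h2 (y := p) (by rw [Real.dist_eq, sub_zero, abs_of_pos hp0]; exact hp) hp0
    rwa [Real.dist_eq] at this
  -- A total variation distance below θ changes the integral of f by at most ε/2; the summand 1
  -- protects against f = 0.
  set θ := ε / (4 * (‖f‖ + 1)) with hθ
  have hf0 : 0 ≤ ‖f‖ := norm_nonneg f
  have hθ0 : 0 < θ := by positivity
  have hsum := (hdTV θ hθ0).add (hPn δ hδ)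
  rw [add_zero] at hsum
  refine tendsto_of_tendsto_of_tendsto_of_le_of_le tendsto_const_nhds hsum (fun _ => zero_le) ?_
  intro n
  refine (measure_mono_ae ?_).trans (measure_union_le _ _)
  filter_upwards [integral_condDistrib_mul_natCast (h.measurable_acceptProb hr n)
    (h.measurable_lastGap hr n) f] with ω hω hmem
  by_contra hcon
  have hcon' : ω ∉ ({ω | θ ≤ _} ∪ {ω | δ ≤ _} : Set Ω) := hcon
  simp only [Set.mem_union, Set.mem_ofPred_eq, not_or, not_le, sub_zero, Real.norm_eq_abs] at hcon'
  have hmem' : ε ≤ _ := hmem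
  rw [hω, Real.norm_eq_abs] at hmem'
  set p := acceptProb r (X ω) n with hp
  have hp0 : 0 < p := acceptProb_pos _ _
  have hp1 : p ≤ 1 := acceptProb_le_one hr _ _
  have hprob := isProbabilityMeasure_geomFromOne hp0 hp1
  set κ := condDistrib (fun ω' => lastGap r (X ω') n) (fun ω' => acceptProb r (X ω') n) P p with hκ
  have h1 := abs_integral_sub_le_dTV (μ := κ) (ν := geomFromOne p) (f := fun j => f (p * j))
    (C := ‖f‖) fun j => f.norm_coe_le_norm _
  have h2 := hδf p hp0 (by rw [abs_of_pos hp0] at hcon'; exact hcon'.2)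
  have h3 : dTV κ (geomFromOne p) < θ := (le_abs_self _).trans_lt hcon'.1
  have h4 : 2 * ‖f‖ * dTV κ (geomFromOne p) ≤ ε / 2 := by
    calc 2 * ‖f‖ * dTV κ (geomFromOne p) ≤ 2 * (‖f‖ + 1) * θ := by
          refine mul_le_mul (by linarith) h3.le dTV_nonneg (by positivity)
      _ = ε / 2 := by rw [hθ]; field_simp; norm_num
  have h5 := abs_sub_le (∫ j : ℕ, f (p * j) ∂κ) (∫ j : ℕ, f (p * j) ∂(geomFromOne p))
    (∫ x, f x ∂(expMeasure 1))
  linarith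

end

/-! ### Maximal coupling on a countable type -/

section

variable {α : Type*} {k b : α → ℝ≥0∞}

/-- The probability with which a value drawn from `k` is kept. -/
def keepWeight (k b : α → ℝ≥0∞) (x : α) : ℝ≥0∞ := if k x ≤ b x then 1 else b x / k x

open scoped Classical in
/-- The transition probabilities of the maximal coupling of `k` and `b`. -/
def couplingWeight (k b : α → ℝ≥0∞) (x y : α) : ℝ≥0∞ :=
  (if x = y then keepWeight k b x else 0) +
    (1 - keepWeight k b x) * ((b y - k y) / ∑' z, (b z - k z))

theorem keepWeight_le_one (x : α) : keepWeight k b x ≤ 1 := by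
  unfold keepWeight
  split_ifs with h
  · exact le_rfl
  · exact ENNReal.div_le_of_le_mul (by rw [one_mul]; exact (not_le.1 h).le)

theorem mul_keepWeight (hk : ∀ x, k x ≠ ∞) (x : α) :
    k x * keepWeight k b x = min (k x) (b x) := by
  unfold keepWeight
  split_ifs with h
  · rw [mul_one, min_eq_left h]
  · rw [ENNReal.mul_div_cancel (ne_of_gt (lt_of_le_of_lt zero_le (not_le.1 h))) (hk x),
      min_eq_right (not_le.1 h).le]

theorem mul_one_sub_keepWeight (hk : ∀ x, k x ≠ ∞) (x : α) :
    k x * (1 - keepWeight k b x) = k x - b x := by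
  rw [ENNReal.mul_sub fun _ _ => hk x, mul_one, mul_keepWeight hk, tsub_min]

theorem keepWeight_le_couplingWeight (x : α) : keepWeight k b x ≤ couplingWeight k b x x := by
  unfold couplingWeight
  rw [if_pos rfl]
  exact le_self_add

theorem ne_top_of_tsum_eq_one (hk : ∑' x, k x = 1) (x : α) : k x ≠ ∞ :=
  ne_top_of_le_ne_top (by rw [hk]; exact ENNReal.one_ne_top) (ENNReal.le_tsum x)

theorem tsum_tsub_add_tsum_min : ∑' x, (k x - b x) + ∑' x, min (k x) (b x) = ∑' x, k x := by
  rw [← ENNReal.tsum_add]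
  refine tsum_congr fun x => ?_
  rw [← tsub_min, tsub_add_cancel_of_le (min_le_left _ _)]

/-- Both sums complement the common part, the sum of min(k, b), to total mass 1. Thus the mass
released by `k` is exactly the deficit of `b`. -/
theorem tsum_tsub_comm (hk : ∑' x, k x = 1) (hb : ∑' x, b x = 1) :
    ∑' x, (k x - b x) = ∑' x, (b x - k x) := by
  have h1 := tsum_tsub_add_tsum_min (k := k) (b := b)
  have h2 := tsum_tsub_add_tsum_min (k := b) (b := k)
  simp only [min_comm (b _) (k _)] at h2
  rw [hk, ← hb, ← h2] at h1
  refine (ENNReal.add_left_inj (ne_top_of_le_ne_top ENNReal.one_ne_top ?_)).1 h1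
  rw [← hk]
  exact ENNReal.tsum_le_tsum fun x => min_le_left _ _

theorem tsum_tsub_ne_top (hb : ∑' x, b x = 1) : ∑' x, (b x - k x) ≠ ∞ :=
  ne_top_of_le_ne_top ENNReal.one_ne_top (hb ▸ ENNReal.tsum_le_tsum fun _ => tsub_le_self)

theorem tsum_couplingWeight_right (hk : ∑' x, k x = 1) (hb : ∑' x, b x = 1) (x : α) :
    ∑' y, couplingWeight k b x y = 1 := by
  classical
  unfold couplingWeight
  rw [ENNReal.tsum_add, tsum_eq_single x fun y hy => if_neg hy.symm, if_pos rfl,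
    ENNReal.tsum_mul_left]
  simp only [div_eq_mul_inv]
  rw [ENNReal.tsum_mul_right]
  set D := ∑' z, (b z - k z) with hD
  -- If D = 0, nothing is ever released: every value is kept with probability 1, so the degenerate
  -- quotient is harmless.
  rcases eq_or_ne D 0 with h0 | h0
  · have h1 : k x ≤ b x := by
      rw [← tsum_tsub_comm hk hb] at hD
      exact tsub_eq_zero_iff_le.1 (ENNReal.tsum_eq_zero.1 (hD.symm.trans h0) x)
    have h2 : keepWeight k b x = 1 := by unfold keepWeight; rw [if_pos h1]
    rw [h2, tsub_self, zero_mul, add_zero]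
  · rw [ENNReal.mul_inv_cancel h0 (tsum_tsub_ne_top hb), mul_one,
      add_tsub_cancel_of_le (keepWeight_le_one x)]

/-- The value y receives min(k, b) from values kept in place and b - k from the redistributed mass,
together b. -/
theorem tsum_mul_couplingWeight (hk : ∑' x, k x = 1) (hb : ∑' x, b x = 1) (y : α) :
    ∑' x, k x * couplingWeight k b x y = b y := by
  classical
  have hkt := ne_top_of_tsum_eq_one hk
  unfold couplingWeight
  simp only [mul_add, mul_ite, mul_zero, mul_keepWeight hkt, ← mul_assoc,
    mul_one_sub_keepWeight hkt]
  rw [ENNReal.tsum_add, tsum_eq_single y fun x hx => if_neg hx, if_pos rfl,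
    ENNReal.tsum_mul_right, tsum_tsub_comm hk hb]
  set D := ∑' z, (b z - k z) with hD
  have h1 : D * ((b y - k y) / D) = b y - k y := by
    rcases eq_or_ne D 0 with h0 | h0
    · have := (ENNReal.tsum_eq_zero.1 (hD.symm.trans h0)) y
      rw [h0, this, zero_mul]
    · exact ENNReal.mul_div_cancel h0 (tsum_tsub_ne_top hb)
  rw [h1, add_comm, min_comm, ← tsub_min, tsub_add_cancel_of_le (min_le_left _ _)]

theorem tsum_mul_one_sub_couplingWeight_le (hk : ∑' x, k x = 1) :
    ∑' x, k x * (1 - couplingWeight k b x x) ≤ ∑' x, (k x - b x) := by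
  refine ENNReal.tsum_le_tsum fun x => ?_
  rw [← mul_one_sub_keepWeight (ne_top_of_tsum_eq_one hk)]
  gcongr
  exact keepWeight_le_couplingWeight x

theorem measurable_couplingWeight {β : Type*} [MeasurableSpace β] [Countable α]
    {k b : β → α → ℝ≥0∞} (hk : ∀ x, Measurable fun p => k p x)
    (hb : ∀ x, Measurable fun p => b p x) (x y : α) :
    Measurable fun p => couplingWeight (k p) (b p) x y := by
  have h1 : Measurable fun p => keepWeight (k p) (b p) x := by
    unfold keepWeight
    exact Measurable.ite (measurableSet_le (hk x) (hb x)) measurable_const ((hb x).div (hk x))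
  unfold couplingWeight
  refine Measurable.add ?_ ((measurable_const.sub h1).mul (((hb y).sub (hk y)).div
    (Measurable.tsum fun z => (hb z).sub (hk z))))
  split_ifs
  · exact h1
  · exact measurable_const

end

/-! ### Adding a discrete random variable with given conditional weights -/

section

variable {Ω α : Type*} [MeasurableSpace Ω] [MeasurableSpace α] [Countable α]
  [MeasurableSingletonClass α]

/-- The joint law of `ω` and a variable which takes the value `y` with probability `w ω y`. -/
def extendMeasure (P : Measure Ω) (w : Ω → α → ℝ≥0∞) : Measure (Ω × α) :=
  Measure.sum fun y => (P.withDensity fun ω => w ω y).map fun ω => (ω, y)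

theorem lintegral_extendMeasure (P : Measure Ω) {w : Ω → α → ℝ≥0∞}
    (hw : ∀ y, Measurable fun ω => w ω y) {g : Ω × α → ℝ≥0∞} (hg : Measurable g) :
    ∫⁻ z, g z ∂(extendMeasure P w) = ∫⁻ ω, ∑' y, w ω y * g (ω, y) ∂P := by
  rw [extendMeasure, lintegral_sum_measure,
    lintegral_tsum (f := fun y ω => w ω y * g (ω, y)) fun y => ((hw y).mul (hg.comp measurable_prodMk_right)).aemeasurable]
  refine tsum_congr fun y => ?_
  rw [lintegral_map hg measurable_prodMk_right]
  exact lintegral_withDensity_eq_lintegral_mul _ (hw y) (hg.comp measurable_prodMk_right)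

theorem extendMeasure_map_fst (P : Measure Ω) {w : Ω → α → ℝ≥0∞}
    (hw : ∀ y, Measurable fun ω => w ω y) (hw1 : ∀ ω, ∑' y, w ω y = 1) :
    (extendMeasure P w).map Prod.fst = P := by
  ext A hA
  rw [Measure.map_apply measurable_fst hA, ← lintegral_indicator_one (measurable_fst hA),
    lintegral_extendMeasure P hw (measurable_one.indicator (measurable_fst hA)),
    ← lintegral_indicator_one hA]
  refine lintegral_congr fun ω => ?_
  have : ∀ y : α, (Prod.fst ⁻¹' A).indicator (1 : Ω × α → ℝ≥0∞) (ω, y) =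
      A.indicator (1 : Ω → ℝ≥0∞) ω := fun y => rfl
  simp only [this]
  rw [ENNReal.tsum_mul_right, hw1, one_mul]

end

/-- A joint integral, in terms of the conditional law of a discrete variable. -/
theorem lintegral_condDistrib_tsum {Ω α : Type*} [MeasurableSpace Ω] {P : Measure Ω}
    [IsProbabilityMeasure P] [MeasurableSpace α] [Countable α] [MeasurableSingletonClass α]
    [StandardBorelSpace α] [Nonempty α] {Z : Ω → ℝ} {V : Ω → α} (hZ : Measurable Z)
    (hV : Measurable V) {g : ℝ × α → ℝ≥0∞} (hg : Measurable g) :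
    ∫⁻ ω, g (Z ω, V ω) ∂P = ∫⁻ ω, ∑' x, condDistrib V Z P (Z ω) {x} * g (Z ω, x) ∂P := by
  have h1 : ∫⁻ ω, g (Z ω, V ω) ∂P = ∫⁻ z, g z ∂(P.map fun ω => (Z ω, V ω)) :=
    (lintegral_map hg (hZ.prodMk hV)).symm
  rw [h1, ← compProd_map_condDistrib hV.aemeasurable, Measure.lintegral_compProd hg,
    lintegral_map (Measurable.lintegral_kernel_prod_right' hg) hZ]
  refine lintegral_congr fun ω => ?_
  rw [lintegral_countable']
  exact tsum_congr fun x => mul_comm _ _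

/-! ### Bernoulli patterns on the window -/

/-- The window of length `a / p` before `n`. -/
def windowSet (a : ℝ) (n : ℕ) (p : ℝ) : Finset ℕ :=
  (Finset.Icc 1 n).filter fun k : ℕ => (n : ℝ) - a / p ≤ k

/-- The law of the set of successes among independent trials in the window. -/
def patternWeight (a : ℝ) (n : ℕ) (p : ℝ) (c : Finset ℕ) : ℝ≥0∞ :=
  if c ⊆ windowSet a n p then ENNReal.ofReal (bernWeight p (windowSet a n p) c) else 0

theorem measurable_patternWeight (a : ℝ) (n : ℕ) (c : Finset ℕ) :
    Measurable fun p => patternWeight a n p c := by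
  have h : Measurable fun z : Finset ℕ × ℝ =>
      if c ⊆ z.1 then ENNReal.ofReal (bernWeight z.2 z.1 c) else 0 := by
    refine measurable_from_prod_countable_right fun d => ?_
    by_cases hd : c ⊆ d
    · simp only [hd, if_true]
      exact (measurable_bernWeight d c).ennreal_ofReal
    · simp only [hd, if_false]
      exact measurable_const
  exact h.comp ((measurable_filter_window a n (Finset.Icc 1 n)).prodMk measurable_id)

theorem tsum_patternWeight_mul {p : ℝ} (h0 : 0 ≤ p) (h1 : p ≤ 1) (a : ℝ) (n : ℕ)
    {f : Finset ℕ → ℝ} (hf : ∀ c, 0 ≤ f c) :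
    ∑' c, patternWeight a n p c * ENNReal.ofReal (f c) =
      ENNReal.ofReal (bernSum p (windowSet a n p) f) := by
  rw [tsum_eq_sum (s := (windowSet a n p).powerset), bernSum,
    ENNReal.ofReal_sum_of_nonneg fun c _ => mul_nonneg (bernWeight_nonneg h0 h1 _ c) (hf c)]
  · refine Finset.sum_congr rfl fun c hc => ?_
    rw [patternWeight, if_pos (Finset.mem_powerset.1 hc),
      ENNReal.ofReal_mul (bernWeight_nonneg h0 h1 _ c)]
  · intro c hc
    rw [patternWeight, if_neg fun h => hc (Finset.mem_powerset.2 h), zero_mul]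

theorem tsum_patternWeight {p : ℝ} (h0 : 0 ≤ p) (h1 : p ≤ 1) (a : ℝ) (n : ℕ) :
    ∑' c, patternWeight a n p c = 1 := by
  have := tsum_patternWeight_mul h0 h1 a n (f := fun _ => 1) fun _ => zero_le_one
  simpa [bernSum_const] using this

/-- The expectation of a product of functions of independent indicators factorises. -/
theorem bernSum_prod (p : ℝ) (T : Finset ℕ) (h : ℕ → Prop → ℝ) :
    bernSum p T (fun c => ∏ k ∈ T, h k (k ∈ c)) =
      ∏ k ∈ T, ((1 - p) * h k False + p * h k True) := by
  induction T using Finset.induction_on with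
  | empty => simp [bernSum_empty]
  | insert k T hk ih =>
    rw [bernSum_insert hk, Finset.prod_insert hk, ← ih, add_mul, mul_assoc, mul_assoc,
      ← bernSum_const_mul T (h k False), ← bernSum_const_mul T (h k True)]
    congr 2
    · refine bernSum_congr fun c hc => ?_
      have : (k ∈ c) = False := by simpa using fun h => hk (hc h)
      rw [Finset.prod_insert hk, this]
    · refine bernSum_congr fun c hc => ?_
      have : (k ∈ insert k c) = True := by simp
      rw [Finset.prod_insert hk, this]
      congr 1
      refine Finset.prod_congr rfl fun j hj => ?_
      have : j ≠ k := fun h => hk (h ▸ hj)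
      simp [this]

/-! ### Indicators on the whole line -/

/-- The bits of a pattern on the window, and independent bits with success probability `p`
elsewhere. -/
def patchBit (a : ℝ) (n : ℕ) (p : ℝ) (c : Finset ℕ) (u : ℝ) (k : ℕ) : Bool :=
  if k ∈ windowSet a n p then decide (k ∈ c) else decide (Real.exp (-u) < p)

theorem measurable_patchBit (a : ℝ) (n k : ℕ) :
    Measurable fun z : Finset ℕ × ℝ × ℝ => patchBit a n z.2.1 z.1 z.2.2 k := by
  have h1 : Measurable fun z : Finset ℕ × ℝ × ℝ => windowSet a n z.2.1 :=
    (measurable_filter_window a n (Finset.Icc 1 n)).comp (by fun_prop)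
  have hd : ∀ {α : Type} [MeasurableSpace α] {p : α → Prop} [DecidablePred p],
      MeasurableSet {x | p x} → Measurable fun x => decide (p x) := fun {α _ p _} hp =>
    measurable_to_bool (by
      have : (fun x => decide (p x)) ⁻¹' {true} = {x | p x} := by ext; simp
      rwa [this])
  unfold patchBit
  refine Measurable.ite ((measurable_of_countable fun c : Finset ℕ => c).comp h1 (t :=
    {c | k ∈ c}) .of_discrete) (hd ?_) (hd ?_)
  · exact (measurable_fst (t := {c : Finset ℕ | k ∈ c}) .of_discrete)
  · exact measurableSet_lt (by fun_prop) (by fun_prop)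

theorem expMeasure_exp_neg_lt {p : ℝ} (h0 : 0 < p) (h1 : p ≤ 1) :
    expMeasure 1 {u | Real.exp (-u) < p} = ENNReal.ofReal p := by
  have : {u : ℝ | Real.exp (-u) < p} = Set.Ioi (-Real.log p) := by
    ext u
    rw [Set.mem_ofPred_eq, Set.mem_Ioi, ← Real.lt_log_iff_exp_lt h0]
    constructor <;> intro h <;> linarith
  rw [this, expMeasure_Ioi (by linarith [Real.log_nonpos h0.le h1]), neg_neg, Real.exp_log h0]

theorem expMeasure_patchBit {a p : ℝ} {n : ℕ} (h0 : 0 < p) (h1 : p ≤ 1) (c : Finset ℕ) (k : ℕ)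
    (b : Bool) :
    expMeasure 1 {u | patchBit a n p c u k = b} = ENNReal.ofReal
      (if k ∈ windowSet a n p then (if decide (k ∈ c) = b then 1 else 0)
        else if b then p else 1 - p) := by
  unfold patchBit
  by_cases hk : k ∈ windowSet a n p
  · simp only [hk, if_true]
    by_cases hb : decide (k ∈ c) = b
    · simp [hb]
    · simp [hb]
  · simp only [hk, if_false]
    cases b
    · have : {u : ℝ | decide (Real.exp (-u) < p) = false} = {u | Real.exp (-u) < p}ᶜ := by
        ext u; simp
      rw [this, prob_compl_eq_one_sub (measurableSet_lt (by fun_prop) (by fun_prop)),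
        expMeasure_exp_neg_lt h0 h1, ← ENNReal.ofReal_one, ← ENNReal.ofReal_sub _ h0.le]
      simp
    · simpa using expMeasure_exp_neg_lt h0 h1

/-- The independent seeds for the bits outside the window. -/
abbrev seedMeasure : Measure (ℕ → ℝ) := Measure.infinitePi fun _ => expMeasure 1

/-- The patched bits are independent with success probability `p`. -/
theorem tsum_patternWeight_mul_seedMeasure {a p : ℝ} {n : ℕ} (h0 : 0 < p) (h1 : p ≤ 1)
    (S : Finset ℕ) (b : ℕ → Bool) :
    ∑' c, patternWeight a n p c * seedMeasure {u | ∀ k ∈ S, patchBit a n p c (u k) k = b k} =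
      ENNReal.ofReal (∏ k ∈ S, if b k then p else 1 - p) := by
  classical
  set W := windowSet a n p with hW
  set m : ℕ → Prop → ℝ := fun k q => if k ∈ W then (if decide q = b k then 1 else 0)
    else if b k then p else 1 - p with hm
  have hm0 : ∀ k q, 0 ≤ m k q := by
    intro k q
    simp only [hm]
    split_ifs <;> linarith
  have e1 : ∀ c, seedMeasure {u | ∀ k ∈ S, patchBit a n p c (u k) k = b k} =
      ENNReal.ofReal (∏ k ∈ S, m k (k ∈ c)) := by
    intro c
    have : {u : ℕ → ℝ | ∀ k ∈ S, patchBit a n p c (u k) k = b k} =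
        (S : Set ℕ).pi fun k => {v | patchBit a n p c v k = b k} := rfl
    rw [this, Measure.infinitePi_pi _ fun k _ => ?_,
      ENNReal.ofReal_prod_of_nonneg fun k _ => hm0 _ _]
    · refine Finset.prod_congr rfl fun k _ => ?_
      rw [expMeasure_patchBit h0 h1]
      simp only [hm, ← hW]
      congr!
    · exact (measurable_patchBit a n k).comp (f := fun v : ℝ => (c, p, v)) (by fun_prop)
        (measurableSet_singleton (b k))
  simp only [e1]
  rw [tsum_patternWeight_mul h0.le h1 a n fun c => Finset.prod_nonneg fun k _ => hm0 _ _]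
  congr 1
  -- Inside the window the bits come from the pattern, outside from the seeds; the two groups of
  -- factors are evaluated separately and recombined.
  rw [← hW, bernSum_of_inter (T := S ∩ W) Finset.inter_subset_right]
  · have e2 : ∀ c : Finset ℕ, ∏ k ∈ S, m k (k ∈ c) =
        (∏ k ∈ S \ W, if b k then p else 1 - p) * ∏ k ∈ S ∩ W, m k (k ∈ c) := by
      intro c
      rw [mul_comm, ← Finset.prod_inter_mul_prod_sdiff S W]
      congr 1
      refine Finset.prod_congr rfl fun k hk => ?_
      simp [hm, (Finset.mem_sdiff.1 hk).2]
    simp only [e2]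
    rw [bernSum_const_mul, bernSum_prod, mul_comm, ← Finset.prod_inter_mul_prod_sdiff S W]
    congr 1
    refine Finset.prod_congr rfl fun k hk => ?_
    simp only [hm, (Finset.mem_inter.1 hk).2, if_true]
    cases b k <;> simp
  · intro c _
    refine Finset.prod_congr rfl fun k hk => ?_
    by_cases hkW : k ∈ W
    · simp [hk, hkW]
    · simp [hm, hkW]

section

variable {Ω : Type*} [mΩ : MeasurableSpace Ω] {P : Measure Ω} [IsProbabilityMeasure P]
  {X : Ω → ℕ → ℝ} {r : ℕ → ℕ}

/-! ### Coupling the accepted candidates in the window with a Bernoulli pattern -/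

/-- The coupling weights for a pattern `V` and independent trials in the window, given `Z`. -/
def windowCoupling (P : Measure Ω) [IsFiniteMeasure P] (a : ℝ) (n : ℕ) (Z : Ω → ℝ) (V : Ω → Finset ℕ) (ω : Ω)
    (y : Finset ℕ) : ℝ≥0∞ :=
  couplingWeight (fun x => condDistrib V Z P (Z ω) {x}) (patternWeight a n (Z ω)) (V ω) y

theorem tsum_condDistrib_singleton (Z : Ω → ℝ) (V : Ω → Finset ℕ) (p : ℝ) :
    ∑' x, condDistrib V Z P p {x} = 1 := by
  have h := lintegral_countable' (μ := condDistrib V Z P p) (fun _ => (1 : ℝ≥0∞))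
  simp only [lintegral_const, measure_univ, one_mul] at h
  exact h.symm

section

variable {Z : Ω → ℝ} {V : Ω → Finset ℕ} (a : ℝ) (n : ℕ)

theorem measurable_windowCoupling_apply (Z : Ω → ℝ) (V : Ω → Finset ℕ) (y : Finset ℕ) :
    Measurable fun z : ℝ × Finset ℕ => couplingWeight
      (fun x => condDistrib V Z P z.1 {x}) (patternWeight a n z.1) z.2 y :=
  measurable_from_prod_countable_left fun x => measurable_couplingWeight
    (k := fun p x => condDistrib V Z P p {x}) (b := patternWeight a n)
    (fun _ => Kernel.measurable_coe _ .of_discrete) (measurable_patternWeight a n) x y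

theorem measurable_windowCoupling (hZ : Measurable Z) (hV : Measurable V) (y : Finset ℕ) :
    Measurable fun ω => windowCoupling P a n Z V ω y :=
  (measurable_windowCoupling_apply a n Z V y).comp (hZ.prodMk hV)

theorem tsum_windowCoupling (hZ01 : ∀ ω, 0 ≤ Z ω ∧ Z ω ≤ 1) (ω : Ω) :
    ∑' y, windowCoupling P a n Z V ω y = 1 :=
  tsum_couplingWeight_right (tsum_condDistrib_singleton Z V _)
    (tsum_patternWeight (hZ01 ω).1 (hZ01 ω).2 a n) (V ω)

/-- Given `Z`, the second component of the coupling is a Bernoulli pattern. -/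
theorem lintegral_windowCoupling (hZ : Measurable Z) (hV : Measurable V)
    (hZ01 : ∀ ω, 0 ≤ Z ω ∧ Z ω ≤ 1) {g : ℝ × Finset ℕ → ℝ≥0∞} (hg : Measurable g) :
    ∫⁻ z, g (Z z.1, z.2) ∂(extendMeasure P (windowCoupling P a n Z V)) =
      ∫⁻ ω, ∑' y, patternWeight a n (Z ω) y * g (Z ω, y) ∂P := by
  have hgy : ∀ y, Measurable fun ω => g (Z ω, y) := fun y =>
    hg.comp (hZ.prodMk measurable_const)
  rw [lintegral_extendMeasure P (measurable_windowCoupling a n hZ hV)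
    (g := fun z => g (Z z.1, z.2)) (hg.comp (by fun_prop)),
    lintegral_tsum (f := fun y ω => windowCoupling P a n Z V ω y * g (Z ω, y))
      fun y => ((measurable_windowCoupling a n hZ hV y).mul (hgy y)).aemeasurable,
    lintegral_tsum (f := fun y ω => patternWeight a n (Z ω) y * g (Z ω, y)) fun y =>
      (((measurable_patternWeight a n y).comp hZ).mul (hgy y)).aemeasurable]
  refine tsum_congr fun y => ?_
  -- Disintegrating `V` given `Z` turns the transition weights into their average under the
  -- conditional law, which `tsum_mul_couplingWeight` identifies as the pattern weight.
  have h1 := lintegral_condDistrib_tsum (P := P) hZ hV (g := fun z => couplingWeight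
    (fun x => condDistrib V Z P z.1 {x}) (patternWeight a n z.1) z.2 y * g (z.1, y))
    ((measurable_windowCoupling_apply a n Z V y).mul
      (hg.comp (measurable_fst.prodMk measurable_const)))
  refine h1.trans (lintegral_congr fun ω => ?_)
  simp only [← mul_assoc]
  rw [ENNReal.tsum_mul_right, tsum_mul_couplingWeight (tsum_condDistrib_singleton Z V _)
    (tsum_patternWeight (hZ01 ω).1 (hZ01 ω).2 a n)]

/-- Maximality of the coupling: the probability of disagreement is at most the mean conditional
total variation distance. -/
theorem measure_windowCoupling_ne_le (hZ : Measurable Z) (hV : Measurable V)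
    (hZ01 : ∀ ω, 0 ≤ Z ω ∧ Z ω ≤ 1) :
    extendMeasure P (windowCoupling P a n Z V) {z | V z.1 ≠ z.2} ≤
      ∫⁻ ω, ∑' x, (condDistrib V Z P (Z ω) {x} - patternWeight a n (Z ω) x) ∂P := by
  have hm : MeasurableSet {z : Ω × Finset ℕ | V z.1 ≠ z.2} :=
    (measurableSet_eq_fun (hV.comp measurable_fst) measurable_snd).compl
  have hgm : Measurable fun z : ℝ × Finset ℕ => 1 - couplingWeight
      (fun x => condDistrib V Z P z.1 {x}) (patternWeight a n z.1) z.2 z.2 :=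
    measurable_const.sub (measurable_from_prod_countable_left fun x => by
      exact (measurable_windowCoupling_apply a n Z V x).comp (measurable_id.prodMk measurable_const))
  rw [← lintegral_indicator_one hm, lintegral_extendMeasure P
    (measurable_windowCoupling a n hZ hV) (measurable_one.indicator hm)]
  calc _ ≤ ∫⁻ ω, (1 - windowCoupling P a n Z V ω (V ω)) ∂P := by
        refine lintegral_mono fun ω => ?_
        have h1 := tsum_windowCoupling (P := P) (V := V) a n hZ01 ω
        refine ENNReal.le_sub_of_add_le_right (ne_top_of_tsum_eq_one h1 _) ?_
        rw [← h1, ← tsum_ite_eq (V ω) fun y => windowCoupling P a n Z V ω y, ← ENNReal.tsum_add]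
        refine ENNReal.tsum_le_tsum fun y => ?_
        by_cases hy : y = V ω
        · simp [hy]
        · simp only [hy, if_false, add_zero]
          refine (mul_le_mul_right (Set.indicator_le_self' (f := (1 : Ω × Finset ℕ → ℝ≥0∞))
            (fun _ _ => zero_le) _) _).trans ?_
          simp
    _ ≤ _ := by
        have h1 := lintegral_condDistrib_tsum (P := P) hZ hV hgm
        refine (le_of_eq h1).trans (lintegral_mono fun ω => ?_)
        exact tsum_mul_one_sub_couplingWeight_le (tsum_condDistrib_singleton Z V _)

/-- The joint law of the original randomness, the coupled pattern and the seeds. -/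
def seededMeasure (P : Measure Ω) [IsFiniteMeasure P] (a : ℝ) (n : ℕ) (Z : Ω → ℝ) (V : Ω → Finset ℕ) :
    Measure ((Ω × Finset ℕ) × (ℕ → ℝ)) :=
  (extendMeasure P (windowCoupling P a n Z V)).prod seedMeasure

/-- The original randomness together with the patched bits. -/
def seededBits (a : ℝ) (n : ℕ) (Z : Ω → ℝ) (z : (Ω × Finset ℕ) × (ℕ → ℝ)) : Ω × (ℕ → Bool) :=
  (z.1.1, fun k => patchBit a n (Z z.1.1) z.1.2 (z.2 k) k)

theorem measurable_seededBits (hZ : Measurable Z) : Measurable (seededBits a n Z) := by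
  refine Measurable.prodMk (by fun_prop) (measurable_pi_iff.2 fun k => ?_)
  exact (measurable_patchBit a n k).comp (f := fun z : (Ω × Finset ℕ) × (ℕ → ℝ) =>
    (z.1.2, Z z.1.1, z.2 k)) (by fun_prop)

theorem isProbabilityMeasure_extendMeasure (hZ : Measurable Z) (hV : Measurable V)
    (hZ01 : ∀ ω, 0 ≤ Z ω ∧ Z ω ≤ 1) :
    IsProbabilityMeasure (extendMeasure P (windowCoupling P a n Z V)) := by
  have h1 := extendMeasure_map_fst P (measurable_windowCoupling (P := P) a n hZ hV)
    (tsum_windowCoupling a n hZ01)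
  constructor
  rw [← Set.preimage_univ (f := Prod.fst), ← Measure.map_apply measurable_fst .univ, h1,
    measure_univ]

theorem seededMeasure_map_fst (hZ : Measurable Z) (hV : Measurable V)
    (hZ01 : ∀ ω, 0 ≤ Z ω ∧ Z ω ≤ 1) :
    ((seededMeasure P a n Z V).map (seededBits a n Z)).map Prod.fst = P := by
  have := isProbabilityMeasure_extendMeasure (P := P) a n hZ hV hZ01
  rw [Measure.map_map measurable_fst (measurable_seededBits a n hZ)]
  have h1 : (Prod.fst ∘ seededBits a n Z : (Ω × Finset ℕ) × (ℕ → ℝ) → Ω) =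
      Prod.fst ∘ Prod.fst := rfl
  rw [h1, ← Measure.map_map measurable_fst measurable_fst, seededMeasure, Measure.map_fst_prod,
    measure_univ, one_smul]
  exact extendMeasure_map_fst P (measurable_windowCoupling a n hZ hV)
    (tsum_windowCoupling a n hZ01)

theorem seededMeasure_apply (hZ : Measurable Z) (hV : Measurable V)
    (hZ01 : ∀ ω, 0 < Z ω ∧ Z ω ≤ 1) {A : Set ℝ} (hA : MeasurableSet A) (S : Finset ℕ)
    (b : ℕ → Bool) :
    (seededMeasure P a n Z V).map (seededBits a n Z)
      ({w | Z w.1 ∈ A} ∩ {w | ∀ k ∈ S, w.2 k = b k}) =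
      ∫⁻ ω in Z ⁻¹' A, ENNReal.ofReal (∏ k ∈ S, if b k then Z ω else 1 - Z ω) ∂P := by
  have hZ01' : ∀ ω, 0 ≤ Z ω ∧ Z ω ≤ 1 := fun ω => ⟨(hZ01 ω).1.le, (hZ01 ω).2⟩
  have := isProbabilityMeasure_extendMeasure (P := P) a n hZ hV hZ01'
  have hSm : MeasurableSet {w : Ω × (ℕ → Bool) | ∀ k ∈ S, w.2 k = b k} := by
    have : {w : Ω × (ℕ → Bool) | ∀ k ∈ S, w.2 k = b k} =
        ⋂ k ∈ S, {w : Ω × (ℕ → Bool) | w.2 k = b k} := by ext; simp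
    rw [this]
    exact Finset.measurableSet_biInter _ fun k _ =>
      measurableSet_eq_fun (by fun_prop) measurable_const
  have hBm : MeasurableSet ({w : Ω × (ℕ → Bool) | Z w.1 ∈ A} ∩ {w | ∀ k ∈ S, w.2 k = b k}) :=
    ((hZ.comp measurable_fst) hA).inter hSm
  have hT : MeasurableSet {z : (ℝ × Finset ℕ) × (ℕ → ℝ) |
      ∀ k ∈ S, patchBit a n z.1.1 z.1.2 (z.2 k) k = b k} := by
    have : {z : (ℝ × Finset ℕ) × (ℕ → ℝ) | ∀ k ∈ S, patchBit a n z.1.1 z.1.2 (z.2 k) k = b k} =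
        ⋂ k ∈ S, {z : (ℝ × Finset ℕ) × (ℕ → ℝ) | patchBit a n z.1.1 z.1.2 (z.2 k) k = b k} := by
      ext; simp
    rw [this]
    exact Finset.measurableSet_biInter _ fun k _ =>
      measurableSet_eq_fun ((measurable_patchBit a n k).comp
        (f := fun z : (ℝ × Finset ℕ) × (ℕ → ℝ) => (z.1.2, z.1.1, z.2 k)) (by fun_prop))
        measurable_const
  -- The seeds are integrated out first, leaving a function of `Z` and the pattern alone, to which
  -- the second marginal of the coupling applies.
  set g : ℝ × Finset ℕ → ℝ≥0∞ := fun z => A.indicator 1 z.1 *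
    seedMeasure {u | ∀ k ∈ S, patchBit a n z.1 z.2 (u k) k = b k} with hg
  have hgm : Measurable g := ((measurable_one.indicator hA).comp measurable_fst).mul
    (measurable_measure_prodMk_left hT)
  rw [Measure.map_apply (measurable_seededBits a n hZ) hBm, seededMeasure,
    Measure.prod_apply (measurable_seededBits a n hZ hBm)]
  have e1 : ∀ z : Ω × Finset ℕ, seedMeasure (Prod.mk z ⁻¹' (seededBits a n Z ⁻¹'
      ({w | Z w.1 ∈ A} ∩ {w | ∀ k ∈ S, w.2 k = b k}))) = g (Z z.1, z.2) := by
    intro z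
    by_cases hz : Z z.1 ∈ A
    · have : Prod.mk z ⁻¹' (seededBits a n Z ⁻¹'
          ({w | Z w.1 ∈ A} ∩ {w | ∀ k ∈ S, w.2 k = b k})) =
          {u | ∀ k ∈ S, patchBit a n (Z z.1) z.2 (u k) k = b k} := by
        ext u
        simp [seededBits, hz]
      rw [this]
      simp [hg, hz]
    · have : Prod.mk z ⁻¹' (seededBits a n Z ⁻¹'
          ({w | Z w.1 ∈ A} ∩ {w | ∀ k ∈ S, w.2 k = b k})) = ∅ := by
        ext u
        simp [seededBits, hz]
      rw [this]
      simp [hg, hz]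
  simp only [e1]
  rw [lintegral_windowCoupling a n hZ hV hZ01' hgm, ← lintegral_indicator (hZ hA)]
  refine lintegral_congr fun ω => ?_
  by_cases hω : Z ω ∈ A
  · rw [Set.indicator_of_mem (show ω ∈ Z ⁻¹' A from hω),
      ← tsum_patternWeight_mul_seedMeasure (a := a) (n := n) (hZ01 ω).1 (hZ01 ω).2 S b]
    simp [hg, hω]
  · rw [Set.indicator_of_notMem (show ω ∉ Z ⁻¹' A from hω)]
    simp [hg, hω]

theorem condIIDBernoulli_seededMeasure (hZ : Measurable Z) (hV : Measurable V)
    (hZ01 : ∀ ω, 0 < Z ω ∧ Z ω ≤ 1) :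
    CondIIDBernoulli ((seededMeasure P a n Z V).map (seededBits a n Z)) (fun w => Z w.1)
      (fun k w => w.2 k) := by
  set ν := (seededMeasure P a n Z V).map (seededBits a n Z) with hν
  have hfst : ν.map Prod.fst = P :=
    seededMeasure_map_fst a n hZ hV fun ω => ⟨(hZ01 ω).1.le, (hZ01 ω).2⟩
  have hprob : IsProbabilityMeasure ν := by
    constructor
    rw [← Set.preimage_univ (f := Prod.fst), ← Measure.map_apply measurable_fst .univ, hfst,
      measure_univ]
  have hZw : Measurable fun w : Ω × (ℕ → Bool) => Z w.1 := hZ.comp measurable_fst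
  refine ⟨hZw, fun k => by fun_prop, fun S b => ?_⟩
  set f : ℝ → ℝ := fun p => ∏ k ∈ S, if b k then p else 1 - p with hf
  have hfm : Measurable f := by
    refine Finset.measurable_fun_prod _ fun k _ => ?_
    split_ifs
    · exact measurable_id
    · exact measurable_const.sub measurable_id
  have hf01 : ∀ ω, 0 ≤ f (Z ω) ∧ f (Z ω) ≤ 1 := by
    intro ω
    have h1 : ∀ k ∈ S, 0 ≤ (if b k then Z ω else 1 - Z ω) := fun k _ => by
      split_ifs
      · exact (hZ01 ω).1.le
      · linarith [(hZ01 ω).2]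
    refine ⟨Finset.prod_nonneg h1, Finset.prod_le_one h1 fun k _ => ?_⟩
    split_ifs
    · exact (hZ01 ω).2
    · linarith [(hZ01 ω).1]
  have hSm : MeasurableSet {w : Ω × (ℕ → Bool) | ∀ k ∈ S, w.2 k = b k} := by
    have : {w : Ω × (ℕ → Bool) | ∀ k ∈ S, w.2 k = b k} =
        ⋂ k ∈ S, {w : Ω × (ℕ → Bool) | w.2 k = b k} := by ext; simp
    rw [this]
    exact Finset.measurableSet_biInter _ fun k _ =>
      measurableSet_eq_fun (by fun_prop) measurable_const
  have hint : Integrable (fun w : Ω × (ℕ → Bool) => f (Z w.1)) ν :=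
    Integrable.of_bound (hfm.comp hZw).aestronglyMeasurable 1 (ae_of_all _ fun w => by
      rw [Real.norm_eq_abs, abs_of_nonneg (hf01 _).1]
      exact (hf01 _).2)
  symm
  refine ae_eq_condExp_of_forall_setIntegral_eq hZw.comap_le
    ((integrable_const 1).indicator hSm) (fun _ _ _ => hint.integrableOn) ?_ ?_
  -- Events generated by Z are preimages of Borel sets, so `seededMeasure_apply` is exactly the
  -- defining property of the conditional probability.
  · rintro _ ⟨A, hA, rfl⟩ _
    change ∫ w in (fun w : Ω × (ℕ → Bool) => Z w.1) ⁻¹' A, f (Z w.1) ∂ν = _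
    have h3 : 0 ≤ᵐ[ν.restrict ((fun w : Ω × (ℕ → Bool) => Z w.1) ⁻¹' A)]
        fun w => f (Z w.1) := ae_of_all _ fun w => (hf01 w.1).1
    rw [setIntegral_indicator hSm, setIntegral_const, smul_eq_mul, mul_one,
      integral_eq_lintegral_of_nonneg_ae h3 (hfm.comp hZw).aestronglyMeasurable, Measure.real]
    congr 1
    have h1 := seededMeasure_apply (P := P) a n hZ hV hZ01 hA S b
    refine Eq.trans ?_ h1.symm
    have h2 : ∫⁻ ω in Z ⁻¹' A, ENNReal.ofReal (f (Z ω)) ∂P =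
        ∫⁻ ω in Z ⁻¹' A, ENNReal.ofReal (f (Z ω)) ∂(ν.map Prod.fst) := by rw [hfst]
    refine Eq.trans ?_ h2.symm
    exact (setLIntegral_map (f := fun ω => ENNReal.ofReal (f (Z ω))) (hZ hA)
      (hfm.comp hZ).ennreal_ofReal measurable_fst).symm
  · exact (hfm.comp (comap_measurable _)).aestronglyMeasurable

end

end

/-- The indicator that `(p, c)` lies in `s`, where `c` is first restricted to the window. -/
def patternTest (s : Set (ℝ × Finset ℕ)) (a : ℝ) (n : ℕ) (p : ℝ) (c : Finset ℕ) : ℝ :=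
  s.indicator 1 (p, c.filter fun k : ℕ => (n : ℝ) - a / p ≤ k)

theorem isWindowTest_patternTest {s : Set (ℝ × Finset ℕ)} (hs : MeasurableSet s) (a : ℝ) (n : ℕ) :
    IsWindowTest a n (patternTest s a n) where
  measurable c := (measurable_one.indicator hs).comp
    (measurable_id.prodMk (measurable_filter_window a n c))
  mem_Icc p c := indicator_one_mem_Icc _ _
  filter_eq p _ c := by
    unfold patternTest
    simp only [Finset.filter_filter, and_self]

/-- A sequence of eventual properties holds along a sequence of indices tending to infinity. -/
theorem exists_tendsto_atTop_eventually {Q : ℕ → ℕ → Prop} (hQ : ∀ j, ∀ᶠ n in atTop, Q j n) :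
    ∃ m : ℕ → ℕ, Tendsto m atTop atTop ∧ ∀ᶠ n in atTop, Q (m n) n := by
  classical
  choose N hN using fun j => eventually_atTop.1 (hQ j)
  -- The index at n is the largest j ≤ n whose property is already guaranteed from n onwards.
  refine ⟨fun n => Nat.findGreatest (fun j => N j ≤ n) n, ?_, ?_⟩
  · refine tendsto_atTop.2 fun J => ?_
    filter_upwards [eventually_ge_atTop (max J (N J))] with n hn
    exact Nat.le_findGreatest ((le_max_left _ _).trans hn) ((le_max_right _ _).trans hn)
  · filter_upwards [eventually_ge_atTop (N 0)] with n hn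
    exact hN _ n (Nat.findGreatest_spec (P := fun j => N j ≤ n) (Nat.zero_le n) hn)

/-! ### The coupling of acceptances and the choice of a_n. -/

section

variable {Ω : Type*} [mΩ : MeasurableSpace Ω] {P : Measure Ω} [IsProbabilityMeasure P]
  {X : Ω → ℕ → ℝ} {r : ℕ → ℕ}

/-- The accepted candidates in the window before `n`. -/
def windowPattern (a : ℝ) (n : ℕ) (r : ℕ → ℕ) (x : ℕ → ℝ) : Finset ℕ :=
  (acceptedSet r x n).filter fun k : ℕ => (n : ℝ) - a / acceptProb r x n ≤ k

theorem IsExpSequence.measurable_windowPattern (h : IsExpSequence P X) (hr : IsRankSequence r)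
    (a : ℝ) (n : ℕ) : Measurable fun ω => windowPattern a n r (X ω) := by
  have h1 : Measurable fun z : Finset ℕ × ℝ => z.1.filter fun k : ℕ => (n : ℝ) - a / z.2 ≤ k :=
    measurable_from_prod_countable_right fun c => measurable_filter_window a n c
  exact h1.comp ((h.measurable_acceptedSet hr n).prodMk (h.measurable_acceptProb hr n))

/-- The left side is the mean conditional total variation distance. It is attained by testing on the
set where the conditional law of the accepted pattern exceeds the Bernoulli one, which is a window
test. -/
theorem IsExpSequence.lintegral_tsub_patternWeight_le (h : IsExpSequence P X)
    (hr : IsRankSequence r) {a η : ℝ} {n : ℕ} (hc : WindowComparison P X r a η n) :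
    ∫⁻ ω, ∑' x, (condDistrib (fun ω' => windowPattern a n r (X ω'))
      (fun ω' => acceptProb r (X ω') n) P (acceptProb r (X ω) n) {x} -
        patternWeight a n (acceptProb r (X ω) n) x) ∂P ≤ ENNReal.ofReal η := by
  set Z : Ω → ℝ := fun ω => acceptProb r (X ω) n with hZ
  set V : Ω → Finset ℕ := fun ω => windowPattern a n r (X ω) with hV
  have hZm : Measurable Z := h.measurable_acceptProb hr n
  have hVm : Measurable V := h.measurable_windowPattern hr a n
  have hZ0 : ∀ ω, 0 ≤ Z ω := fun ω => (acceptProb_pos _ _).le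
  have hZ1 : ∀ ω, Z ω ≤ 1 := fun ω => acceptProb_le_one hr _ _
  set κ := condDistrib V Z P with hκ
  have hκm : ∀ x, Measurable fun p => κ p {x} := fun x => Kernel.measurable_coe κ .of_discrete
  set s : Set (ℝ × Finset ℕ) := {z | patternWeight a n z.1 z.2 < κ z.1 {z.2}} with hs
  have hsm : MeasurableSet s := measurableSet_lt
    (measurable_from_prod_countable_left fun x => measurable_patternWeight a n x)
    (measurable_from_prod_countable_left fun x => hκm x)
  have hind : Measurable (s.indicator (1 : ℝ × Finset ℕ → ℝ≥0∞)) := measurable_one.indicator hsm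
  set G : Ω → ℝ≥0∞ := fun ω => ∑' x, patternWeight a n (Z ω) x * s.indicator 1 (Z ω, x) with hG
  have hGm : Measurable G := Measurable.tsum fun x =>
    ((measurable_patternWeight a n x).comp hZm).mul (hind.comp (hZm.prodMk measurable_const))
  have hG1 : ∀ ω, G ω ≤ 1 := by
    intro ω
    rw [← tsum_patternWeight (hZ0 ω) (hZ1 ω) a n]
    refine ENNReal.tsum_le_tsum fun x => ?_
    refine (mul_le_mul_right (Set.indicator_le_self' (f := (1 : ℝ × Finset ℕ → ℝ≥0∞))
      (fun _ _ => zero_le) _) _).trans ?_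
    simp
  have hfin : ∫⁻ ω, G ω ∂P ≠ ∞ :=
    ne_of_lt (lt_of_le_of_lt (lintegral_mono hG1) (by simp))
  have hsplit : ∀ ω, ∑' x, (κ (Z ω) {x} - patternWeight a n (Z ω) x) + G ω =
      ∑' x, κ (Z ω) {x} * s.indicator 1 (Z ω, x) := by
    intro ω
    rw [hG, ← ENNReal.tsum_add]
    refine tsum_congr fun x => ?_
    by_cases hx : (Z ω, x) ∈ s
    · rw [Set.indicator_of_mem hx]
      simp only [Pi.one_apply, mul_one]
      exact tsub_add_cancel_of_le (le_of_lt hx)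
    · rw [Set.indicator_of_notMem hx]
      simp only [mul_zero, add_zero]
      exact tsub_eq_zero_of_le (not_lt.1 hx)
  have hbern : ∀ ω, ENNReal.ofReal
      (bernSum (Z ω) (Finset.Icc 1 n) (patternTest s a n (Z ω))) = G ω := by
    intro ω
    set W := windowSet a n (Z ω) with hW
    have hf : ∀ c ⊆ Finset.Icc 1 n, (c.filter fun k : ℕ => (n : ℝ) - a / Z ω ≤ k) = c ∩ W := by
      intro c hcs
      ext k
      simp only [hW, windowSet, Finset.mem_filter, Finset.mem_inter]
      exact ⟨fun h => ⟨h.1, hcs h.1, h.2⟩, fun h => ⟨h.1, h.2.2⟩⟩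
    have hWs : W ⊆ Finset.Icc 1 n := Finset.filter_subset _ _
    rw [bernSum_of_inter (T := W) hWs]
    · rw [hW, ← tsum_patternWeight_mul (hZ0 ω) (hZ1 ω) a n (f := patternTest s a n (Z ω))
        fun c => (indicator_one_mem_Icc _ _).1]
      refine tsum_congr fun c => ?_
      by_cases hcW : c ⊆ W
      · rw [patternTest, hf c (hcW.trans hWs), Finset.inter_eq_left.2 hcW, ofReal_indicator_one]
      · have : patternWeight a n (Z ω) c = 0 := if_neg hcW
        rw [this, zero_mul, zero_mul]
    · intro c hcs
      rw [patternTest, patternTest, hf c hcs, hf _ (Finset.inter_subset_left.trans hcs),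
        Finset.inter_assoc, Finset.inter_self]
  refine ENNReal.le_of_add_le_add_right hfin ?_
  rw [← lintegral_add_right _ hGm, lintegral_congr hsplit,
    ← lintegral_condDistrib_tsum hZm hVm hind]
  calc ∫⁻ ω, s.indicator 1 (Z ω, V ω) ∂P
      = ∫⁻ ω, ENNReal.ofReal (patternTest s a n (Z ω) (acceptedSet r (X ω) n)) ∂P :=
        lintegral_congr fun ω => (ofReal_indicator_one s _).symm
    _ ≤ ∫⁻ ω, ENNReal.ofReal (bernSum (Z ω) (Finset.Icc 1 n) (patternTest s a n (Z ω))) ∂P +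
        ENNReal.ofReal η := hc.lintegral_le _ (isWindowTest_patternTest hsm a n)
    _ = _ := by rw [lintegral_congr hbern, add_comm]

/-- The acceptance indicators coincide in the window with conditionally independent ones, except
on an event of small probability. -/
theorem IsExpSequence.exists_coupling (h : IsExpSequence P X) (hr : IsRankSequence r) (a : ℝ)
    (n : ℕ) :
    ∃ ν : Measure (Ω × (ℕ → Bool)), ν.map Prod.fst = P ∧
      CondIIDBernoulli ν (fun w => acceptProb r (X w.1) n) (fun k w => w.2 k) ∧
      ∀ η, WindowComparison P X r a η n → 1 - 2 * ENNReal.ofReal η ≤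
        ν {w | 1 ≤ (n : ℝ) - a * (acceptProb r (X w.1) n)⁻¹ ∧
          ∀ k : ℕ, (n : ℝ) - a * (acceptProb r (X w.1) n)⁻¹ ≤ k → k ≤ n →
            (Accepted r (X w.1) k ↔ w.2 k = true)} := by
  set Z : Ω → ℝ := fun ω => acceptProb r (X ω) n with hZ
  set V : Ω → Finset ℕ := fun ω => windowPattern a n r (X ω) with hV
  have hZm : Measurable Z := h.measurable_acceptProb hr n
  have hVm : Measurable V := h.measurable_windowPattern hr a n
  have hZ01 : ∀ ω, 0 < Z ω ∧ Z ω ≤ 1 := fun ω => ⟨acceptProb_pos _ _, acceptProb_le_one hr _ _⟩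
  have hZ01' : ∀ ω, 0 ≤ Z ω ∧ Z ω ≤ 1 := fun ω => ⟨(hZ01 ω).1.le, (hZ01 ω).2⟩
  refine ⟨(seededMeasure P a n Z V).map (seededBits a n Z),
    seededMeasure_map_fst a n hZm hVm hZ01', condIIDBernoulli_seededMeasure a n hZm hVm hZ01,
    fun η hη => ?_⟩
  have := isProbabilityMeasure_extendMeasure (P := P) a n hZm hVm hZ01'
  set E : Set (Ω × Finset ℕ) := {z | V z.1 = z.2} ∩ Prod.fst ⁻¹' {ω | 1 ≤ (n : ℝ) - a / Z ω}
    with hE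
  have hEm : MeasurableSet E := (measurableSet_eq_fun (hVm.comp measurable_fst)
    measurable_snd).inter (measurable_fst (measurableSet_le measurable_const (by fun_prop)))
  have hEc : extendMeasure P (windowCoupling P a n Z V) Eᶜ ≤ 2 * ENNReal.ofReal η := by
    have hsub : Eᶜ ⊆ {z | V z.1 ≠ z.2} ∪ Prod.fst ⁻¹' {ω | (n : ℝ) - a / Z ω < 1} := by
      intro z hz
      by_cases h1 : V z.1 = z.2
      · exact Or.inr (show (n : ℝ) - a / Z z.1 < 1 from not_le.1 fun h2 => hz ⟨h1, h2⟩)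
      · exact Or.inl h1
    refine (measure_mono hsub).trans ((measure_union_le _ _).trans ?_)
    rw [two_mul]
    refine add_le_add ((measure_windowCoupling_ne_le a n hZm hVm hZ01').trans
      (h.lintegral_tsub_patternWeight_le hr hη)) ?_
    rw [← Measure.map_apply measurable_fst (measurableSet_lt (by fun_prop) measurable_const),
      extendMeasure_map_fst P (measurable_windowCoupling a n hZm hVm)
        (tsum_windowCoupling a n hZ01')]
    exact hη.measure_le
  calc 1 - 2 * ENNReal.ofReal η ≤ 1 - extendMeasure P (windowCoupling P a n Z V) Eᶜ :=
        tsub_le_tsub_left hEc _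
    _ = extendMeasure P (windowCoupling P a n Z V) E := by
        rw [prob_compl_eq_one_sub hEm, ENNReal.sub_sub_cancel ENNReal.one_ne_top prob_le_one]
    _ = seededMeasure P a n Z V (Prod.fst ⁻¹' E) := by
        rw [seededMeasure, ← Measure.map_apply measurable_fst hEm, Measure.map_fst_prod,
          measure_univ, one_smul]
    _ ≤ seededMeasure P a n Z V (seededBits a n Z ⁻¹' _) := by
        refine measure_mono fun z hz => ?_
        obtain ⟨h1, h2⟩ := hz
        simp only [Set.mem_ofPred_eq, Set.mem_preimage] at h1 h2
        simp only [seededBits, Set.mem_preimage, Set.mem_ofPred_eq, ← div_eq_mul_inv]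
        refine ⟨h2, fun k hk hkn => ?_⟩
        have hk1 : 1 ≤ k := by
          have : (1 : ℝ) ≤ k := h2.trans hk
          exact_mod_cast this
        have hkW : k ∈ windowSet a n (Z z.1.1) :=
          Finset.mem_filter.2 ⟨Finset.mem_Icc.2 ⟨hk1, hkn⟩, hk⟩
        rw [patchBit, if_pos hkW, decide_eq_true_iff, ← h1]
        simp only [hV, windowPattern, Finset.mem_filter, mem_acceptedSet]
        exact ⟨fun hacc => ⟨⟨⟨hk1, hkn⟩, hacc⟩, hk⟩, fun hmem => hmem.1.2⟩
    -- This inequality holds for arbitrary sets, so the agreement event need not be shown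
    -- measurable.
    _ ≤ _ := Measure.le_map_apply (measurable_seededBits a n hZm).aemeasurable _

/-- For each j the comparison with a = j+1 and error 1/(j+1) holds eventually; letting j grow slowly
with n gives a_n → ∞ and vanishing error at once. -/
theorem IsExpSequence.exists_coupling_sequence (h : IsExpSequence P X) (hr : IsRankSequence r)
    (hdiv : Tendsto (fun m : ℕ => ∑ k ∈ Finset.Icc 1 m, delta r k / (r k : ℝ)) atTop atTop)
    (hr_top : Tendsto r atTop atTop) :
    ∃ (a : ℕ → ℝ) (ν : ℕ → Measure (Ω × (ℕ → Bool))),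
      Tendsto a atTop atTop ∧
      (∀ n, (ν n).map Prod.fst = P ∧
        CondIIDBernoulli (ν n) (fun w => acceptProb r (X w.1) n) (fun k w => w.2 k)) ∧
      Tendsto (fun n : ℕ => ν n {w |
          1 ≤ (n : ℝ) - a n * (acceptProb r (X w.1) n)⁻¹ ∧
          ∀ k : ℕ, (n : ℝ) - a n * (acceptProb r (X w.1) n)⁻¹ ≤ k → k ≤ n →
            (Accepted r (X w.1) k ↔ w.2 k = true)}) atTop (𝓝 1) := by
  obtain ⟨m, hm, hmQ⟩ := exists_tendsto_atTop_eventually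
    (Q := fun j n => WindowComparison P X r (j + 1) (1 / ((j : ℝ) + 1)) n) fun j =>
    h.eventually_windowComparison hr hdiv hr_top (by positivity) (by positivity)
  choose ν hν1 hν2 hν3 using fun n => h.exists_coupling hr ((m n : ℝ) + 1) n
  have hmr : Tendsto (fun n => (m n : ℝ)) atTop atTop := tendsto_natCast_atTop_atTop.comp hm
  refine ⟨fun n => (m n : ℝ) + 1, ν, tendsto_atTop_add_const_right _ _ hmr,
    fun n => ⟨hν1 n, hν2 n⟩, ?_⟩
  have hlim : Tendsto (fun n => 1 - 2 * ENNReal.ofReal (1 / ((m n : ℝ) + 1))) atTop (𝓝 1) := by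
    have h1 : Tendsto (fun n => ENNReal.ofReal (1 / ((m n : ℝ) + 1))) atTop (𝓝 0) := by
      have := ENNReal.tendsto_ofReal (tendsto_one_div_add_atTop_nhds_zero_nat (𝕜 := ℝ) |>.comp hm)
      simpa using this
    have h2 := ENNReal.Tendsto.sub (tendsto_const_nhds (x := (1 : ℝ≥0∞)) (f := atTop))
      (ENNReal.Tendsto.const_mul h1 (Or.inr (by simp : (2 : ℝ≥0∞) ≠ ∞)))
      (Or.inl ENNReal.one_ne_top)
    simpa using h2
  refine tendsto_of_tendsto_of_tendsto_of_le_of_le' hlim tendsto_const_nhds ?_ ?_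
  · filter_upwards [hmQ] with n hn using hν3 n _ hn
  · refine Eventually.of_forall fun n => ?_
    have : ν n Set.univ = 1 := by
      rw [← Set.preimage_univ (f := Prod.fst), ← Measure.map_apply measurable_fst .univ, hν1 n,
        measure_univ]
    exact (measure_mono (Set.subset_univ _)).trans this.le

end

end Hiring

end

theorem mainTheorem12 {Ω : Type*} [MeasurableSpace Ω] (P : Measure Ω) [IsProbabilityMeasure P]
    -- candidate `k ≥ 1` has the value `X ω k`; the values are i.i.d. `Exp(1)`
    (X : Ω → ℕ → ℝ)
    (hX_meas : ∀ k ≥ 1, Measurable fun ω => X ω k)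
    (hX_indep : iIndepFun (fun (k : ℕ) ω => X ω (k + 1)) P)
    (hX_law : ∀ k ≥ 1, P.map (fun ω => X ω k) = expMeasure 1)
    (r : ℕ → ℕ) (hr : Hiring.IsRankSequence r)
    (hdiv : Tendsto (fun m : ℕ => ∑ k ∈ Finset.Icc 1 m, Hiring.delta r k / (r k : ℝ)) atTop atTop)
    (hr_top : Tendsto r atTop atTop) :
    -- `P_n` is the conditional probability that candidate `n` is accepted, given the past
    (∀ n ≥ 1,
      P⟦{ω | Hiring.Accepted r (X ω) n} |
          ⨆ k ∈ Finset.Icc 1 (n - 1), MeasurableSpace.comap (fun ω => X ω k) inferInstance⟧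
        =ᵐ[P] fun ω => Hiring.acceptProb r (X ω) n) ∧
    -- on `[n - a_n / P_n, n]` the acceptance indicators agree w.h.p. with indicators that are
    -- conditionally i.i.d. given `P_n`; these live on an extension of the probability space
    (∃ (a : ℕ → ℝ) (ν : ℕ → Measure (Ω × (ℕ → Bool))),
      Tendsto a atTop atTop ∧
      (∀ n, (ν n).map Prod.fst = P ∧
        Hiring.CondIIDBernoulli (ν n) (fun w => Hiring.acceptProb r (X w.1) n)
          (fun k w => w.2 k)) ∧
      Tendsto (fun n : ℕ => ν n {w |
          1 ≤ (n : ℝ) - a n * (Hiring.acceptProb r (X w.1) n)⁻¹ ∧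
          ∀ k : ℕ, (n : ℝ) - a n * (Hiring.acceptProb r (X w.1) n)⁻¹ ≤ k → k ≤ n →
            (Hiring.Accepted r (X w.1) k ↔ w.2 k = true)})
        atTop (𝓝 1)) ∧
    -- the conditional law of `L_n` given `P_n` approaches the geometric distribution
    TendstoInMeasure P
      (fun n ω => Hiring.dTV
        (condDistrib (fun ω' => Hiring.lastGap r (X ω') n)
          (fun ω' => Hiring.acceptProb r (X ω') n) P (Hiring.acceptProb r (X ω) n))
        (Hiring.geomFromOne (Hiring.acceptProb r (X ω) n)))
      atTop (fun _ => 0) ∧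
    -- conditionally on `P_n`, `P_n * L_n` converges in distribution to `Exp(1)`
    Hiring.CondTendstoInDistribution P
      (fun n ω => Hiring.acceptProb r (X ω) n * (Hiring.lastGap r (X ω) n : ℝ))
      (fun n ω => Hiring.acceptProb r (X ω) n) (expMeasure 1) := by
  have h : Hiring.IsExpSequence P X := ⟨hX_meas, hX_indep, hX_law⟩
  exact ⟨fun n hn => h.condExp_accepted hr hn, h.exists_coupling_sequence hr hdiv hr_top,
    h.tendstoInMeasure_dTV hr hdiv hr_top, h.condTendstoInDistribution hr hdiv hr_top⟩
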